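/- Let $V:\mathbb R^3\to[0,\infty)$ be a bounded, measurable, spherically symmetric function of finite range. For a cubic box $\Lambda$ with side length $L$ and $N\in\mathbb N$, let $H_{N,\Lambda}^{D}$ and $H_{N,\Lambda}^{P}$ be the self-adjoint Hamiltonians $$-\sum_{i=1}^N\Delta_i+\sum_{1\le i<j\le N}V(x_i-x_j)$$ on the space $\mathcal H_{N,\Lambda}$ of symmetric functions in $L^2(\Lambda^N)$, with Dirichlet and periodic boundary conditions respectively (in the periodic case $x_i-x_j$ is understood on the torus $\mathbb R^3/L\mathbb Z^3$). For $\beta>0$ and $\rho=N/|\Lambda|$ let $$f^{D(P)}(\rho,\Lambda,\beta)=-\frac1{|\Lambda|\beta}\ln\operatorname{Tr}_{\mathcal H_{N,\Lambda}}e^{-\beta H^{D(P)}_{N,\Lambda}}$$ be the free energies per unit volume. For $\rho>0$ let $\Lambda=\Lambda(\rho)$ be the cubic box of volume $|\Lambda|=\rho^{-41/20}$, let $\Lambda^*$ be the cubic box of volume $$|\Lambda^*|=|\Lambda|\,(1+2\rho^{41/120})^3,\qquad\text{and let}\qquad \rho^*=\rho\,(1+2\rho^{41/120})^{-3},$$ so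 that $\rho^*|\Lambda^*|=\rho|\Lambda|$. Below, $\rho\to0$ through the positive values for which $N=\rho|\Lambda|$ is an integer. Let $\beta=\beta(\rho)$ be such that $\lim_{\rho\to0}\rho^{2/3}\beta(\rho)$ exists and lies in $(0,\infty)$. If there is a constant $C$ such that $$f^{P}(\rho,\Lambda,\beta)\le C\rho^{5/3}$$ for all sufficiently small such $\rho$, then $$\limsup_{\rho\to0}\Big(f^{D}(\rho^*,\Lambda^*,\beta)-f^{P}(\rho,\Lambda,\beta)\Big)\rho^{-2}\le0 .$$ -/

import Mathlib

open MeasureTheory Filter Topology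
open scoped ENNReal ContDiff

noncomputable section

namespace BoseGas

/-! ### Self-adjoint operators, their heat operators and traces -/

section Operators

variable {E : Type*} [NormedAddCommGroup E] [InnerProductSpace ℂ E] [CompleteSpace E]

/-- An unbounded operator on `E` is given by its graph `A : Set (E × E)`, that is,
`(u, f) ∈ A` means that `u` lies in the domain of the operator and is mapped to `f`.

The form domain of `A`: limits `u` of sequences `uₙ` in the domain of `A` which are Cauchy for the
quadratic form, `⟪uₙ - uₘ, A (uₙ - uₘ)⟫ → 0` as `n, m → ∞`. -/
def formDomain (A : Set (E × E)) : Set E :=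
  {u | ∃ p : ℕ → E × E, (∀ n, p n ∈ A) ∧ Tendsto (fun n => (p n).1) atTop (𝓝 u) ∧
    Tendsto (fun nm : ℕ × ℕ =>
      inner ℂ ((p nm.1).1 - (p nm.2).1) ((p nm.1).2 - (p nm.2).2)) (atTop ×ˢ atTop) (𝓝 0)}

/-- The Friedrichs extension of a symmetric non-negative operator: the restriction of the
adjoint of `A` to the form domain of `A`. -/
def friedrichs (A : Set (E × E)) : Set (E × E) :=
  {q | q.1 ∈ formDomain A ∧ ∀ p ∈ A, inner ℂ p.2 q.1 = inner ℂ p.1 q.2}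

/-- `R = (1 + T)⁻¹` is an everywhere defined bounded operator: `R f = u` if and only if `u` is in
the domain of `T` and `T u + u = f`. -/
def IsResolvent (T : Set (E × E)) (R : E →L[ℂ] E) : Prop :=
  ∀ f u : E, R f = u ↔ (u, f - u) ∈ T

open Classical in
/-- The operator `(1 + T)⁻¹` of a non-negative self-adjoint operator `T`
(zero if there is no such bounded operator). -/
def invOneAdd (T : Set (E × E)) : E →L[ℂ] E :=
  if h : ∃ R : E →L[ℂ] E, IsResolvent T R then h.choose else 0

/-- The operator `exp (-β T)` of a non-negative self-adjoint operator `T`, through the functional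
calculus of `R = (1 + T)⁻¹`: a spectral value `t` of `T` corresponds to the spectral value
`x = (1 + t)⁻¹` of `R`, and `exp (-β t) = exp (-β (x⁻¹ - 1))`. The value at `x = 0` is the
limit as `t → ∞`. -/
def expNeg (β : ℝ) (T : Set (E × E)) : E →L[ℂ] E :=
  cfc (fun x : ℝ => if 0 < x then Real.exp (-β * (x⁻¹ - 1)) else 0) (invOneAdd T)

/-- The trace `∑ᵢ ⟪eᵢ, B eᵢ⟫ ∈ [0, ∞]` of a non-negative bounded operator `B`, computed in an
orthonormal basis (its value does not depend on the basis). -/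
def trace (B : E →L[ℂ] E) : ℝ≥0∞ :=
  ∑' i : (exists_hilbertBasis ℂ E).choose,
    ENNReal.ofReal (RCLike.re (inner ℂ (i : E) (B (i : E))))

end Operators

/-! ### The `N`-particle Hilbert space -/

/-- Positions of `N` particles in `ℝ³`. -/
abbrev Config (N : ℕ) : Type := Fin N → EuclideanSpace ℝ (Fin 3)

/-- The set `Λ ^ N` for the open cubic box `Λ = (0, L)³`. -/
def box (N : ℕ) (L : ℝ) : Set (Config N) := {x | ∀ i k, x i k ∈ Set.Ioo 0 L}

/-- Lebesgue measure on `Λ ^ N`. -/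
abbrev boxMeasure (N : ℕ) (L : ℝ) : Measure (Config N) := volume.restrict (box N L)

theorem measurePreserving_perm (N : ℕ) (L : ℝ) (σ : Equiv.Perm (Fin N)) :
    MeasurePreserving (fun x : Config N => fun i => x (σ i)) (boxMeasure N L) (boxMeasure N L) := by
  have h0 : MeasurePreserving (fun x : Config N => fun i => x (σ i)) volume volume := by
    have h := volume_measurePreserving_piCongrLeft
      (fun _ : Fin N => EuclideanSpace ℝ (Fin 3)) σ.symm
    convert h using 1
    funext x i
    have := MeasurableEquiv.piCongrLeft_apply_apply (β := fun _ : Fin N => EuclideanSpace ℝ (Fin 3))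
      σ.symm x (σ i)
    simpa using this.symm
  have hb : MeasurableSet (box N L) := by
    have : box N L = ⋂ i, ⋂ k, (fun x : Config N => x i k) ⁻¹' Set.Ioo 0 L := by
      ext x; simp [box]
    rw [this]
    refine MeasurableSet.iInter fun i => MeasurableSet.iInter fun k => ?_
    exact (by fun_prop : Measurable fun x : Config N => x i k) measurableSet_Ioo
  have h := h0.restrict_preimage hb
  have hp : (fun x : Config N => fun i => x (σ i)) ⁻¹' box N L = box N L := by
    ext x
    exact ⟨fun hx i k => by simpa using hx (σ.symm i) k, fun hx i k => hx (σ i) k⟩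
  rwa [hp] at h

/-- The Hilbert space of `N` bosons: the square-integrable functions on `Λ ^ N` which
are symmetric under permutations of the particles. -/
def bosonSpace (N : ℕ) (L : ℝ) : Submodule ℂ (Lp ℂ 2 (boxMeasure N L)) where
  carrier := {ψ | ∀ σ : Equiv.Perm (Fin N), (fun x => ψ (fun i => x (σ i))) =ᵐ[boxMeasure N L] ψ}
  zero_mem' σ := by
    have h0 := Lp.coeFn_zero ℂ 2 (boxMeasure N L)
    have h1 := (measurePreserving_perm N L σ).quasiMeasurePreserving.ae_eq_comp h0
    exact h1.trans h0.symm
  add_mem' {a b} ha hb σ := by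
    have h0 := Lp.coeFn_add a b
    have h1 := (measurePreserving_perm N L σ).quasiMeasurePreserving.ae_eq_comp h0
    filter_upwards [h0, h1, ha σ, hb σ] with x e0 e1 e2 e3
    simp only [Function.comp_apply, Pi.add_apply] at e0 e1 e2 e3 ⊢
    rw [e0, e1, e2, e3]
  smul_mem' c a ha σ := by
    have h0 := Lp.coeFn_smul c a
    have h1 := (measurePreserving_perm N L σ).quasiMeasurePreserving.ae_eq_comp h0
    filter_upwards [h0, h1, ha σ] with x e0 e1 e2
    simp only [Function.comp_apply, Pi.smul_apply] at e0 e1 e2 ⊢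
    rw [e0, e1, e2]

theorem isClosed_bosonSpace (N : ℕ) (L : ℝ) :
    IsClosed (bosonSpace N L : Set (Lp ℂ 2 (boxMeasure N L))) := by
  have h : (bosonSpace N L : Set (Lp ℂ 2 (boxMeasure N L))) =
      ⋂ σ : Equiv.Perm (Fin N),
        {ψ | Lp.compMeasurePreserving _ (measurePreserving_perm N L σ) ψ = ψ} := by
    ext ψ
    rw [Set.mem_iInter]
    refine forall_congr' fun σ => ?_
    have h1 := Lp.coeFn_compMeasurePreserving ψ (measurePreserving_perm N L σ)
    change _ ↔ Lp.compMeasurePreserving _ (measurePreserving_perm N L σ) ψ = ψ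
    rw [Lp.ext_iff]
    exact ⟨fun h2 => h1.trans h2, fun h2 => h1.symm.trans h2⟩
  rw [h]
  exact isClosed_iInter fun σ => isClosed_eq
    (Lp.isometry_compMeasurePreserving (measurePreserving_perm N L σ)).continuous continuous_id

instance (N : ℕ) (L : ℝ) : CompleteSpace (bosonSpace N L) :=
  (isClosed_bosonSpace N L).completeSpace_coe

/-! ### Hamiltonians -/

/-- `φ` is symmetric under permutations of the particles. -/
def IsSymmetric {N : ℕ} (φ : Config N → ℂ) : Prop :=
  ∀ (σ : Equiv.Perm (Fin N)) (x : Config N), φ (fun i => x (σ i)) = φ x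

/-- The core of the Dirichlet Hamiltonian: smooth symmetric functions with compact support in the
open set `Λ ^ N`. -/
def DirichletCore (N : ℕ) (L : ℝ) : Set (Config N → ℂ) :=
  {φ | ContDiff ℝ ∞ φ ∧ IsSymmetric φ ∧ HasCompactSupport φ ∧ tsupport φ ⊆ box N L}

/-- The core of the periodic Hamiltonian: smooth symmetric functions on `ℝ ^ (3N)` which have
period `L` in each coordinate of each particle. -/
def PeriodicCore (N : ℕ) (L : ℝ) : Set (Config N → ℂ) :=
  {φ | ContDiff ℝ ∞ φ ∧ IsSymmetric φ ∧
    ∀ (x : Config N) (i : Fin N) (k : Fin 3),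
      φ (x + Pi.single i (EuclideanSpace.single k L)) = φ x}

/-- `(H φ) (x) = - ∑ᵢ (Δᵢ φ) (x) + ∑_{i < j} W (xᵢ - xⱼ) φ (x)`. -/
def hamiltonianApply {N : ℕ} (W : EuclideanSpace ℝ (Fin 3) → ℝ) (φ : Config N → ℂ)
    (x : Config N) : ℂ :=
  -∑ i, Laplacian.laplacian (fun y => φ (Function.update x i y)) (x i)
    + ((∑ i, ∑ j ∈ Finset.Ioi i, W (x i - x j) : ℝ) : ℂ) * φ x

/-- The (graph of the) operator `φ ↦ H φ` with domain the given core of smooth functions. -/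
def coreHamiltonian (N : ℕ) (L : ℝ) (W : EuclideanSpace ℝ (Fin 3) → ℝ)
    (core : Set (Config N → ℂ)) : Set (bosonSpace N L × bosonSpace N L) :=
  {p | ∃ φ ∈ core, (p.1 : Lp ℂ 2 (boxMeasure N L)) =ᵐ[boxMeasure N L] φ ∧
    (p.2 : Lp ℂ 2 (boxMeasure N L)) =ᵐ[boxMeasure N L] hamiltonianApply W φ}

/-- The representative in `[-L/2, L/2]³` of a point of `ℝ³` modulo `L ℤ³`. Its norm is the distance
to the origin on the torus `ℝ³ / L ℤ³`. -/
def torusRep (L : ℝ) (x : EuclideanSpace ℝ (Fin 3)) : EuclideanSpace ℝ (Fin 3) :=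
  WithLp.toLp 2 fun k => x k - L * round (x k / L)

/-- The Hamiltonian `H_{N,Λ}` with Dirichlet boundary conditions, `Λ = (0, L)³`. -/
def dirichletHamiltonian (V : EuclideanSpace ℝ (Fin 3) → ℝ) (N : ℕ) (L : ℝ) :
    Set (bosonSpace N L × bosonSpace N L) :=
  friedrichs (coreHamiltonian N L V (DirichletCore N L))

/-- The Hamiltonian `H_{N,Λ}` with periodic boundary conditions, `Λ = (0, L)³`; the particles
interact through their distance on the torus. -/
def periodicHamiltonian (V : EuclideanSpace ℝ (Fin 3) → ℝ) (N : ℕ) (L : ℝ) :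
    Set (bosonSpace N L × bosonSpace N L) :=
  friedrichs (coreHamiltonian N L (fun x => V (torusRep L x)) (PeriodicCore N L))

/-! ### Free energies -/

/-- `-(|Λ| β)⁻¹ ln Z`, as an extended real number (`Z = ∞` gives `-∞`). -/
def freeEnergyOf (vol β : ℝ) (Z : ℝ≥0∞) : EReal :=
  -((((vol * β)⁻¹ : ℝ) : EReal) * ENNReal.log Z)

/-- Side length of a cube of volume `vol`. -/
def side (vol : ℝ) : ℝ := vol ^ (1 / 3 : ℝ)

/-- Number of particles at density `ρ` in volume `vol`; this is `N = ρ |Λ|` whenever `ρ |Λ|` is a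
natural number. -/
def particleNumber (ρ vol : ℝ) : ℕ := ⌊ρ * vol⌋₊

/-- The free energy per unit volume `f^D(ρ, Λ, β)` for Dirichlet boundary conditions in a cube of
volume `vol`. -/
def freeEnergyD (V : EuclideanSpace ℝ (Fin 3) → ℝ) (ρ vol β : ℝ) : EReal :=
  freeEnergyOf vol β
    (trace (expNeg β (dirichletHamiltonian V (particleNumber ρ vol) (side vol))))

/-- The free energy per unit volume `f^P(ρ, Λ, β)` for periodic boundary conditions in a cube of
volume `vol`. -/
def freeEnergyP (V : EuclideanSpace ℝ (Fin 3) → ℝ) (ρ vol β : ℝ) : EReal :=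
  freeEnergyOf vol β
    (trace (expNeg β (periodicHamiltonian V (particleNumber ρ vol) (side vol))))

/-- The volume `|Λ| = ρ^{-41/20}`. -/
def boxVol (ρ : ℝ) : ℝ := ρ ^ (-(41 / 20) : ℝ)

/-- The volume `|Λ*| = |Λ| (1 + 2 ρ^{41/120})³` of the revised box. -/
def boxVolStar (ρ : ℝ) : ℝ := boxVol ρ * (1 + 2 * ρ ^ (41 / 120 : ℝ)) ^ 3

/-- The revised density `ρ* = ρ (1 + 2 ρ^{41/120})⁻³`. -/
def densityStar (ρ : ℝ) : ℝ := ρ * ((1 + 2 * ρ ^ (41 / 120 : ℝ)) ^ 3)⁻¹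

/-- The densities `ρ > 0` for which `N = ρ |Λ|` is a natural number, where `|Λ| = ρ^{-41/20}`. -/
def admissibleDensities : Set ℝ := {ρ | 0 < ρ ∧ ∃ N : ℕ, ρ * boxVol ρ = N}

end BoseGas

end

open MeasureTheory Filter Topology
open scoped ENNReal ContDiff

noncomputable section

/-! Write `ℓ = ρ^{-41/60}` for the side of `Λ` and `κ = ρ^{41/120}`, so that `Λ*` has side `ℓ(1+2κ)`
and holds the same number `N` of particles. A periodic function is turned into a Dirichlet function
by multiplying it with a product of one-dimensional cutoffs `h`, supported inside `(0, ℓ+δ)` and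
with `h(t)² + h(t+ℓ)² = 1` on one period. Since `h²` periodizes to `1`, this map is isometric from
the torus to the larger box, and it does not increase the interaction, because the torus potential
dominates `V` as soon as `ℓ` exceeds twice the range. By the localization formula the kinetic energy
grows only by a potential of size `C/δ²` living on slabs of width `δ`: the cross term is a total
derivative on the torus and integrates to zero.

With `δ = ℓ/M` the cutoff can be translated to `M` positions whose slabs are disjoint, so the
average error is `ε = 3NCM/ℓ²`, smaller by a factor `M` than for a fixed cutoff. The Peierls
inequality, applied to the images of the eigenvectors of the periodic Hamiltonian, bounds the
Dirichlet trace below by a sum of exponentials for each translate, and convexity in the translate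
gives `exp(-βε) Z^P ≤ Z^D` (`trace_comparison`, `exists_partition_comparison`).

The two free energies are divided by different volumes, which costs `(1/|Λ| - 1/|Λ*|) β⁻¹ ln Z^P`.
This needs an a priori upper bound on `Z^P`: dropping the interaction and the symmetry constraint
bounds it by the partition function of `3N` free one-dimensional modes, so that `ln Z^P` is of order
`N` up to a logarithm of `ρ`. After multiplication by `ρ^{-2}` the volume term is of order
`ρ^{1/120}` up to that logarithm, and the localization term of order `ρ^{1/40}` (`scaled_error_le`).
Without the averaging over translates the latter would be `ρ^{-19/60}` and the argument would fail.

The operators are defined through graphs and Friedrichs extensions, so the functional analysis is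
built as well: the resolvent `(1+T)⁻¹` is `ι ι*` for the embedding `ι` of the form space; it is
compact in the periodic case because plane waves have energies tending to infinity, which provides
the eigenvectors. On the Dirichlet side only a tangent line inequality for the heat operator on the
core is needed. -/

namespace BoseGas

/-! ### Form space, Friedrichs extension and resolvent of a non-negative symmetric operator. -/

section Friedrichs

universe u

variable {E : Type u} [NormedAddCommGroup E] [InnerProductSpace ℂ E]

/-- A linear graph which is symmetric and non-negative. -/
structure IsNonnegSymmetric (S : Submodule ℂ (E × E)) : Prop where
  symm : ∀ p ∈ S, ∀ q ∈ S, inner ℂ p.2 q.1 = inner ℂ p.1 q.2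
  nonneg : ∀ p ∈ S, 0 ≤ (inner ℂ p.1 p.2).re

/-- The form inner product `⟪u, v⟫ + ⟪u, A v⟫` on the graph of a symmetric operator. -/
@[reducible]
def formCore {S : Submodule ℂ (E × E)} (hS : IsNonnegSymmetric S) :
    PreInnerProductSpace.Core ℂ S where
  inner p q := inner ℂ (p : E × E).1 (q : E × E).1 + inner ℂ (p : E × E).1 (q : E × E).2
  conj_inner_symm p q := by
    rw [map_add, inner_conj_symm, inner_conj_symm, hS.symm p p.2 q q.2]
  re_inner_nonneg p := by
    have h := hS.nonneg p p.2
    have h2 : 0 ≤ (inner ℂ (p : E × E).1 (p : E × E).1).re := inner_self_nonneg (𝕜 := ℂ)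
    simpa using add_nonneg h2 h
  add_left p q r := by
    simp only [Submodule.coe_add, Prod.fst_add, inner_add_left]; ring
  smul_left p q r := by
    simp only [Submodule.coe_smul, Prod.smul_fst, inner_smul_left]; ring

/-- The completion of a space with a positive semidefinite inner product. -/
theorem exists_hilbert_completion {F : Type u} [AddCommGroup F] [Module ℂ F]
    (c : PreInnerProductSpace.Core ℂ F) :
    ∃ (G : Type u) (_ : NormedAddCommGroup G) (_ : InnerProductSpace ℂ G) (_ : CompleteSpace G)
      (j : F →ₗ[ℂ] G), DenseRange j ∧ ∀ p q : F, inner ℂ (j p) (j q) = c.inner p q := by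
  let _ : SeminormedAddCommGroup F :=
    InnerProductSpace.Core.toSeminormedAddCommGroup (𝕜 := ℂ) (F := F)
  let _ : InnerProductSpace ℂ F := InnerProductSpace.ofCore c
  exact ⟨UniformSpace.Completion F, inferInstance, inferInstance, inferInstance,
    (UniformSpace.Completion.toComplL : F →L[ℂ] UniformSpace.Completion F).toLinearMap,
    UniformSpace.Completion.denseRange_coe, fun p q => UniformSpace.Completion.inner_coe p q⟩

variable {S : Submodule ℂ (E × E)}

theorem subset_friedrichs (hS : IsNonnegSymmetric S) : (S : Set (E × E)) ⊆ friedrichs S := by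
  intro p hp
  refine ⟨⟨fun _ => p, fun _ => hp, tendsto_const_nhds, ?_⟩, fun q hq => hS.symm q hq p hp⟩
  simp

/-- The form space of a non-negative symmetric operator and its map to the underlying space. -/
theorem exists_form_space (hS : IsNonnegSymmetric S) [CompleteSpace E] :
    ∃ (G : Type u) (_ : NormedAddCommGroup G) (_ : InnerProductSpace ℂ G) (_ : CompleteSpace G)
      (j : S →ₗ[ℂ] G) (ι : G →L[ℂ] E), DenseRange j ∧
      (∀ p q : S, inner ℂ (j p) (j q) =
        inner ℂ (p : E × E).1 (q : E × E).1 + inner ℂ (p : E × E).1 (q : E × E).2) ∧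
      (∀ p : S, ι (j p) = (p : E × E).1) ∧ ‖ι‖ ≤ 1 ∧
      (∀ (p : S) (w : G),
        inner ℂ (p : E × E).1 (ι w) + inner ℂ (p : E × E).2 (ι w) = inner ℂ (j p) w) ∧
      ∀ (u : E) (p : ℕ → S), Tendsto (fun n => (p n : E × E).1) atTop (𝓝 u) →
        Tendsto (fun nm : ℕ × ℕ => inner ℂ ((p nm.1 : E × E).1 - (p nm.2 : E × E).1)
          ((p nm.1 : E × E).2 - (p nm.2 : E × E).2)) (atTop ×ˢ atTop) (𝓝 0) →
        ∃ w, Tendsto (fun n => j (p n)) atTop (𝓝 w) ∧ ι w = u := by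
  obtain ⟨G, _, _, _, j, hj, hjin'⟩ := exists_hilbert_completion (formCore hS)
  have hjin : ∀ p q : S, inner ℂ (j p) (j q) =
    inner ℂ (p : E × E).1 (q : E × E).1 + inner ℂ (p : E × E).1 (q : E × E).2 := hjin'
  let f : S →ₗ[ℂ] E := (LinearMap.fst ℂ E E).comp S.subtype
  have hf : ∀ p, ‖f p‖ ≤ 1 * ‖j p‖ := by
    intro p
    rw [one_mul]
    refine le_of_sq_le_sq ?_ (norm_nonneg _)
    rw [← inner_self_eq_norm_sq (𝕜 := ℂ), ← inner_self_eq_norm_sq (𝕜 := ℂ), hjin]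
    have := hS.nonneg p p.2
    simpa [f] using this
  let ι : G →L[ℂ] E := f.extendOfNorm j
  have hι : ∀ p : S, ι (j p) = (p : E × E).1 := fun p =>
    LinearMap.extendOfNorm_eq hj ⟨1, hf⟩ p
  have hιn : ‖ι‖ ≤ 1 := LinearMap.opNorm_extendOfNorm_le hj zero_le_one hf
  have hnorm : ∀ p : S, ‖j p‖ ^ 2 = ‖(p : E × E).1‖ ^ 2 +
      (inner ℂ (p : E × E).1 (p : E × E).2).re := by
    intro p
    rw [← inner_self_eq_norm_sq (𝕜 := ℂ), ← inner_self_eq_norm_sq (𝕜 := ℂ), hjin]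
    simp
  refine ⟨G, inferInstance, inferInstance, inferInstance, j, ι, hj, hjin, hι, hιn, ?_, ?_⟩
  -- Both sides are continuous in `w`, so it suffices to check the identity on the dense range of
  -- `j`, where it is the definition of the form inner product together with symmetry.
  · intro p w
    refine hj.induction_on (p := fun w => inner ℂ (p : E × E).1 (ι w) +
      inner ℂ (p : E × E).2 (ι w) = inner ℂ (j p) w) w
      (isClosed_eq (by fun_prop) (by fun_prop)) fun q => ?_
    rw [hι, hjin, hS.symm p p.2 q q.2]
  · intro u p hpu hpc
    have hc : CauchySeq fun n => j (p n) := by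
      rw [cauchySeq_iff_tendsto_dist_atTop_0]
      have h1 : Tendsto (fun nm : ℕ × ℕ => ‖(p nm.1 : E × E).1 - (p nm.2 : E × E).1‖ ^ 2)
          (atTop ×ˢ atTop) (𝓝 0) := by
        have h0 : Tendsto (fun nm : ℕ × ℕ => (p nm.1 : E × E).1 - (p nm.2 : E × E).1)
          (atTop ×ˢ atTop) (𝓝 (u - u)) := (hpu.comp tendsto_fst).sub (hpu.comp tendsto_snd)
        simpa using h0.norm.pow 2
      have h2 := (Complex.continuous_re.tendsto 0).comp hpc
      have h3 := (h1.add h2).sqrt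
      simp only [Complex.zero_re, add_zero, Real.sqrt_zero] at h3
      rw [← prod_atTop_atTop_eq]
      refine h3.congr fun nm => ?_
      have h4 := hnorm (p nm.1 - p nm.2)
      simp only [Submodule.coe_sub, Prod.fst_sub, Prod.snd_sub] at h4
      rw [dist_eq_norm, ← map_sub]
      simp only [Function.comp_apply]
      rw [← h4, Real.sqrt_sq (norm_nonneg _)]
    obtain ⟨w, hw⟩ := cauchySeq_tendsto_of_complete hc
    refine ⟨w, hw, tendsto_nhds_unique ((ι.continuous.tendsto w).comp hw) ?_⟩
    exact hpu.congr fun n => (hι (p n)).symm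

/-- The Friedrichs extension of a non-negative symmetric operator is non-negative self-adjoint. -/
theorem exists_isResolvent_friedrichs [CompleteSpace E] (hS : IsNonnegSymmetric S) :
    ∃ R : E →L[ℂ] E, IsResolvent (friedrichs (S : Set (E × E))) R ∧ R.IsPositive ∧ ‖R‖ ≤ 1 := by
  obtain ⟨G, _, _, _, j, ι, hj, hjin, hι, hιn, key, hlim⟩ := exists_form_space hS
  have hfd : ∀ u ∈ formDomain (S : Set (E × E)), ∃ w, ι w = u := by
    rintro u ⟨p, hp, hpu, hpc⟩
    obtain ⟨w, -, hw⟩ := hlim u (fun n => ⟨p n, hp n⟩) hpu hpc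
    exact ⟨w, hw⟩
  have hfd' : ∀ w, ι w ∈ formDomain (S : Set (E × E)) := by
    intro w
    have hw : w ∈ closure (Set.range j) := hj w
    obtain ⟨x, hx, hxw⟩ := mem_closure_iff_seq_limit.1 hw
    choose p hp using hx
    refine ⟨fun n => p n, fun n => (p n).2, ?_, ?_⟩
    · have := (ι.continuous.tendsto w).comp hxw
      refine this.congr fun n => ?_
      simp only [Function.comp_apply]
      rw [← hp, hι]
    · have h0 : Tendsto (fun nm : ℕ × ℕ => x nm.1 - x nm.2) (atTop ×ˢ atTop) (𝓝 (w - w)) :=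
        (hxw.comp tendsto_fst).sub (hxw.comp tendsto_snd)
      have h1 := h0.inner (𝕜 := ℂ) h0
      have h2 := (ι.continuous.tendsto _).comp h0
      have h3 := h2.inner (𝕜 := ℂ) h2
      have h4 := h1.sub h3
      simp only [sub_self, map_zero, inner_zero_left] at h4
      refine h4.congr fun nm => ?_
      simp only [Function.comp_apply]
      rw [← hp, ← hp, ← map_sub, hι, hjin]
      simp
  -- By Riesz, `ι* g` represents the functional `v ↦ ⟪g, ι v⟫` on the form space, so `ι ι* g` is the
  -- weak solution of `T u + u = g`. Positivity and the norm bound are immediate for this operator.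
  refine ⟨ι.comp (ContinuousLinearMap.adjoint ι), ?_, ι.isPositive_self_comp_adjoint, ?_⟩
  · intro g u
    constructor
    · rintro rfl
      refine ⟨hfd' _, fun p hp => ?_⟩
      have h := key ⟨p, hp⟩ (ContinuousLinearMap.adjoint ι g)
      rw [ContinuousLinearMap.adjoint_inner_right, hι] at h
      simp only [ContinuousLinearMap.comp_apply, inner_sub_right]
      rw [← h]; ring
    · rintro ⟨hu, hup⟩
      -- Any preimage `w` of `u` is good enough: pairing with the dense vectors `j p` forces `w = ι*
      -- g`, so injectivity of `ι` never enters.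
      obtain ⟨w, rfl⟩ := hfd u hu
      have : w = ContinuousLinearMap.adjoint ι g := by
        refine hj.eq_of_inner_left (𝕜 := ℂ) ?_
        intro p
        rw [← inner_conj_symm, ← inner_conj_symm (ContinuousLinearMap.adjoint ι g)]
        congr 1
        rw [← key, ContinuousLinearMap.adjoint_inner_right, hι, hup p p.2, inner_sub_right]
        ring
      rw [ContinuousLinearMap.comp_apply, this]
  · refine (ContinuousLinearMap.opNorm_comp_le _ _).trans ?_
    rw [LinearIsometryEquiv.norm_map]
    exact mul_le_one₀ hιn (norm_nonneg _) hιn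

theorem IsResolvent.unique {T : Set (E × E)} {R R' : E →L[ℂ] E} (h : IsResolvent T R)
    (h' : IsResolvent T R') : R = R' := by
  ext f
  exact ((h' f (R f)).2 ((h f (R f)).1 rfl)).symm

theorem IsResolvent.invOneAdd_eq {T : Set (E × E)} {R : E →L[ℂ] E} (h : IsResolvent T R) :
    invOneAdd T = R := by
  have hex : ∃ R : E →L[ℂ] E, IsResolvent T R := ⟨R, h⟩
  rw [invOneAdd, dif_pos hex]
  exact hex.choose_spec.unique h

theorem isResolvent_invOneAdd_friedrichs [CompleteSpace E] (hS : IsNonnegSymmetric S) :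
    IsResolvent (friedrichs (S : Set (E × E))) (invOneAdd (friedrichs (S : Set (E × E)))) := by
  obtain ⟨R, h, -⟩ := exists_isResolvent_friedrichs hS
  rwa [h.invOneAdd_eq]

theorem isPositive_invOneAdd_friedrichs [CompleteSpace E] (hS : IsNonnegSymmetric S) :
    (invOneAdd (friedrichs (S : Set (E × E)))).IsPositive := by
  obtain ⟨R, h, h', -⟩ := exists_isResolvent_friedrichs hS
  rwa [h.invOneAdd_eq]

/-- Vectors in the domain of the Friedrichs extension are approximated by vectors of the core
together with their energy. -/
theorem exists_seq_of_mem_friedrichs [CompleteSpace E] (hS : IsNonnegSymmetric S) {u g : E}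
    (h : (u, g) ∈ friedrichs (S : Set (E × E))) :
    ∃ p : ℕ → E × E, (∀ n, p n ∈ S) ∧ Tendsto (fun n => (p n).1) atTop (𝓝 u) ∧
      Tendsto (fun n => (inner ℂ (p n).1 (p n).2).re) atTop (𝓝 (inner ℂ u g).re) := by
  obtain ⟨G, _, _, _, j, ι, hj, hjin, hι, hιn, key, hlim⟩ := exists_form_space hS
  obtain ⟨⟨p, hp, hpu, hpc⟩, hug⟩ := h
  obtain ⟨w, hw, rfl⟩ := hlim u (fun n => ⟨p n, hp n⟩) hpu hpc
  refine ⟨p, hp, hpu, ?_⟩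
  -- Pairing `j (p n)` with the limit `w` involves only `(p n).1`, because the defining relation of
  -- the adjoint moves the operator onto `u`; the limit then identifies the energy of `w` with that
  -- of `u`.
  have h1 : inner ℂ w w = inner ℂ (ι w) (ι w) + inner ℂ (ι w) g := by
    refine tendsto_nhds_unique (hw.inner (𝕜 := ℂ) (tendsto_const_nhds (x := w))) ?_
    refine ((hpu.inner (𝕜 := ℂ) (tendsto_const_nhds (x := ι w))).add
      (hpu.inner (𝕜 := ℂ) (tendsto_const_nhds (x := g)))).congr fun n => ?_
    rw [← key, ← hug _ (hp n)]
  have h2 := ((hw.inner (𝕜 := ℂ) hw).sub (hpu.inner (𝕜 := ℂ) hpu))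
  rw [h1, add_sub_cancel_left] at h2
  refine ((Complex.continuous_re.tendsto _).comp h2).congr fun n => ?_
  simp only [Function.comp_apply]
  rw [hjin, add_sub_cancel_left]

end Friedrichs

/-! ### The heat operator and the Peierls inequality on the core. -/

section HeatOperator

universe u

variable {E : Type u} [NormedAddCommGroup E] [InnerProductSpace ℂ E]

/-- The function of the resolvent `(1 + T)⁻¹` which gives the heat operator `exp (-β T)`. -/
def heatFun (β x : ℝ) : ℝ := if 0 < x then Real.exp (-β * (x⁻¹ - 1)) else 0

/-- The gluing function `expNegInvGlue` is smooth across `0`, so this form yields continuity of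
`heatFun` at the spectral value `0` of the resolvent, which corresponds to infinite energy. -/
theorem heatFun_eq {β : ℝ} (hβ : 0 < β) (x : ℝ) :
    heatFun β x = Real.exp β * expNegInvGlue (x / β) := by
  unfold heatFun expNegInvGlue
  by_cases hx : 0 < x
  · rw [if_pos hx, if_neg (not_le.2 (div_pos hx hβ)), ← Real.exp_add]
    congr 1
    rw [inv_div]; ring
  · rw [if_neg hx, if_pos (div_nonpos_of_nonpos_of_nonneg (not_lt.1 hx) hβ.le), mul_zero]

theorem continuous_heatFun {β : ℝ} (hβ : 0 < β) : Continuous (heatFun β) := by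
  have : heatFun β = fun x => Real.exp β * expNegInvGlue (x / β) := funext (heatFun_eq hβ)
  rw [this]
  have := (expNegInvGlue.contDiff (n := 0)).continuous
  fun_prop

theorem heatFun_nonneg (β x : ℝ) : 0 ≤ heatFun β x := by
  unfold heatFun; split_ifs <;> positivity

/-- The tangent line inequality for `exp (-β t)` at `t = s`, in the variable `x = (1 + t)⁻¹`. -/
theorem tangent_le_heatFun (β s : ℝ) {x : ℝ} (hx : 0 ≤ x) :
    Real.exp (-β * s) * (1 + β * s + β) * (x * x) - Real.exp (-β * s) * β * x
      ≤ x * heatFun β x * x := by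
  rcases hx.eq_or_lt with rfl | hx
  · simp
  rw [heatFun, if_pos hx]
  have h1 : Real.exp (-β * (x⁻¹ - 1)) = Real.exp (-β * s) * Real.exp (-β * (x⁻¹ - 1 - s)) := by
    rw [← Real.exp_add]; congr 1; ring
  have h2 := Real.add_one_le_exp (-β * (x⁻¹ - 1 - s))
  -- With `t = x⁻¹ - 1` the tangent line `1 - β(t - s)` is unbounded as `x → 0`; multiplying by `x²`
  -- makes it the polynomial on the left, which is harmless for the functional calculus.
  have h3 : (1 + β * s + β) * (x * x) - β * x = x * (-β * (x⁻¹ - 1 - s) + 1) * x := by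
    field_simp; ring
  rw [h1]
  calc _ = Real.exp (-β * s) * (x * (-β * (x⁻¹ - 1 - s) + 1) * x) := by rw [← h3]; ring
    _ ≤ Real.exp (-β * s) * (x * Real.exp (-β * (x⁻¹ - 1 - s)) * x) := by gcongr
    _ = _ := by ring

variable [CompleteSpace E]

theorem expNeg_eq (β : ℝ) (T : Set (E × E)) : expNeg β T = cfc (heatFun β) (invOneAdd T) := rfl

theorem isPositive_expNeg (β : ℝ) (T : Set (E × E)) : (expNeg β T).IsPositive := by
  rw [← ContinuousLinearMap.nonneg_iff_isPositive, expNeg_eq]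
  exact cfc_nonneg fun x _ => heatFun_nonneg β x

omit [CompleteSpace E] in
theorem re_inner_mono {A B : E →L[ℂ] E} (h : A ≤ B) (u : E) :
    (inner ℂ u (A u)).re ≤ (inner ℂ u (B u)).re := by
  have := (ContinuousLinearMap.le_def A B).1 h |>.re_inner_nonneg_right u
  simp only [_root_.sub_apply, inner_sub_right] at this
  simpa using this

/-- The Peierls inequality, in its tangent line form, for vectors of the core. -/
theorem tangent_le_inner_expNeg {S : Submodule ℂ (E × E)} (hS : IsNonnegSymmetric S) {β : ℝ}
    (hβ : 0 < β) (s : ℝ) {p : E × E} (hp : p ∈ S) :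
    Real.exp (-β * s) * ((1 + β * s) * ‖p.1‖ ^ 2 - β * (inner ℂ p.1 p.2).re) ≤
      (inner ℂ p.1 (expNeg β (friedrichs (S : Set (E × E))) p.1)).re := by
  have hR := isResolvent_invOneAdd_friedrichs hS
  have hpos := isPositive_invOneAdd_friedrichs hS
  rw [expNeg_eq]
  set R := invOneAdd (friedrichs (S : Set (E × E))) with hRdef
  -- A core vector is `R f` with `f = p.1 + p.2`. Hence the inequality sandwiched between two
  -- factors of `R`, evaluated at `f`, is a statement about the heat operator at `p.1` itself.
  have hu : R (p.1 + p.2) = p.1 := by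
    rw [hR, add_sub_cancel_left]
    exact subset_friedrichs hS hp
  have hsa : IsSelfAdjoint R := hpos.isSelfAdjoint
  have hspec : ∀ x ∈ spectrum ℝ R, 0 ≤ x :=
    fun x hx => spectrum_nonneg_of_nonneg ((ContinuousLinearMap.nonneg_iff_isPositive R).2 hpos) hx
  have hc := (continuous_heatFun hβ).continuousOn (s := spectrum ℝ R)
  have h1 : cfc (fun x => x * heatFun β x * x) R = R * cfc (heatFun β) R * R := by
    rw [cfc_mul (fun x => x * heatFun β x) (fun x => x) R, cfc_mul (fun x => x) (heatFun β) R,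
      cfc_id' ℝ R]
  have h2 : cfc (fun x => Real.exp (-β * s) * (1 + β * s + β) * (x * x)
      - Real.exp (-β * s) * β * x) R =
      (Real.exp (-β * s) * (1 + β * s + β)) • (R * R) - (Real.exp (-β * s) * β) • R := by
    rw [cfc_sub _ _ R, cfc_const_mul _ _ R, cfc_const_mul _ _ R, cfc_mul _ _ R, cfc_id' ℝ R]
  have h3 := cfc_mono (a := R) (fun x hx => tangent_le_heatFun β s (hspec x hx))
    (by fun_prop) (by fun_prop)
  rw [h1, h2] at h3
  have hmul : ∀ (A B : E →L[ℂ] E) (u : E), (A * B) u = A (B u) := fun _ _ _ => rfl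
  have h4 := re_inner_mono h3 (p.1 + p.2)
  have hsym : ∀ a b : E, inner ℂ a (R b) = inner ℂ (R a) b := fun a b => (hpos.isSymmetric a b).symm
  simp only [_root_.sub_apply, _root_.smul_apply,
    hmul, hu] at h4
  rw [hsym (p.1 + p.2) (cfc (heatFun β) R p.1), hu] at h4
  refine le_trans (le_of_eq ?_) h4
  rw [inner_sub_right, ← Complex.coe_smul, ← Complex.coe_smul, inner_smul_right, inner_smul_right,
    hsym, hu, inner_add_left, inner_self_eq_norm_sq_to_K]
  have h5 : (inner ℂ p.2 p.1).re = (inner ℂ p.1 p.2).re := inner_re_symm (𝕜 := ℂ) _ _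
  have h6 : ((((‖p.1‖ : ℝ) : ℂ)) ^ 2).re = ‖p.1‖ ^ 2 := by norm_cast
  simp only [Complex.sub_re, Complex.re_ofReal_mul, Complex.add_re, h5, h6, Complex.coe_algebraMap]
  ring

end HeatOperator

/-! ### The trace in different orthonormal systems. -/

section Trace

universe u

variable {E : Type u} [NormedAddCommGroup E] [InnerProductSpace ℂ E] [CompleteSpace E]

omit [CompleteSpace E] in
theorem ofReal_norm_sq_eq_tsum {ι : Type*} (b : HilbertBasis ι ℂ E) (u : E) :
    ENNReal.ofReal (‖u‖ ^ 2) = ∑' i, ENNReal.ofReal (‖inner ℂ (b i) u‖ ^ 2) := by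
  have h := (b.hasSum_inner_mul_inner u u).mapL Complex.reCLM
  have h' : HasSum (fun i => ‖inner ℂ (b i) u‖ ^ 2) (‖u‖ ^ 2) := by
    convert h using 1
    · funext i
      rw [← inner_conj_symm u (b i)]
      simp only [Complex.reCLM_apply]
      rw [← Complex.normSq_eq_conj_mul_self, Complex.ofReal_re, Complex.normSq_eq_norm_sq]
    · rw [← inner_self_eq_norm_sq (𝕜 := ℂ)]; rfl
  rw [← h'.tsum_eq, ENNReal.ofReal_tsum_of_nonneg (fun _ => by positivity) h'.summable]

omit [CompleteSpace E] in
theorem tsum_ofReal_inner_sq_le {ι : Type*} {φ : ι → E} (hφ : Orthonormal ℂ φ) (u : E) :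
    ∑' i, ENNReal.ofReal (‖inner ℂ (φ i) u‖ ^ 2) ≤ ENNReal.ofReal (‖u‖ ^ 2) := by
  rw [← ENNReal.ofReal_tsum_of_nonneg (fun _ => by positivity) (hφ.inner_products_summable u)]
  exact ENNReal.ofReal_le_ofReal (hφ.tsum_inner_products_le u)

/-- Write `B = A²` with `A` positive, expand `‖A φ_i‖²` by Parseval in the basis `b`, exchange the
sums and apply Bessel to the family `φ`. Since `φ` is only orthonormal this covers both basis
independence of the trace and the lower bound used for Peierls. -/
theorem tsum_inner_le_tsum_inner {B : E →L[ℂ] E} (hB : B.IsPositive) {ι κ : Type*} {φ : ι → E}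
    (hφ : Orthonormal ℂ φ) (b : HilbertBasis κ ℂ E) :
    ∑' i, ENNReal.ofReal (inner ℂ (φ i) (B (φ i))).re ≤
      ∑' k, ENNReal.ofReal (inner ℂ (b k) (B (b k))).re := by
  have h0 : 0 ≤ B := (ContinuousLinearMap.nonneg_iff_isPositive B).2 hB
  obtain ⟨A, hA, rfl⟩ : ∃ A : E →L[ℂ] E, A.IsPositive ∧ A * A = B :=
    ⟨CFC.sqrt B, (ContinuousLinearMap.nonneg_iff_isPositive _).1 (CFC.sqrt_nonneg B),
      CFC.sqrt_mul_sqrt_self B h0⟩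
  have hn : ∀ u : E, (inner ℂ u ((A * A) u)).re = ‖A u‖ ^ 2 := by
    intro u
    rw [show (A * A) u = A (A u) from rfl, ← inner_self_eq_norm_sq (𝕜 := ℂ)]
    exact congrArg Complex.re (hA.isSymmetric u (A u)).symm
  simp only [hn]
  calc ∑' i, ENNReal.ofReal (‖A (φ i)‖ ^ 2)
      = ∑' i, ∑' k, ENNReal.ofReal (‖inner ℂ (b k) (A (φ i))‖ ^ 2) :=
        tsum_congr fun i => ofReal_norm_sq_eq_tsum b _
    _ = ∑' k, ∑' i, ENNReal.ofReal (‖inner ℂ (b k) (A (φ i))‖ ^ 2) := ENNReal.tsum_comm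
    _ ≤ ∑' k, ENNReal.ofReal (‖A (b k)‖ ^ 2) := by
        refine ENNReal.tsum_le_tsum fun k => ?_
        refine le_trans (le_of_eq (tsum_congr fun i => ?_)) (tsum_ofReal_inner_sq_le hφ (A (b k)))
        rw [norm_inner_symm]
        exact congrArg (fun z : ℂ => ENNReal.ofReal (‖z‖ ^ 2)) (hA.isSymmetric (φ i) (b k))

theorem tsum_inner_le_trace {B : E →L[ℂ] E} (hB : B.IsPositive) {ι : Type*} {φ : ι → E}
    (hφ : Orthonormal ℂ φ) :
    ∑' i, ENNReal.ofReal (inner ℂ (φ i) (B (φ i))).re ≤ trace B := by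
  obtain ⟨b, hb⟩ := (exists_hilbertBasis ℂ E).choose_spec
  have h := tsum_inner_le_tsum_inner hB hφ b
  rw [hb] at h
  exact h

theorem trace_le_tsum_inner {B : E →L[ℂ] E} (hB : B.IsPositive) {κ : Type*}
    (b : HilbertBasis κ ℂ E) :
    trace B ≤ ∑' k, ENNReal.ofReal (inner ℂ (b k) (B (b k))).re := by
  obtain ⟨b', hb⟩ := (exists_hilbertBasis ℂ E).choose_spec
  have h := tsum_inner_le_tsum_inner hB b'.orthonormal b
  rw [hb] at h
  exact h

end Trace

/-! ### Eigenvectors of a compact resolvent, and compactness from a mode bound. -/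

section Spectral

universe u v

variable {E : Type u} [NormedAddCommGroup E] [InnerProductSpace ℂ E] [CompleteSpace E]

/-- A compact self-adjoint operator has a Hilbert basis of eigenvectors. -/
theorem exists_hilbertBasis_eigenvectors {R : E →L[ℂ] E} (hR : R.IsSymmetric)
    (hc : IsCompactOperator R) :
    ∃ (I : Type u) (b : HilbertBasis I ℂ E) (x : I → ℝ), ∀ i, R (b i) = (x i : ℂ) • b i := by
  let V : ℂ → Submodule ℂ E := fun μ => Module.End.eigenspace (R : Module.End ℂ E) μ
  have hV : ∀ μ, IsClosed (V μ : Set E) := by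
    intro μ
    have : (V μ : Set E) = {v | R v = μ • v} := by
      ext v; exact Module.End.mem_eigenspace_iff
    rw [this]
    exact isClosed_eq (by fun_prop) (by fun_prop)
  have hVc : ∀ μ, CompleteSpace (V μ) := fun μ => (hV μ).completeSpace_coe
  choose w b hb using fun μ => exists_hilbertBasis ℂ (V μ)
  have hon : Orthonormal ℂ (fun a : Σ μ, w μ => ((b a.1 a.2 : V a.1) : E)) :=
    hR.orthogonalFamily_eigenspaces.orthonormal_sigma_orthonormal (fun μ => (b μ).orthonormal)
  have hperp : (Submodule.span ℂ (Set.range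
      (fun a : Σ μ, w μ => ((b a.1 a.2 : V a.1) : E))))ᗮ = ⊥ := by
    rw [eq_bot_iff, ← ContinuousLinearMap.orthogonalComplement_iSup_eigenspaces_eq_bot hc hR]
    intro v hv
    rw [Submodule.mem_orthogonal] at hv
    have hv' : ∀ μ, ∀ z ∈ V μ, inner ℂ z v = 0 := by
      intro μ z hz
      have hd := (b μ).dense_span
      have hz' : (⟨z, hz⟩ : V μ) ∈ (Submodule.span ℂ (Set.range (b μ))).topologicalClosure := by
        rw [hd]; trivial
      have hcl : IsClosed {y : V μ | inner ℂ (y : E) v = 0} :=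
        isClosed_eq (by fun_prop) continuous_const
      refine closure_minimal (s := (Submodule.span ℂ (Set.range (b μ)) : Set (V μ))) ?_ hcl hz'
      intro y hy
      refine Submodule.span_induction (p := fun y _ => inner ℂ ((y : V μ) : E) v = 0)
        ?_ (by simp) ?_ ?_ hy
      · rintro _ ⟨k, rfl⟩
        exact hv _ (Submodule.subset_span ⟨⟨μ, k⟩, rfl⟩)
      · intro y z _ _ hy hz
        rw [Submodule.coe_add, inner_add_left, hy, hz, add_zero]
      · intro c y _ hy
        rw [Submodule.coe_smul, inner_smul_left, hy, mul_zero]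
    rw [Submodule.mem_orthogonal]
    intro z hz
    refine Submodule.iSup_induction V (motive := fun z => inner ℂ z v = 0) hz hv' (by simp) ?_
    intro y z hy hz
    rw [inner_add_left, hy, hz, add_zero]
  refine ⟨Σ μ, w μ, HilbertBasis.mkOfOrthogonalEqBot hon hperp, fun a => a.1.re, fun a => ?_⟩
  rw [HilbertBasis.coe_mkOfOrthogonalEqBot]
  have h1 : R ((b a.1 a.2 : V a.1) : E) = a.1 • ((b a.1 a.2 : V a.1) : E) :=
    Module.End.mem_eigenspace_iff.1 (b a.1 a.2).2
  have h2 : ((b a.1 a.2 : V a.1) : E) ≠ 0 := fun h => hon.ne_zero a h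
  have h3 : (starRingEnd ℂ) a.1 = a.1 :=
    hR.conj_eigenvalue_eq_self (Module.End.hasEigenvalue_of_hasEigenvector
      (x := ((b a.1 a.2 : V a.1) : E)) ⟨(b a.1 a.2).2, h2⟩)
  rw [Complex.conj_eq_iff_re.1 h3, h1]

/-- Expectation of the heat operator in an eigenvector of the resolvent. -/
theorem inner_cfc_le_of_eigenvector {R : E →L[ℂ] E} (hR : IsSelfAdjoint R) {f : ℝ → ℝ}
    (hf : Continuous f) {v : E} (hv : ‖v‖ = 1) {x : ℝ} (hx : R v = (x : ℂ) • v) :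
    (inner ℂ v (cfc f R v)).re ≤ f x := by
  refine le_of_forall_pos_le_add fun ε hε => ?_
  obtain ⟨C, hC⟩ : ∃ C, ∀ y ∈ spectrum ℝ R, f y ≤ C := by
    obtain ⟨C, hC⟩ := (ContinuousFunctionalCalculus.isCompact_spectrum (R := ℝ) R).bddAbove_image
      hf.continuousOn
    exact ⟨C, fun y hy => hC ⟨y, hy, rfl⟩⟩
  obtain ⟨δ, hδ, hδf⟩ := Metric.continuousAt_iff.1 hf.continuousAt ε hε
  -- On the compact spectrum `f` is dominated by the parabola `f x + ε + K (y - x)²`: by continuity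
  -- near `x`, and by the size of `K` farther away. The quadratic term annihilates an eigenvector
  -- with eigenvalue `x`, so no spectral mapping at eigenvectors is required.
  set K : ℝ := |C - f x| / δ ^ 2 with hK
  have hK0 : 0 ≤ K := by positivity
  have hle : ∀ y ∈ spectrum ℝ R, f y ≤ (f x + ε) + K * ((y - x) * (y - x)) := by
    intro y hy
    by_cases hyx : dist y x < δ
    · have h1 := hδf hyx
      rw [Real.dist_eq] at h1
      have h2 := (abs_lt.1 h1).2
      have h3 : 0 ≤ K * ((y - x) * (y - x)) := mul_nonneg hK0 (mul_self_nonneg _)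
      linarith
    · have h1 : δ ^ 2 ≤ (y - x) * (y - x) := by
        rw [← abs_mul_abs_self, ← sq]
        rw [Real.dist_eq] at hyx
        exact pow_le_pow_left₀ hδ.le (not_lt.1 hyx) 2
      have h2 : |C - f x| ≤ K * ((y - x) * (y - x)) := by
        calc |C - f x| = K * δ ^ 2 := by rw [hK]; field_simp
          _ ≤ _ := by gcongr
      have h3 := le_abs_self (C - f x)
      have h4 := hC y hy
      linarith
  have h1 := cfc_mono (a := R) (f := f) (g := fun y => (f x + ε) + K * ((y - x) * (y - x)))
    hle (by fun_prop) (by fun_prop)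
  have h2 : cfc (fun y => (f x + ε) + K * ((y - x) * (y - x))) R =
      algebraMap ℝ (E →L[ℂ] E) (f x + ε) +
        K • ((R - algebraMap ℝ (E →L[ℂ] E) x) * (R - algebraMap ℝ (E →L[ℂ] E) x)) := by
    rw [cfc_const_add _ _ R, cfc_const_mul _ _ R, cfc_mul _ _ R, cfc_sub (fun y => y) _ R,
      cfc_id' ℝ R, cfc_const x R]
  rw [h2] at h1
  have h3 := re_inner_mono h1 v
  have hal : ∀ c : ℝ, (algebraMap ℝ (E →L[ℂ] E) c) v = (c : ℂ) • v := by
    intro c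
    rw [Algebra.algebraMap_eq_smul_one]
    rfl
  have h4 : (R - algebraMap ℝ (E →L[ℂ] E) x) v = 0 := by
    rw [_root_.sub_apply, hal, hx, sub_self]
  have h5 : (algebraMap ℝ (E →L[ℂ] E) (f x + ε) +
        K • ((R - algebraMap ℝ (E →L[ℂ] E) x) * (R - algebraMap ℝ (E →L[ℂ] E) x))) v =
      ((f x + ε : ℝ) : ℂ) • v := by
    rw [_root_.add_apply, hal, _root_.smul_apply,
      show ((R - algebraMap ℝ (E →L[ℂ] E) x) * (R - algebraMap ℝ (E →L[ℂ] E) x)) v =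
        (R - algebraMap ℝ (E →L[ℂ] E) x) ((R - algebraMap ℝ (E →L[ℂ] E) x) v) from rfl,
      h4, map_zero, smul_zero, add_zero]
  rw [h5, inner_smul_right, inner_self_eq_norm_sq_to_K, hv] at h3
  simpa using h3

/-- Parseval's identity on the closed span of an orthonormal family. -/
theorem hasSum_norm_inner_sq {F : Type v} [NormedAddCommGroup F] [InnerProductSpace ℂ F]
    [CompleteSpace F] {K : Type*} {e : K → F} (he : Orthonormal ℂ e) {v : F}
    (hv : v ∈ (Submodule.span ℂ (Set.range e)).topologicalClosure) :
    HasSum (fun k => ‖inner ℂ (e k) v‖ ^ 2) (‖v‖ ^ 2) := by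
  set U := (Submodule.span ℂ (Set.range e)).topologicalClosure with hU
  have hUc : CompleteSpace U := (Submodule.isClosed_topologicalClosure _).completeSpace_coe
  have hmem : ∀ k, e k ∈ U := fun k =>
    Submodule.le_topologicalClosure _ (Submodule.subset_span ⟨k, rfl⟩)
  have he' : Orthonormal ℂ (fun k => (⟨e k, hmem k⟩ : U)) :=
    he.codRestrict U hmem
  have hperp : (Submodule.span ℂ (Set.range (fun k => (⟨e k, hmem k⟩ : U))))ᗮ = ⊥ := by
    rw [eq_bot_iff]
    intro y hy
    rw [Submodule.mem_orthogonal] at hy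
    have h1 : ∀ z ∈ Submodule.span ℂ (Set.range e), inner ℂ z (y : F) = 0 := by
      intro z hz
      induction hz using Submodule.span_induction with
      | mem z hz =>
        obtain ⟨k, rfl⟩ := hz
        exact hy _ (Submodule.subset_span ⟨k, rfl⟩)
      | zero => simp
      | add a b _ _ ha hb => rw [inner_add_left, ha, hb, add_zero]
      | smul c a _ ha => rw [inner_smul_left, ha, mul_zero]
    have h2 : inner ℂ (y : F) (y : F) = 0 :=
      closure_minimal (s := (Submodule.span ℂ (Set.range e) : Set F))
        (t := {z | inner ℂ z (y : F) = 0}) h1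
        (isClosed_eq (by fun_prop) continuous_const) y.2
    rw [Submodule.mem_bot, ← Submodule.coe_eq_zero, ← inner_self_eq_zero (𝕜 := ℂ), h2]
  have h := (HilbertBasis.mkOfOrthogonalEqBot he' hperp).hasSum_inner_mul_inner ⟨v, hv⟩ ⟨v, hv⟩
  rw [HilbertBasis.coe_mkOfOrthogonalEqBot] at h
  convert h.mapL Complex.reCLM using 1
  · funext k
    change _ = (inner ℂ v (e k) * inner ℂ (e k) v).re
    rw [← inner_conj_symm v (e k), ← Complex.normSq_eq_conj_mul_self, Complex.ofReal_re,
      Complex.normSq_eq_norm_sq]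
  · rw [← inner_self_eq_norm_sq (𝕜 := ℂ)]; rfl

/-- Orthonormal modes whose energies bound the form of a non-negative symmetric operator. -/
structure IsModeBound (S : Submodule ℂ (E × E)) {F : Type v} [NormedAddCommGroup F]
    [InnerProductSpace ℂ F] (ι : E →ₗᵢ[ℂ] F) {K : Type*} (e : K → F) (lam : K → ℝ) : Prop where
  orthonormal : Orthonormal ℂ e
  finite : ∀ C, {k | lam k ≤ C}.Finite
  nonneg : ∀ k, 0 ≤ lam k
  bound : ∀ p ∈ S, ∀ s : Finset K,
    ∑ k ∈ s, lam k * ‖inner ℂ (e k) (ι p.1)‖ ^ 2 ≤ (inner ℂ p.1 p.2).re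
  mem_closure : ∀ p ∈ S, ι p.1 ∈ (Submodule.span ℂ (Set.range e)).topologicalClosure

variable {S : Submodule ℂ (E × E)} {F : Type v} [NormedAddCommGroup F]
    [InnerProductSpace ℂ F] [CompleteSpace F] {ι : E →ₗᵢ[ℂ] F} {K : Type*} {e : K → F} {lam : K → ℝ}

-- The bounds are assumed on the core only. For each finite set of modes they are closed conditions,
-- so they pass to the Friedrichs domain along a sequence whose energies converge too.
omit [CompleteSpace F] in
theorem IsModeBound.friedrichs (h : IsModeBound S ι e lam) (hS : IsNonnegSymmetric S) {u g : E}
    (hu : (u, g) ∈ friedrichs (S : Set (E × E))) :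
    (∀ s : Finset K, ∑ k ∈ s, lam k * ‖inner ℂ (e k) (ι u)‖ ^ 2 ≤ (inner ℂ u g).re) ∧
      ι u ∈ (Submodule.span ℂ (Set.range e)).topologicalClosure := by
  obtain ⟨p, hp, hpu, hpg⟩ := exists_seq_of_mem_friedrichs hS hu
  have hι : Tendsto (fun n => ι (p n).1) atTop (𝓝 (ι u)) := (ι.continuous.tendsto u).comp hpu
  refine ⟨fun s => ?_, ?_⟩
  · refine le_of_tendsto_of_tendsto (tendsto_finsetSum _ fun k _ => ?_) hpg
      (Eventually.of_forall fun n => h.bound _ (hp n) s)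
    exact ((tendsto_const_nhds.inner hι).norm.pow 2).const_mul _
  · exact (Submodule.isClosed_topologicalClosure _).mem_of_tendsto hι
      (Eventually.of_forall fun n => h.mem_closure _ (hp n))

theorem isCompactOperator_finite_rank {F : Type v} [NormedAddCommGroup F] [InnerProductSpace ℂ F]
    (e : K → F) (s : Finset K) :
    IsCompactOperator (∑ k ∈ s, (innerSL ℂ (e k)).smulRight (e k) : F →L[ℂ] F) := by
  classical
  induction s using Finset.induction_on with
  | empty => simpa using isCompactOperator_zero
  | insert a s ha ih =>
    rw [Finset.sum_insert ha]
    refine IsCompactOperator.add ?_ ih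
    have h1 : IsCompactOperator (innerSL ℂ (e a) : F →L[ℂ] ℂ) :=
      isCompactOperator_of_locallyCompactSpace_dom _
    exact h1.clm_comp (ContinuousLinearMap.toSpanSingleton ℂ (e a))

/-- Truncating `ι R f` to the finitely many modes with `lam k ≤ n + 1` leaves a remainder of squared
norm at most `(n+1)⁻¹` times the energy of `R f`, which is at most `‖R‖ ‖f‖²`. So `ι R` is a norm
limit of finite rank operators, and `ι* ι = 1` returns compactness to `R`. -/
theorem IsModeBound.isCompactOperator (h : IsModeBound S ι e lam) (hS : IsNonnegSymmetric S) :
    IsCompactOperator (invOneAdd (BoseGas.friedrichs (S : Set (E × E)))) := by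
  classical
  have hR := isResolvent_invOneAdd_friedrichs hS
  set R := invOneAdd (BoseGas.friedrichs (S : Set (E × E)))
  set P : ℕ → F →L[ℂ] F := fun n =>
    ∑ k ∈ (h.finite n).toFinset, (innerSL ℂ (e k)).smulRight (e k) with hP
  have key : ∀ (n : ℕ) (f : E), ‖ι (R f) - P (n + 1) (ι (R f))‖ ^ 2 ≤
      (‖R‖ / (n + 1)) * ‖f‖ ^ 2 := by
    intro n f
    obtain ⟨hb, hcl⟩ := h.friedrichs hS ((hR f (R f)).1 rfl)
    set v := ι (R f) with hv
    have hPv : P (n + 1) v = ∑ k ∈ (h.finite (n + 1 : ℕ)).toFinset, inner ℂ (e k) v • e k := by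
      simp [hP]
    have hmem : v - P (n + 1) v ∈ (Submodule.span ℂ (Set.range e)).topologicalClosure := by
      refine Submodule.sub_mem _ hcl ?_
      rw [hPv]
      exact Submodule.sum_mem _ fun k _ => Submodule.smul_mem _ _
        (Submodule.le_topologicalClosure _ (Submodule.subset_span ⟨k, rfl⟩))
    have hco : ∀ k, inner ℂ (e k) (v - P (n + 1) v) =
        if lam k ≤ (n + 1 : ℕ) then 0 else inner ℂ (e k) v := by
      intro k
      rw [inner_sub_right, hPv, inner_sum]
      simp only [inner_smul_right, orthonormal_iff_ite.1 h.orthonormal]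
      simp only [mul_ite, mul_one, mul_zero, Finset.sum_ite_eq, Set.Finite.mem_toFinset,
        Set.mem_ofPred_eq]
      split_ifs <;> simp
    have hs := hasSum_norm_inner_sq h.orthonormal hmem
    refine hasSum_le_of_sum_le hs fun s => ?_
    have hq : (inner ℂ (R f) (f - R f)).re ≤ ‖R‖ * ‖f‖ ^ 2 := by
      rw [inner_sub_right, Complex.sub_re]
      have h1 : 0 ≤ (inner ℂ (R f) (R f)).re := inner_self_nonneg (𝕜 := ℂ)
      have h2 : (inner ℂ (R f) f).re ≤ ‖R f‖ * ‖f‖ := re_inner_le_norm (𝕜 := ℂ) _ _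
      have h3 := mul_le_mul_of_nonneg_right (R.le_opNorm f) (norm_nonneg f)
      nlinarith
    have hn : (0 : ℝ) < n + 1 := by positivity
    calc ∑ k ∈ s, ‖inner ℂ (e k) (v - P (n + 1) v)‖ ^ 2
        ≤ ∑ k ∈ s, (1 / (n + 1 : ℝ)) * (lam k * ‖inner ℂ (e k) v‖ ^ 2) := by
          refine Finset.sum_le_sum fun k _ => ?_
          rw [hco]
          split_ifs with hk
          · have := h.nonneg k
            rw [norm_zero, zero_pow two_ne_zero]
            positivity
          · have h1 : (n + 1 : ℝ) ≤ lam k := by push_cast at hk; exact (not_le.1 hk).le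
            rw [← mul_assoc]
            refine le_mul_of_one_le_left (by positivity) ?_
            rw [one_div, ← div_eq_inv_mul, le_div_iff₀ hn, one_mul]
            exact h1
      _ = (1 / (n + 1 : ℝ)) * ∑ k ∈ s, lam k * ‖inner ℂ (e k) v‖ ^ 2 := by rw [Finset.mul_sum]
      _ ≤ (1 / (n + 1 : ℝ)) * (‖R‖ * ‖f‖ ^ 2) := by gcongr; exact (hb s).trans hq
      _ = _ := by ring
  have hlim : Tendsto (fun n => (P (n + 1)).comp (ι.toContinuousLinearMap.comp R)) atTop
      (𝓝 (ι.toContinuousLinearMap.comp R)) := by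
    rw [tendsto_iff_norm_sub_tendsto_zero]
    have h0 : Tendsto (fun n : ℕ => √(‖R‖ / ((n : ℝ) + 1))) atTop (𝓝 0) := by
      have := (tendsto_const_div_atTop_nhds_zero_nat ‖R‖).comp (tendsto_add_atTop_nat 1)
      have := this.sqrt
      simpa using this
    refine squeeze_zero (fun _ => norm_nonneg _) (fun n => ?_) h0
    refine ContinuousLinearMap.opNorm_le_bound _ (Real.sqrt_nonneg _) fun f => ?_
    rw [_root_.sub_apply, norm_sub_rev]
    refine le_of_sq_le_sq ?_ (by positivity)
    rw [mul_pow, Real.sq_sqrt (by positivity)]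
    exact key n f
  have hcomp : IsCompactOperator (ι.toContinuousLinearMap.comp R) :=
    isCompactOperator_of_tendsto hlim (Eventually.of_forall fun n =>
      (isCompactOperator_finite_rank e _).comp_clm _)
  have := hcomp.clm_comp (ContinuousLinearMap.adjoint ι.toContinuousLinearMap)
  have h2 : ⇑(ContinuousLinearMap.adjoint ι.toContinuousLinearMap) ∘
      ⇑(ι.toContinuousLinearMap.comp R) = R := by
    funext f
    refine ext_inner_left ℂ fun w => ?_
    simp only [Function.comp_apply, ContinuousLinearMap.adjoint_inner_right]
    exact ι.inner_map_map w (R f)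
  rwa [h2] at this

end Spectral

/-! ### Comparison of partition functions through maps between cores. -/

section Comparison

universe u v

variable {E : Type u} [NormedAddCommGroup E] [InnerProductSpace ℂ E] [CompleteSpace E]
  {S : Submodule ℂ (E × E)} {F : Type v} [NormedAddCommGroup F]
  [InnerProductSpace ℂ F] {ι : E →ₗᵢ[ℂ] F} {K : Type*} {e : K → F} {lam : K → ℝ}

omit [CompleteSpace E] in
/-- An eigenvector of the resolvent with non-zero eigenvalue is an eigenvector of the operator. -/
theorem IsResolvent.mem_of_eigenvector {T : Set (E × E)} {R : E →L[ℂ] E} (hR : IsResolvent T R)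
    {v : E} {x : ℝ} (hx : 0 < x) (h : R v = (x : ℂ) • v) :
    (v, ((x⁻¹ - 1 : ℝ) : ℂ) • v) ∈ T := by
  have h1 : R (((x⁻¹ : ℝ) : ℂ) • v) = v := by
    rw [map_smul, h, smul_smul, ← Complex.ofReal_mul, inv_mul_cancel₀ hx.ne', Complex.ofReal_one,
      one_smul]
  have h2 := (hR _ _).1 h1
  convert h2 using 2
  rw [Complex.ofReal_sub, sub_smul, Complex.ofReal_one, one_smul]

omit [CompleteSpace E] in
theorem re_inner_smul_self {v : E} (hv : ‖v‖ = 1) (c : ℝ) :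
    (inner ℂ v ((c : ℂ) • v)).re = c := by
  rw [inner_smul_right, inner_self_eq_norm_sq_to_K, hv]
  simp

/-- Jensen's inequality for the exponential and the weights `w`. -/
theorem exp_neg_le_tsum {β x : ℝ} (hβ : 0 < β) {w : K → ℝ} (hw : ∀ k, 0 ≤ w k)
    (hsum : HasSum w 1) (hx : ∀ s : Finset K, ∑ k ∈ s, lam k * w k ≤ x) :
    ENNReal.ofReal (Real.exp (-β * x)) ≤ ∑' k, ENNReal.ofReal (w k * Real.exp (-β * lam k)) := by
  -- On a finite set the weights need not add up to `1`. The tangent line at `x` is therefore summed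
  -- with the partial weight kept explicit, and the bracket becomes `1` only in the limit.
  have h1 : ∀ s : Finset K, Real.exp (-β * x) * ((1 + β * x) * ∑ k ∈ s, w k - β * x) ≤
      ∑ k ∈ s, w k * Real.exp (-β * lam k) := by
    intro s
    calc Real.exp (-β * x) * ((1 + β * x) * ∑ k ∈ s, w k - β * x)
        ≤ Real.exp (-β * x) * ((1 + β * x) * ∑ k ∈ s, w k - β * ∑ k ∈ s, lam k * w k) := by
          gcongr; exact hx s
      _ = ∑ k ∈ s, w k * (Real.exp (-β * x) * (-β * (lam k - x) + 1)) := by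
          rw [Finset.mul_sum, Finset.mul_sum, ← Finset.sum_sub_distrib, Finset.mul_sum]
          exact Finset.sum_congr rfl fun k _ => by ring
      _ ≤ ∑ k ∈ s, w k * Real.exp (-β * lam k) := by
          refine Finset.sum_le_sum fun k _ => mul_le_mul_of_nonneg_left ?_ (hw k)
          calc Real.exp (-β * x) * (-β * (lam k - x) + 1)
              ≤ Real.exp (-β * x) * Real.exp (-β * (lam k - x)) := by
                gcongr; exact Real.add_one_le_exp _
            _ = _ := by rw [← Real.exp_add]; congr 1; ring
  have h2 : Tendsto (fun s : Finset K => ENNReal.ofReal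
      (Real.exp (-β * x) * ((1 + β * x) * ∑ k ∈ s, w k - β * x))) atTop
      (𝓝 (ENNReal.ofReal (Real.exp (-β * x) * ((1 + β * x) * 1 - β * x)))) :=
    (ENNReal.continuous_ofReal.tendsto _).comp
      (((hsum.const_mul (1 + β * x)).sub_const _).const_mul _)
  rw [show Real.exp (-β * x) * ((1 + β * x) * 1 - β * x) = Real.exp (-β * x) by ring] at h2
  refine le_of_tendsto h2 (Eventually.of_forall fun s => ?_)
  refine (ENNReal.ofReal_le_ofReal (h1 s)).trans ?_
  rw [ENNReal.ofReal_sum_of_nonneg fun k _ => mul_nonneg (hw k) (Real.exp_nonneg _)]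
  exact ENNReal.sum_le_tsum s

/-- Jensen bounds each heat eigenvalue by an average of `exp(-β lam k)` with weights `|⟪e k, ι (b
i)⟫|²`; after exchanging the sums, Bessel in `i` shows that each mode is used with total weight at
most `1`. -/
theorem IsModeBound.tsum_heatFun_le [CompleteSpace F] (h : IsModeBound S ι e lam)
    (hS : IsNonnegSymmetric S)
    {β : ℝ} (hβ : 0 < β) {I : Type*} (b : HilbertBasis I ℂ E) {x : I → ℝ}
    (hb : ∀ i, invOneAdd (BoseGas.friedrichs (S : Set (E × E))) (b i) = (x i : ℂ) • b i) :
    ∑' i, ENNReal.ofReal (heatFun β (x i)) ≤ ∑' k, ENNReal.ofReal (Real.exp (-β * lam k)) := by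
  have h1 : ∀ i, ENNReal.ofReal (heatFun β (x i)) ≤
      ∑' k, ENNReal.ofReal (‖inner ℂ (e k) (ι (b i))‖ ^ 2 * Real.exp (-β * lam k)) := by
    intro i
    by_cases hx : 0 < x i
    · obtain ⟨h2, h3⟩ := h.friedrichs hS
        ((isResolvent_invOneAdd_friedrichs hS).mem_of_eigenvector hx (hb i))
      rw [re_inner_smul_self (b.orthonormal.1 i)] at h2
      have h4 := hasSum_norm_inner_sq h.orthonormal h3
      rw [ι.norm_map, b.orthonormal.1 i, one_pow] at h4
      rw [heatFun, if_pos hx]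
      exact exp_neg_le_tsum hβ (fun k => by positivity) h4 h2
    · rw [heatFun, if_neg hx, ENNReal.ofReal_zero]; exact zero_le
  have hon : Orthonormal ℂ (fun i => ι (b i)) := b.orthonormal.comp_linearIsometry ι
  calc ∑' i, ENNReal.ofReal (heatFun β (x i))
      ≤ ∑' i, ∑' k, ENNReal.ofReal (‖inner ℂ (e k) (ι (b i))‖ ^ 2 * Real.exp (-β * lam k)) :=
        ENNReal.tsum_le_tsum h1
    _ = ∑' k, ∑' i, ENNReal.ofReal (‖inner ℂ (e k) (ι (b i))‖ ^ 2 * Real.exp (-β * lam k)) :=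
        ENNReal.tsum_comm
    _ ≤ ∑' k, ENNReal.ofReal (Real.exp (-β * lam k)) := by
        refine ENNReal.tsum_le_tsum fun k => ?_
        simp_rw [ENNReal.ofReal_mul (sq_nonneg _)]
        rw [ENNReal.tsum_mul_right]
        refine mul_le_of_le_one_left zero_le ?_
        have h2 := tsum_ofReal_inner_sq_le hon (e k)
        rw [h.orthonormal.1 k, one_pow, ENNReal.ofReal_one] at h2
        refine le_trans (le_of_eq (tsum_congr fun i => ?_)) h2
        rw [norm_inner_symm]

variable {E' : Type*} [NormedAddCommGroup E'] [InnerProductSpace ℂ E'] [CompleteSpace E']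
  {S' : Submodule ℂ (E' × E')}

/-- Maps between the cores of two operators which preserve the inner product and increase the
energy by a controlled amount. -/
structure IsCoreMap (S : Submodule ℂ (E × E)) (S' : Submodule ℂ (E' × E'))
    (J : E × E → E' × E') (err : E → ℝ) : Prop where
  mem : ∀ p ∈ S, J p ∈ S'
  inner_map : ∀ p ∈ S, ∀ q ∈ S, inner ℂ (J p).1 (J q).1 = inner ℂ p.1 q.1
  continuous : Continuous err
  energy_le : ∀ p ∈ S, (inner ℂ (J p).1 (J p).2).re ≤ (inner ℂ p.1 p.2).re + err p.1

-- A core map is not assumed to be linear, since it will come from a choice of representatives;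
-- preservation of all inner products already makes it isometric by expanding the square.
omit [CompleteSpace E] [CompleteSpace E'] in
theorem IsCoreMap.norm_sub {J : E × E → E' × E'} {err : E → ℝ} (hJ : IsCoreMap S S' J err)
    {p q : E × E} (hp : p ∈ S) (hq : q ∈ S) : ‖(J p).1 - (J q).1‖ = ‖p.1 - q.1‖ := by
  have h1 : ‖(J p).1 - (J q).1‖ ^ 2 = ‖p.1 - q.1‖ ^ 2 := by
    rw [← inner_self_eq_norm_sq (𝕜 := ℂ), ← inner_self_eq_norm_sq (𝕜 := ℂ)]
    simp only [inner_sub_left, inner_sub_right, hJ.inner_map _ hp _ hp, hJ.inner_map _ hp _ hq,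
      hJ.inner_map _ hq _ hp, hJ.inner_map _ hq _ hq]
  exact (sq_eq_sq₀ (norm_nonneg _) (norm_nonneg _)).1 h1

/-- A core map carries an orthonormal family of eigenvectors to an orthonormal family of vectors
with controlled expectation of the heat operator. -/
theorem IsCoreMap.sum_exp_le_trace {J : E × E → E' × E'} {err : E → ℝ} (hJ : IsCoreMap S S' J err)
    (hS : IsNonnegSymmetric S) (hS' : IsNonnegSymmetric S') {β : ℝ} (hβ : 0 < β) {I : Type*}
    {φ : I → E} (hφ : Orthonormal ℂ φ) {x : I → ℝ}
    (hφx : ∀ i, (φ i, (x i : ℂ) • φ i) ∈ friedrichs (S : Set (E × E))) :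
    ∑' i, ENNReal.ofReal (Real.exp (-β * (x i + err (φ i)))) ≤
      trace (expNeg β (friedrichs (S' : Set (E' × E')))) := by
  choose p hp hpφ hpx using fun i => exists_seq_of_mem_friedrichs hS (hφx i)
  have hlim : ∀ i, ∃ ψ, Tendsto (fun n => (J (p i n)).1) atTop (𝓝 ψ) := by
    intro i
    refine cauchySeq_tendsto_of_complete ?_
    have hc := (hpφ i).cauchySeq
    rw [Metric.cauchySeq_iff] at hc ⊢
    intro ε hε
    obtain ⟨n, hn⟩ := hc ε hε
    refine ⟨n, fun a ha c hc => ?_⟩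
    rw [dist_eq_norm, hJ.norm_sub (hp i a) (hp i c), ← dist_eq_norm]
    exact hn a ha c hc
  choose ψ hψ using hlim
  have hψφ : ∀ i j, inner ℂ (ψ i) (ψ j) = inner ℂ (φ i) (φ j) := by
    intro i j
    refine tendsto_nhds_unique ((hψ i).inner (𝕜 := ℂ) (hψ j)) ?_
    exact ((hpφ i).inner (𝕜 := ℂ) (hpφ j)).congr fun n => (hJ.inner_map _ (hp i n) _ (hp j n)).symm
  have hon : Orthonormal ℂ ψ := by
    classical
    rw [orthonormal_iff_ite]
    intro i j
    rw [hψφ, orthonormal_iff_ite.1 hφ]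
  refine le_trans (ENNReal.tsum_le_tsum fun i => ENNReal.ofReal_le_ofReal ?_)
    (tsum_inner_le_trace (isPositive_expNeg β _) hon)
  set B := expNeg β (friedrichs (S' : Set (E' × E')))
  -- For fixed `s` the tangent line inequality is continuous in the vector and its energy bound, so
  -- it survives the passage from core approximants to `ψ i`. Afterwards `s` is set equal to the
  -- limiting energy bound, where the bracket is `1`.
  have h1 : ∀ s : ℝ, Real.exp (-β * s) * ((1 + β * s) * ‖ψ i‖ ^ 2 - β * (x i + err (φ i))) ≤
      (inner ℂ (ψ i) (B (ψ i))).re := by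
    intro s
    have hxi := hpx i
    rw [re_inner_smul_self (hφ.1 i)] at hxi
    have hl : Tendsto (fun n => Real.exp (-β * s) * ((1 + β * s) * ‖(J (p i n)).1‖ ^ 2 -
        β * ((inner ℂ (p i n).1 (p i n).2).re + err (p i n).1))) atTop
        (𝓝 (Real.exp (-β * s) * ((1 + β * s) * ‖ψ i‖ ^ 2 - β * (x i + err (φ i))))) :=
      ((((hψ i).norm.pow 2).const_mul _).sub
        ((hxi.add ((hJ.continuous.tendsto _).comp (hpφ i))).const_mul β)).const_mul _
    have hr : Tendsto (fun n => (inner ℂ (J (p i n)).1 (B (J (p i n)).1)).re) atTop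
        (𝓝 (inner ℂ (ψ i) (B (ψ i))).re) :=
      (Complex.continuous_re.tendsto _).comp
        ((hψ i).inner ((B.continuous.tendsto _).comp (hψ i)))
    refine le_of_tendsto_of_tendsto hl hr (Eventually.of_forall fun n => ?_)
    refine le_trans ?_ (tangent_le_inner_expNeg hS' hβ s (hJ.mem _ (hp i n)))
    exact mul_le_mul_of_nonneg_left (sub_le_sub_left
      (mul_le_mul_of_nonneg_left (hJ.energy_le _ (hp i n)) hβ.le) _) (Real.exp_nonneg _)
  have h2 := h1 (x i + err (φ i))
  rw [hon.1 i] at h2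
  refine le_trans (le_of_eq ?_) h2
  ring

/-- Comparison of the partition functions of two operators through an average over core maps. -/
theorem trace_comparison [CompleteSpace F] (h : IsModeBound S ι e lam) (hS : IsNonnegSymmetric S)
    (hS' : IsNonnegSymmetric S') {β : ℝ} (hβ : 0 < β) {M : ℕ} (hM : 0 < M)
    {J : Fin M → E × E → E' × E'} {err : Fin M → E → ℝ} (hJ : ∀ m, IsCoreMap S S' (J m) (err m))
    {ε : ℝ} (hε : ∀ u, ∑ m, err m u ≤ M * ε * ‖u‖ ^ 2) :
    ENNReal.ofReal (Real.exp (-β * ε)) * trace (expNeg β (friedrichs (S : Set (E × E)))) ≤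
        trace (expNeg β (friedrichs (S' : Set (E' × E')))) ∧
      trace (expNeg β (friedrichs (S : Set (E × E)))) ≤
        ∑' k, ENNReal.ofReal (Real.exp (-β * lam k)) := by
  have hpos := isPositive_invOneAdd_friedrichs hS
  obtain ⟨I, b, x, hb⟩ := exists_hilbertBasis_eigenvectors hpos.isSymmetric
    (h.isCompactOperator hS)
  have htr : trace (expNeg β (friedrichs (S : Set (E × E)))) ≤
      ∑' i, ENNReal.ofReal (heatFun β (x i)) := by
    refine (trace_le_tsum_inner (isPositive_expNeg β _) b).trans ?_
    refine ENNReal.tsum_le_tsum fun i => ENNReal.ofReal_le_ofReal ?_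
    exact inner_cfc_le_of_eigenvector hpos.isSelfAdjoint (continuous_heatFun hβ)
      (b.orthonormal.1 i) (hb i)
  refine ⟨?_, htr.trans (h.tsum_heatFun_le hS hβ b hb)⟩
  refine (mul_le_mul_right htr _).trans ?_
  -- Only eigenvalues `x i > 0` correspond to vectors in the domain of the operator, with energy `(x
  -- i)⁻¹ - 1`; the others have `heatFun` equal to `0` and can be discarded.
  have hsupp : ∑' i, ENNReal.ofReal (heatFun β (x i)) =
      ∑' i : {i // 0 < x i}, ENNReal.ofReal (Real.exp (-β * ((x i)⁻¹ - 1))) := by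
    rw [← tsum_subtype_eq_of_support_subset (s := {i | 0 < x i})]
    · refine tsum_congr fun i => ?_
      have hi : 0 < x i := i.2
      rw [heatFun, if_pos hi]
    · intro i hi
      by_contra hx
      have hx' : ¬ 0 < x i := hx
      exact hi (by simp only [heatFun]; rw [if_neg hx', ENNReal.ofReal_zero])
  rw [hsupp]
  have hsub : Orthonormal ℂ (fun i : {i // 0 < x i} => b i) :=
    b.orthonormal.comp _ Subtype.val_injective
  have hm : ∀ m, ∑' i : {i // 0 < x i},
      ENNReal.ofReal (Real.exp (-β * (((x i)⁻¹ - 1) + err m (b i)))) ≤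
      trace (expNeg β (friedrichs (S' : Set (E' × E')))) := fun m =>
    (hJ m).sum_exp_le_trace hS hS' hβ hsub fun i =>
      (isResolvent_invOneAdd_friedrichs hS).mem_of_eigenvector i.2 (hb i)
  have hM' : (M : ℝ≥0∞) ≠ 0 := by exact_mod_cast hM.ne'
  rw [← ENNReal.mul_le_mul_iff_right hM' (ENNReal.natCast_ne_top M)]
  calc (M : ℝ≥0∞) * (ENNReal.ofReal (Real.exp (-β * ε)) *
        ∑' i : {i // 0 < x i}, ENNReal.ofReal (Real.exp (-β * ((x i)⁻¹ - 1))))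
      = ∑' i : {i // 0 < x i}, (M : ℝ≥0∞) * (ENNReal.ofReal (Real.exp (-β * ε)) *
          ENNReal.ofReal (Real.exp (-β * ((x i)⁻¹ - 1)))) := by
        rw [ENNReal.tsum_mul_left, ENNReal.tsum_mul_left]
    _ ≤ ∑' i : {i // 0 < x i}, ∑ m,
          ENNReal.ofReal (Real.exp (-β * (((x i)⁻¹ - 1) + err m (b i)))) := by
        refine ENNReal.tsum_le_tsum fun i => ?_
        rw [← ENNReal.ofReal_sum_of_nonneg fun _ _ => Real.exp_nonneg _,
          ← ENNReal.ofReal_mul (Real.exp_nonneg _), ← ENNReal.ofReal_natCast,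
          ← ENNReal.ofReal_mul (Nat.cast_nonneg _)]
        refine ENNReal.ofReal_le_ofReal ?_
        have h1 := hε (b i)
        rw [b.orthonormal.1 i, one_pow, mul_one] at h1
        -- Convexity over the `M` maps: expand each exponential to first order around the mean error
        -- `ε`. The linear terms sum to `-β (∑ err - Mε)`, which is nonnegative by assumption,
        -- although individual errors may exceed `ε`.
        calc (M : ℝ) * (Real.exp (-β * ε) * Real.exp (-β * ((x i)⁻¹ - 1)))
            = Real.exp (-β * ε) * Real.exp (-β * ((x i)⁻¹ - 1)) * (M - β * (M * ε - M * ε)) := by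
              ring
          _ ≤ Real.exp (-β * ε) * Real.exp (-β * ((x i)⁻¹ - 1)) *
              (M - β * (∑ m, err m (b i) - M * ε)) := by gcongr
          _ = ∑ m, Real.exp (-β * ε) * Real.exp (-β * ((x i)⁻¹ - 1)) *
              (-β * (err m (b i) - ε) + 1) := by
              rw [← Finset.mul_sum, Finset.sum_add_distrib, ← Finset.mul_sum,
                Finset.sum_sub_distrib]
              simp only [Finset.sum_const, Finset.card_univ, Fintype.card_fin, nsmul_eq_mul]
              ring
          _ ≤ ∑ m, Real.exp (-β * ε) * Real.exp (-β * ((x i)⁻¹ - 1)) *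
              Real.exp (-β * (err m (b i) - ε)) := by
              gcongr with m
              exact Real.add_one_le_exp _
          _ = _ := by
              refine Finset.sum_congr rfl fun m _ => ?_
              rw [← Real.exp_add, ← Real.exp_add]
              congr 1; ring
    _ = ∑ m, ∑' i : {i // 0 < x i},
          ENNReal.ofReal (Real.exp (-β * (((x i)⁻¹ - 1) + err m (b i)))) :=
        Summable.tsum_finsetSum fun _ _ => ENNReal.summable
    _ ≤ ∑ _m : Fin M, trace (expNeg β (friedrichs (S' : Set (E' × E')))) :=
        Finset.sum_le_sum fun m _ => hm m
    _ = _ := by simp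

end Comparison

/-! ### Densities of product form. -/

section ProductMeasures

/-- Tonelli by induction on the set of integrated coordinates, through marginal integrals. Reading
off the full integral needs a base point, so the case of an empty factor, where both sides vanish,
is separate. -/
theorem lintegral_prod_pi {ι : Type*} [Fintype ι] {α : ι → Type*} [∀ i, MeasurableSpace (α i)]
    (μ : ∀ i, Measure (α i)) [∀ i, SigmaFinite (μ i)] {g : ∀ i, α i → ℝ≥0∞}
    (hg : ∀ i, Measurable (g i)) :
    ∫⁻ x, ∏ i, g i (x i) ∂(Measure.pi μ) = ∏ i, ∫⁻ y, g i y ∂(μ i) := by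
  classical
  have key : ∀ s : Finset ι, ∫⋯∫⁻_s, (fun x => ∏ i ∈ s, g i (x i)) ∂μ =
      fun _ => ∏ i ∈ s, ∫⁻ y, g i y ∂(μ i) := by
    intro s
    induction s using Finset.induction_on with
    | empty => simp
    | insert a s ha ih =>
      have hm : ∀ t : Finset ι, Measurable fun x : ∀ i, α i => ∏ i ∈ t, g i (x i) := fun t =>
        Finset.measurable_fun_prod t fun i _ => (hg i).comp (measurable_pi_apply i)
      rw [lmarginal_insert' _ (hm _) ha]
      have h1 : ∀ x : ∀ i, α i, ∫⁻ y, ∏ i ∈ insert a s, g i (Function.update x a y i) ∂(μ a) =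
          (∫⁻ y, g a y ∂(μ a)) * ∏ i ∈ s, g i (x i) := by
        intro x
        rw [← lintegral_mul_const _ (hg a)]
        refine lintegral_congr fun y => ?_
        rw [Finset.prod_insert ha, Function.update_self]
        congr 1
        refine Finset.prod_congr rfl fun i hi => ?_
        rw [Function.update_of_ne (ne_of_mem_of_not_mem hi ha)]
      simp_rw [h1]
      funext x
      rw [Finset.prod_insert ha, ← congrFun ih x]
      simp only [lmarginal]
      rw [lintegral_const_mul]
      exact (hm s).comp measurable_updateFinset
  by_cases hne : Nonempty (∀ i, α i)
  · obtain ⟨x⟩ := hne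
    rw [lintegral_eq_lmarginal_univ x, key]
  · have h2 : IsEmpty (∀ i, α i) := not_nonempty_iff.1 hne
    obtain ⟨i, hi⟩ : ∃ i, IsEmpty (α i) := by
      by_contra h
      push Not at h
      exact hne ⟨fun i => Classical.choice (not_isEmpty_iff.1 (by simp))⟩
    rw [Measure.eq_zero_of_isEmpty (Measure.pi μ), lintegral_zero_measure,
      Finset.prod_eq_zero (Finset.mem_univ i)]
    rw [Measure.eq_zero_of_isEmpty (μ i), lintegral_zero_measure]

theorem pi_withDensity {ι : Type*} [Fintype ι] {α : ι → Type*} [∀ i, MeasurableSpace (α i)]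
    (μ : ∀ i, Measure (α i)) [∀ i, SigmaFinite (μ i)] {g : ∀ i, α i → ℝ≥0∞}
    (hg : ∀ i, Measurable (g i)) [∀ i, SigmaFinite ((μ i).withDensity (g i))] :
    Measure.pi (fun i => (μ i).withDensity (g i)) =
      (Measure.pi μ).withDensity fun x => ∏ i, g i (x i) := by
  refine Measure.pi_eq fun s hs => ?_
  rw [withDensity_apply _ (MeasurableSet.univ_pi hs), Measure.restrict_pi_pi,
    lintegral_prod_pi _ hg]
  exact Finset.prod_congr rfl fun i _ => (withDensity_apply _ (hs i)).symm

end ProductMeasures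

/-! ### The torus, its fundamental domain, and integrals of periodic functions. -/

section Torus

variable {N : ℕ} {L : ℝ}

/-- The torus `(ℝ³ / L ℤ³) ^ N`. -/
abbrev Torus (N : ℕ) (L : ℝ) : Type := Fin N → Fin 3 → AddCircle L

/-- The projection to the torus. -/
def toTorus (N : ℕ) (L : ℝ) (x : Config N) : Torus N L := fun i k => (x i k : AddCircle L)

theorem measurable_toTorus : Measurable (toTorus N L) := by
  refine measurable_pi_lambda _ fun i => measurable_pi_lambda _ fun k => ?_
  exact AddCircle.measurable_mk'.comp (by fun_prop)

theorem toTorus_add (x y : Config N) : toTorus N L (x + y) = toTorus N L x + toTorus N L y := by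
  funext i k
  simp [toTorus]

variable [hL : Fact (0 < L)]

/-- The representative of a point of the torus in `[0, L) ^ (3 N)`. -/
def ofTorus (y : Torus N L) : Config N :=
  fun i => WithLp.toLp 2 fun k => (AddCircle.equivIco L 0 (y i k) : ℝ)

theorem toTorus_ofTorus (y : Torus N L) : toTorus N L (ofTorus y) = y := by
  funext i k
  exact AddCircle.coe_equivIco

theorem measurable_ofTorus : Measurable (ofTorus : Torus N L → Config N) := by
  refine measurable_pi_lambda _ fun i => ?_
  refine (PiLp.volume_preserving_toLp (Fin 3)).measurable.comp ?_
  refine measurable_pi_lambda _ fun k => ?_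
  exact measurable_subtype_coe.comp ((AddCircle.measurableEquivIco L 0).measurable.comp
    (by fun_prop))

/-- Functions on `ℝ ^ (3N)` with period `L` in each coordinate. -/
def IsPeriodic {α : Type*} (L : ℝ) (F : Config N → α) : Prop :=
  ∀ (x : Config N) (i : Fin N) (k : Fin 3),
    F (x + Pi.single i (EuclideanSpace.single k L)) = F x

-- The periods of `F` form an additive subgroup containing the coordinate translations by `L`, and
-- two points with the same image on the torus differ by an integer combination of these.
omit hL in
theorem IsPeriodic.apply_eq {α : Type*} {F : Config N → α} (hF : IsPeriodic L F) {x y : Config N}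
    (h : toTorus N L x = toTorus N L y) : F x = F y := by
  let P : AddSubgroup (Config N) :=
    { carrier := {z | ∀ x, F (x + z) = F x}
      zero_mem' := fun x => by rw [add_zero]
      add_mem' := fun {a b} ha hb x => by rw [← add_assoc, hb, ha]
      neg_mem' := fun {a} ha x => by rw [← ha (x + -a), neg_add_cancel_right] }
  have hP : ∀ i k, (Pi.single i (EuclideanSpace.single k L) : Config N) ∈ P :=
    fun i k x => hF x i k
  have hn : ∀ i k, ∃ n : ℤ, n • L = y i k - x i k := by
    intro i k
    have h1 : ((y i k - x i k : ℝ) : AddCircle L) = 0 := by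
      rw [AddCircle.coe_sub, sub_eq_zero]
      exact (congrFun (congrFun h i) k).symm
    exact AddCircle.coe_eq_zero_iff L |>.1 h1
  choose n hn using hn
  have hz : y - x = ∑ i, ∑ k, n i k • (Pi.single i (EuclideanSpace.single k L) : Config N) := by
    funext j
    ext l
    simp only [Finset.sum_apply, Pi.sub_apply, Pi.smul_apply, PiLp.sub_apply]
    rw [← hn j l]
    simp only [Pi.single_apply, smul_ite, smul_zero]
    rw [Finset.sum_eq_single j]
    · simp [Finset.sum_apply, Pi.single_apply]
    · intro b _ hb
      simp [Ne.symm hb]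
    · simp
  have hmem : y - x ∈ P := by
    rw [hz]
    exact P.sum_mem fun i _ => P.sum_mem fun k _ => P.zsmul_mem (hP i k) _
  have := hmem x
  rw [add_sub_cancel] at this
  exact this.symm

theorem IsPeriodic.apply_ofTorus {α : Type*} {F : Config N → α} (hF : IsPeriodic L F)
    (x : Config N) : F (ofTorus (toTorus N L x)) = F x :=
  hF.apply_eq (toTorus_ofTorus _)

omit hL in
theorem IsPeriodic.add_const {α : Type*} {F : Config N → α} (hF : IsPeriodic L F)
    (a : Config N) : IsPeriodic L (fun x => F (x + a)) := by
  intro x i k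
  simp only
  rw [add_right_comm, hF]

/-- Push-forward to the torus of a measure with a product density. -/
theorem map_toTorus_withDensity {g : Fin N → Fin 3 → ℝ → ℝ≥0∞} (hg : ∀ i k, Measurable (g i k))
    {w : Fin N → Fin 3 → AddCircle L → ℝ≥0∞} (hw : ∀ i k, Measurable (w i k))
    (hfin : ∀ i k, ∫⁻ t, g i k t ≠ ⊤)
    (hgw : ∀ i k, ((volume : Measure ℝ).withDensity (g i k)).map (fun t : ℝ => (t : AddCircle L)) =
      volume.withDensity (w i k)) :
    ((volume : Measure (Config N)).withDensity fun x => ∏ i, ∏ k, g i k (x i k)).map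
      (toTorus N L) = volume.withDensity fun y : Torus N L => ∏ i, ∏ k, w i k (y i k) := by
  have hmk : Measurable (fun t : ℝ => (t : AddCircle L)) := AddCircle.measurable_mk'
  have hlp : Measurable (WithLp.toLp 2 : (Fin 3 → ℝ) → EuclideanSpace ℝ (Fin 3)) :=
    (PiLp.volume_preserving_toLp (Fin 3)).measurable
  have hcoord : Measurable
      (fun (x : EuclideanSpace ℝ (Fin 3)) (k : Fin 3) => ((x k : ℝ) : AddCircle L)) :=
    measurable_pi_lambda _ fun k => hmk.comp (by fun_prop)
  have f1 : ∀ i k, IsFiniteMeasure ((volume : Measure ℝ).withDensity (g i k)) := fun i k =>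
    isFiniteMeasure_withDensity (hfin i k)
  have f2 : ∀ i k, IsFiniteMeasure ((volume : Measure (AddCircle L)).withDensity (w i k)) := by
    intro i k
    rw [← hgw]
    infer_instance
  have hg3 : ∀ i, Measurable fun x : Fin 3 → ℝ => ∏ k, g i k (x k) := fun i =>
    Finset.measurable_fun_prod _ fun k _ => (hg i k).comp (measurable_pi_apply k)
  have hg3' : ∀ i, Measurable fun x : EuclideanSpace ℝ (Fin 3) => ∏ k, g i k (x k) := fun i =>
    Finset.measurable_fun_prod _ fun k _ => (hg i k).comp (by fun_prop)
  have hw3 : ∀ i, Measurable fun x : Fin 3 → AddCircle L => ∏ k, w i k (x k) := fun i =>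
    Finset.measurable_fun_prod _ fun k _ => (hw i k).comp (measurable_pi_apply k)
  have e1 : ∀ i, Measure.pi (fun k => (volume : Measure ℝ).withDensity (g i k)) =
      (Measure.pi fun _ => volume).withDensity fun x => ∏ k, g i k (x k) := fun i =>
    pi_withDensity _ (hg i)
  have e2 : ∀ i, Measure.pi (fun k => (volume : Measure (AddCircle L)).withDensity (w i k)) =
      (Measure.pi fun _ => volume).withDensity fun x => ∏ k, w i k (x k) := fun i =>
    pi_withDensity _ (hw i)
  have hvol : (volume : Measure (EuclideanSpace ℝ (Fin 3))) =
      (Measure.pi fun _ : Fin 3 => (volume : Measure ℝ)).map (WithLp.toLp 2) :=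
    (PiLp.volume_preserving_toLp (Fin 3)).map_eq.symm
  have e3 : ∀ i, (volume : Measure (EuclideanSpace ℝ (Fin 3))).withDensity
      (fun x => ∏ k, g i k (x k)) =
      (Measure.pi fun k => (volume : Measure ℝ).withDensity (g i k)).map (WithLp.toLp 2) := by
    intro i
    rw [e1 i, hvol]
    refine Measure.ext fun s hs => ?_
    rw [withDensity_apply _ hs, Measure.map_apply hlp hs, withDensity_apply _ (hlp hs),
      setLIntegral_map hs (hg3' i) hlp]
  have f3 : ∀ i, IsFiniteMeasure ((volume : Measure (EuclideanSpace ℝ (Fin 3))).withDensity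
      (fun x => ∏ k, g i k (x k))) := by
    intro i; rw [e3 i]; infer_instance
  have f4 : ∀ i, IsFiniteMeasure ((Measure.pi fun _ : Fin 3 =>
      (volume : Measure (AddCircle L))).withDensity (fun x => ∏ k, w i k (x k))) := by
    intro i; rw [← e2 i]; infer_instance
  have h1 := pi_withDensity (fun _ : Fin N => (volume : Measure (EuclideanSpace ℝ (Fin 3)))) hg3'
  have h2 := pi_withDensity (fun _ : Fin N => Measure.pi fun _ : Fin 3 =>
    (volume : Measure (AddCircle L))) hw3
  rw [volume_pi, ← h1, volume_pi]
  simp only [volume_pi] at h2 ⊢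
  rw [← h2]
  have hmap : ∀ i, ((volume : Measure (EuclideanSpace ℝ (Fin 3))).withDensity
      (fun x => ∏ k, g i k (x k))).map (fun (x : EuclideanSpace ℝ (Fin 3)) k => ((x k : ℝ) : AddCircle L)) =
      (Measure.pi fun _ : Fin 3 => (volume : Measure (AddCircle L))).withDensity
        (fun x => ∏ k, w i k (x k)) := by
    intro i
    rw [e3 i, Measure.map_map hcoord hlp, ← e2 i]
    have f5 : ∀ k, IsFiniteMeasure (((volume : Measure ℝ).withDensity (g i k)).map
      (fun t : ℝ => (t : AddCircle L))) := fun k => inferInstance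
    have h3 := Measure.pi_map_pi (μ := fun k => (volume : Measure ℝ).withDensity (g i k))
      (f := fun _ (t : ℝ) => (t : AddCircle L)) (fun k => hmk.aemeasurable)
    simp only [hgw] at h3
    exact h3
  have f6 : ∀ i, IsFiniteMeasure (((volume : Measure (EuclideanSpace ℝ (Fin 3))).withDensity
      (fun x => ∏ k, g i k (x k))).map (fun (x : EuclideanSpace ℝ (Fin 3)) k => ((x k : ℝ) : AddCircle L))) :=
    fun i => inferInstance
  have h4 := Measure.pi_map_pi (μ := fun i => (volume : Measure (EuclideanSpace ℝ (Fin 3))).withDensity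
      (fun x => ∏ k, g i k (x k))) (f := fun _ (x : EuclideanSpace ℝ (Fin 3)) k => ((x k : ℝ) : AddCircle L))
      (fun i => hcoord.aemeasurable)
  simp only [hmap] at h4
  exact h4

/-- The push-forward to the circle of a density supported in `(0, 2L]`. -/
theorem map_mk_withDensity {g : ℝ → ℝ≥0∞} (hg : Measurable g)
    (hsupp : ∀ t, t ∉ Set.Ioc 0 (2 * L) → g t = 0) {w : AddCircle L → ℝ≥0∞} (hw : Measurable w)
    (hgw : ∀ t ∈ Set.Ioc 0 L, w (t : AddCircle L) = g t + g (t + L)) :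
    ((volume : Measure ℝ).withDensity g).map (fun t : ℝ => (t : AddCircle L)) =
      volume.withDensity w := by
  have hmk : Measurable (fun t : ℝ => (t : AddCircle L)) := AddCircle.measurable_mk'
  have hL' : 0 < L := hL.out
  refine Measure.ext fun A hA => ?_
  rw [Measure.map_apply hmk hA, withDensity_apply _ (hmk hA), withDensity_apply _ hA,
    ← lintegral_indicator (hmk hA), ← lintegral_indicator hA]
  have hmp := AddCircle.measurePreserving_mk L 0
  rw [zero_add] at hmp
  rw [← hmp.lintegral_comp (hw.indicator hA)]
  set G : ℝ → ℝ≥0∞ := ((fun t : ℝ => (t : AddCircle L)) ⁻¹' A).indicator g with hG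
  have h0 : ∫⁻ t, G t = ∫⁻ t in Set.Ioc 0 (2 * L), G t := by
    rw [setLIntegral_eq_of_support_subset]
    intro t ht
    by_contra h
    refine ht ?_
    exact Set.indicator_apply_eq_zero.2 fun _ => hsupp t h
  have h1 : Set.Ioc 0 (2 * L) = Set.Ioc 0 L ∪ Set.Ioc L (2 * L) :=
    (Set.Ioc_union_Ioc_eq_Ioc hL'.le (by linarith)).symm
  -- The second period is folded back onto the first one; this produces the two-term periodization
  -- `g t + g (t + L)`.
  have h2 : ∫⁻ t in Set.Ioc L (2 * L), G t = ∫⁻ t in Set.Ioc 0 L, G (t + L) := by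
    have h3 := (measurePreserving_add_right (volume : Measure ℝ) L).setLIntegral_comp_preimage
      (s := Set.Ioc L (2 * L)) measurableSet_Ioc (f := G) (hg.indicator (hmk hA))
    rw [← h3]
    congr 2
    ext t
    simp only [Set.mem_preimage, Set.mem_Ioc]
    constructor <;> rintro ⟨h, h'⟩ <;> constructor <;> linarith
  rw [h0, h1, lintegral_union measurableSet_Ioc (Set.Ioc_disjoint_Ioc_of_le le_rfl), h2,
    ← lintegral_add_left (hg.indicator (hmk hA))]
  refine setLIntegral_congr_fun measurableSet_Ioc fun t ht => ?_
  have h4 : ((t + L : ℝ) : AddCircle L) = t := AddCircle.coe_add_period L t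
  change G t + G (t + L) = A.indicator w (t : AddCircle L)
  by_cases ht' : (t : AddCircle L) ∈ A
  · rw [Set.indicator_of_mem ht', hgw t ht, hG, Set.indicator_of_mem, Set.indicator_of_mem]
    · change ((t + L : ℝ) : AddCircle L) ∈ A
      rwa [h4]
    · exact ht'
  · rw [Set.indicator_of_notMem ht', hG, Set.indicator_of_notMem, Set.indicator_of_notMem,
      add_zero]
    · change ((t + L : ℝ) : AddCircle L) ∉ A
      rwa [h4]
    · exact ht'

theorem measurableSet_box (N : ℕ) (L : ℝ) : MeasurableSet (box N L) := by
  have : box N L = ⋂ i, ⋂ k, (fun x : Config N => x i k) ⁻¹' Set.Ioo 0 L := by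
    ext x; simp [box]
  rw [this]
  refine MeasurableSet.iInter fun i => MeasurableSet.iInter fun k => ?_
  exact (by fun_prop : Measurable fun x : Config N => x i k) measurableSet_Ioo

/-- The box is a fundamental domain of the torus. -/
theorem measurePreserving_toTorus :
    MeasurePreserving (toTorus N L) (boxMeasure N L) volume := by
  refine ⟨measurable_toTorus, ?_⟩
  have h := map_toTorus_withDensity (N := N) (L := L)
    (g := fun _ _ => (Set.Ioo 0 L).indicator 1) (w := fun _ _ => 1)
    (fun _ _ => measurable_one.indicator measurableSet_Ioo) (fun _ _ => measurable_one) ?_ ?_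
  · have h1 : (fun x : Config N => ∏ i, ∏ k, (Set.Ioo 0 L).indicator (1 : ℝ → ℝ≥0∞) (x i k)) =
        (box N L).indicator 1 := by
      funext x
      by_cases hx : x ∈ box N L
      · rw [Set.indicator_of_mem hx]
        refine Finset.prod_eq_one fun i _ => Finset.prod_eq_one fun k _ => ?_
        rw [Set.indicator_of_mem (hx i k)]; rfl
      · rw [Set.indicator_of_notMem hx]
        simp only [box, Set.mem_ofPred_eq, not_forall] at hx
        obtain ⟨i, k, hik⟩ := hx
        exact Finset.prod_eq_zero (Finset.mem_univ i)
          (Finset.prod_eq_zero (Finset.mem_univ k) (Set.indicator_of_notMem hik _))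
    rw [h1, withDensity_indicator_one (measurableSet_box N L)] at h
    rw [h]
    simp
  · intro _ _
    rw [lintegral_indicator_one measurableSet_Ioo]
    simp
  · intro _ _
    rw [withDensity_indicator_one measurableSet_Ioo, restrict_Ioo_eq_restrict_Ioc]
    have hmp := AddCircle.measurePreserving_mk L 0
    rw [zero_add] at hmp
    rw [withDensity_one]
    exact hmp.map_eq

section Integrals

variable {X : Type*} [NormedAddCommGroup X] [NormedSpace ℝ X] [MeasurableSpace X] [BorelSpace X]
  [SecondCountableTopology X]

theorem integral_box_eq_torus {F : Config N → X} (hF : IsPeriodic L F) (hFm : Measurable F) :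
    ∫ x in box N L, F x = ∫ y : Torus N L, F (ofTorus y) := by
  have h : Measurable fun y : Torus N L => F (ofTorus y) := hFm.comp measurable_ofTorus
  rw [← measurePreserving_toTorus.map_eq, integral_map measurable_toTorus.aemeasurable
    h.aestronglyMeasurable]
  exact integral_congr_ae (Eventually.of_forall fun x => (hF.apply_ofTorus x).symm)

theorem IsPeriodic.apply_ofTorus_add {α : Type*} {F : Config N → α} (hF : IsPeriodic L F)
    (a : Config N) (y : Torus N L) : F (ofTorus y + a) = F (ofTorus (y + toTorus N L a)) :=
  hF.apply_eq (by rw [toTorus_add, toTorus_ofTorus, toTorus_ofTorus])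

/-- On the torus this is invariance of Haar measure. It replaces all bookkeeping of boundary faces
when periodic functions are translated or integrated by parts. -/
theorem integral_box_add {F : Config N → X} (hF : IsPeriodic L F) (hFm : Measurable F)
    (a : Config N) : ∫ x in box N L, F (x + a) = ∫ x in box N L, F x := by
  rw [integral_box_eq_torus (hF.add_const a) (hFm.comp (measurable_add_const a)),
    integral_box_eq_torus hF hFm]
  simp_rw [hF.apply_ofTorus_add]
  simp_rw [add_comm _ (toTorus N L a)]
  exact integral_add_left_eq_self (fun y : Torus N L => F (ofTorus y)) _

end Integrals

end Torus

/-! ### Partial derivatives, the pair potential, and integration of derivatives. -/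

section Calculus

variable {N : ℕ} {L : ℝ}

/-- The unit vector of the `k`-th coordinate of the `i`-th particle. -/
def dir (i : Fin N) (k : Fin 3) : Config N := Pi.single i (EuclideanSpace.single k 1)

/-- The partial derivative in the `k`-th coordinate of the `i`-th particle. -/
def pd (i : Fin N) (k : Fin 3) (φ : Config N → ℂ) (x : Config N) : ℂ := fderiv ℝ φ x (dir i k)

theorem contDiff_pd {φ : Config N → ℂ} (hφ : ContDiff ℝ ∞ φ) (i : Fin N) (k : Fin 3) :
    ContDiff ℝ ∞ (pd i k φ) :=
  (hφ.fderiv_right (m := ∞) (by simp)).clm_apply contDiff_const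

theorem contDiff_differentiable {φ : Config N → ℂ} (hφ : ContDiff ℝ ∞ φ) : Differentiable ℝ φ :=
  hφ.differentiable (by simp)

theorem pd_add {φ ψ : Config N → ℂ} (hφ : ContDiff ℝ ∞ φ) (hψ : ContDiff ℝ ∞ ψ) (i : Fin N)
    (k : Fin 3) : pd i k (φ + ψ) = pd i k φ + pd i k ψ := by
  funext x
  simp only [pd, Pi.add_apply]
  rw [fderiv_add (contDiff_differentiable hφ x) (contDiff_differentiable hψ x)]
  rfl

theorem pd_const_smul {φ : Config N → ℂ} (hφ : ContDiff ℝ ∞ φ) (c : ℂ) (i : Fin N)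
    (k : Fin 3) : pd i k (c • φ) = c • pd i k φ := by
  funext x
  simp only [pd, Pi.smul_apply]
  rw [fderiv_const_smul (contDiff_differentiable hφ x)]
  rfl

theorem pd_mul {φ ψ : Config N → ℂ} (hφ : ContDiff ℝ ∞ φ) (hψ : ContDiff ℝ ∞ ψ) (i : Fin N)
    (k : Fin 3) (x : Config N) :
    pd i k (fun y => φ y * ψ y) x = pd i k φ x * ψ x + φ x * pd i k ψ x := by
  simp only [pd]
  rw [fderiv_fun_mul (contDiff_differentiable hφ x) (contDiff_differentiable hψ x)]
  simp only [_root_.add_apply, _root_.smul_apply, smul_eq_mul]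
  ring

theorem contDiff_conj {φ : Config N → ℂ} (hφ : ContDiff ℝ ∞ φ) :
    ContDiff ℝ ∞ fun x => (starRingEnd ℂ) (φ x) :=
  Complex.conjCLE.contDiff.comp hφ

theorem pd_conj {φ : Config N → ℂ} (hφ : ContDiff ℝ ∞ φ) (i : Fin N) (k : Fin 3) (x : Config N) :
    pd i k (fun y => (starRingEnd ℂ) (φ y)) x = (starRingEnd ℂ) (pd i k φ x) := by
  have h := (Complex.conjCLE.hasFDerivAt (x := φ x)).comp x (contDiff_differentiable hφ x).hasFDerivAt
  have h2 : HasFDerivAt (fun y => (starRingEnd ℂ) (φ y)) _ x := h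
  simp only [pd]
  rw [h2.fderiv]
  rfl

theorem pd_comp_add (φ : Config N → ℂ) (i : Fin N) (k : Fin 3) (a : Config N) :
    pd i k (fun y => φ (y + a)) = fun x => pd i k φ (x + a) := by
  funext x
  simp only [pd]
  rw [fderiv_comp_add_right]

theorem laplacian_update_eq {φ : Config N → ℂ} (hφ : ContDiff ℝ ∞ φ) (i : Fin N) (x : Config N) :
    Laplacian.laplacian (fun y => φ (Function.update x i y)) (x i) =
      ∑ k, pd i k (pd i k φ) x := by
  have hupd : ∀ y, Function.update x i y =
      ContinuousLinearMap.single ℝ (fun _ : Fin N => EuclideanSpace ℝ (Fin 3)) i y +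
        Function.update x i 0 := by
    intro y
    funext j
    by_cases hj : j = i
    · subst hj; simp
    · simp [hj]
  have haff : ∀ y, HasFDerivAt (fun y => Function.update x i y)
      (ContinuousLinearMap.single ℝ (fun _ : Fin N => EuclideanSpace ℝ (Fin 3)) i) y := by
    intro y
    rw [funext hupd]
    exact (ContinuousLinearMap.hasFDerivAt _).add_const _
  have h1 : ∀ (χ : Config N → ℂ), ContDiff ℝ ∞ χ → ∀ y k,
      fderiv ℝ (fun y => χ (Function.update x i y)) y (EuclideanSpace.single k 1) =
        pd i k χ (Function.update x i y) := by
    intro χ hχ y k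
    have h := ((contDiff_differentiable hχ _).hasFDerivAt).comp y (haff y)
    have h2 : HasFDerivAt (fun y => χ (Function.update x i y)) _ y := h
    rw [h2.fderiv]
    rfl
  have hsm : ContDiff ℝ ∞ fun y => φ (Function.update x i y) := by
    refine hφ.comp ?_
    rw [funext hupd]
    exact (ContinuousLinearMap.contDiff _).add contDiff_const
  rw [congrFun (InnerProductSpace.laplacian_eq_iteratedFDeriv_orthonormalBasis _
    (EuclideanSpace.basisFun (Fin 3) ℝ)) (x i)]
  refine Finset.sum_congr rfl fun k _ => ?_
  rw [iteratedFDeriv_two_apply]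
  simp only [EuclideanSpace.basisFun_apply, Matrix.cons_val_zero, Matrix.cons_val_one]
  have h2 : (fun y => fderiv ℝ (fun y => φ (Function.update x i y)) y (EuclideanSpace.single k 1))
      = fun y => pd i k φ (Function.update x i y) := funext fun y => h1 φ hφ y k
  have hd : DifferentiableAt ℝ (fderiv ℝ (fun y => φ (Function.update x i y))) (x i) :=
    ((hsm.fderiv_right (m := ∞) (by simp)).differentiable (by simp)) _
  have h3 : fderiv ℝ (fun y => fderiv ℝ (fun y => φ (Function.update x i y)) y
      (EuclideanSpace.single k 1)) (x i) (EuclideanSpace.single k 1) =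
      fderiv ℝ (fderiv ℝ (fun y => φ (Function.update x i y))) (x i) (EuclideanSpace.single k 1)
        (EuclideanSpace.single k 1) := by
    rw [fderiv_clm_apply hd (differentiableAt_const _)]
    simp
  rw [← h3, h2, h1 _ (contDiff_pd hφ i k), Function.update_eq_self]

/-- The sum of the pair potentials. -/
def pairSum (W : EuclideanSpace ℝ (Fin 3) → ℝ) (x : Config N) : ℝ :=
  ∑ i, ∑ j ∈ Finset.Ioi i, W (x i - x j)

theorem hamiltonianApply_eq (W : EuclideanSpace ℝ (Fin 3) → ℝ) {φ : Config N → ℂ}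
    (hφ : ContDiff ℝ ∞ φ) (x : Config N) :
    hamiltonianApply W φ x = -∑ i, ∑ k, pd i k (pd i k φ) x + (pairSum W x : ℂ) * φ x := by
  rw [hamiltonianApply, Finset.sum_congr rfl fun i _ => laplacian_update_eq hφ i x]
  rfl

/-- The sum over `i < j` is not visibly invariant under relabelling, whereas the full double sum is.
This identity transfers the invariance to the pair potential, the diagonal being the constant `W 0`
there. -/
theorem sum_sum_Ioi {n : ℕ} {f : Fin n → Fin n → ℝ} (hf : ∀ i j, f i j = f j i) :
    ∑ i, ∑ j, f i j = 2 * ∑ i, ∑ j ∈ Finset.Ioi i, f i j + ∑ i, f i i := by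
  have h1 : ∀ i, ∑ j, f i j =
      ∑ j ∈ Finset.Iio i, f i j + f i i + ∑ j ∈ Finset.Ioi i, f i j := by
    intro i
    rw [← Finset.sum_filter_add_sum_filter_not Finset.univ (fun j => j ≤ i),
      ← Finset.sum_filter_add_sum_filter_not (Finset.univ.filter fun j => j ≤ i) (fun j => j < i)]
    congr 1
    · congr 1
      · refine Finset.sum_congr ?_ fun _ _ => rfl
        ext j; simp; exact fun h => h.le
      · have : (Finset.univ.filter fun j => j ≤ i).filter (fun j => ¬ j < i) = {i} := by
          ext j; simp; constructor
          · rintro ⟨h1, h2⟩; exact le_antisymm h1 h2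
          · rintro rfl; simp
        rw [this, Finset.sum_singleton]
    · refine Finset.sum_congr ?_ fun _ _ => rfl
      ext j; simp
  have h2 : ∑ i, ∑ j ∈ Finset.Iio i, f i j = ∑ i, ∑ j ∈ Finset.Ioi i, f i j := by
    rw [Finset.sum_comm' (s' := fun j => Finset.Ioi j) (t' := Finset.univ) (by simp)]
    exact Finset.sum_congr rfl fun i _ => Finset.sum_congr rfl fun j _ => hf j i
  rw [Finset.sum_congr rfl fun i _ => h1 i, Finset.sum_add_distrib, Finset.sum_add_distrib, h2]
  ring

theorem pairSum_perm {W : EuclideanSpace ℝ (Fin 3) → ℝ} (hW : ∀ z, W (-z) = W z)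
    (σ : Equiv.Perm (Fin N)) (x : Config N) :
    pairSum W (fun i => x (σ i)) = pairSum W x := by
  have hsym : ∀ (y : Config N) i j, W (y i - y j) = W (y j - y i) := fun y i j => by
    rw [← hW, neg_sub]
  have h1 := sum_sum_Ioi (hsym x)
  have h2 := sum_sum_Ioi (hsym fun i => x (σ i))
  have h3 : ∑ i, ∑ j, W (x (σ i) - x (σ j)) = ∑ i, ∑ j, W (x i - x j) := by
    rw [← Equiv.sum_comp σ (fun i => ∑ j, W (x i - x j))]
    exact Finset.sum_congr rfl fun i _ => Equiv.sum_comp σ (fun j => W (x (σ i) - x j))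
  simp only [sub_self] at h1 h2
  simp only [pairSum]
  linarith

theorem hamiltonianApply_perm {W : EuclideanSpace ℝ (Fin 3) → ℝ} (hW : ∀ z, W (-z) = W z)
    {φ : Config N → ℂ} (hφ : IsSymmetric φ) : IsSymmetric (hamiltonianApply W φ) := by
  intro σ x
  have h1 : ∀ i y, φ (Function.update (fun i => x (σ i)) i y) =
      φ (Function.update x (σ i) y) := by
    intro i y
    rw [← hφ σ (Function.update x (σ i) y)]
    congr 1
    funext j
    by_cases hj : j = i
    · subst hj; simp
    · rw [Function.update_of_ne hj, Function.update_of_ne (fun h => hj (σ.injective h))]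
  have h2 := pairSum_perm hW σ x
  simp only [pairSum] at h2
  simp only [hamiltonianApply, h1, h2, hφ σ x]
  congr 2
  exact Equiv.sum_comp σ (fun i => Laplacian.laplacian (fun y => φ (Function.update x i y)) (x i))

theorem abs_pairSum_le {W : EuclideanSpace ℝ (Fin 3) → ℝ} {C : ℝ} (hW : ∀ z, |W z| ≤ C)
    (x : Config N) : |pairSum W x| ≤ N * (N * C) := by
  have hC : 0 ≤ C := (abs_nonneg _).trans (hW 0)
  refine (Finset.abs_sum_le_sum_abs _ _).trans ?_
  refine (Finset.sum_le_sum fun i _ => (Finset.abs_sum_le_sum_abs _ _).trans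
    (Finset.sum_le_sum fun j _ => hW _)).trans ?_
  have h : ∀ i : Fin N, ∑ _j ∈ Finset.Ioi i, C ≤ N * C := by
    intro i
    rw [Finset.sum_const, nsmul_eq_mul]
    refine mul_le_mul_of_nonneg_right ?_ hC
    exact_mod_cast (Finset.card_le_univ _).trans (by simp)
  refine (Finset.sum_le_sum fun i _ => h i).trans ?_
  simp

theorem measurable_pairSum {W : EuclideanSpace ℝ (Fin 3) → ℝ} (hW : Measurable W) :
    Measurable (pairSum W : Config N → ℝ) := by
  refine Finset.measurable_fun_sum _ fun i _ => Finset.measurable_fun_sum _ fun j _ => ?_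
  exact hW.comp (by fun_prop)

theorem exists_isCompact_box_subset (N : ℕ) (L : ℝ) : ∃ K : Set (Config N), IsCompact K ∧ box N L ⊆ K := by
  refine ⟨(fun (y : Fin N → Fin 3 → ℝ) i => WithLp.toLp 2 (y i)) ''
    (Set.pi Set.univ fun _ => Set.pi Set.univ fun _ => Set.Icc 0 L), ?_, ?_⟩
  · refine IsCompact.image (isCompact_univ_pi fun _ => isCompact_univ_pi fun _ => isCompact_Icc) ?_
    exact continuous_pi fun i => (PiLp.continuous_toLp 2 _).comp (continuous_apply i)
  · intro x hx
    exact ⟨fun i k => x i k, fun i _ k _ => Set.Ioo_subset_Icc_self (hx i k), rfl⟩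

instance isFiniteMeasure_boxMeasure : IsFiniteMeasure (boxMeasure N L) := by
  obtain ⟨K, hK, hb⟩ := exists_isCompact_box_subset N L
  exact ⟨by rw [Measure.restrict_apply_univ]; exact (measure_mono hb).trans_lt hK.measure_lt_top⟩

theorem exists_bound_on_box {φ : Config N → ℂ} (hφ : Continuous φ) :
    ∃ C, ∀ x ∈ box N L, ‖φ x‖ ≤ C := by
  obtain ⟨K, hK, hb⟩ := exists_isCompact_box_subset N L
  obtain ⟨C, hC⟩ := hK.exists_bound_of_continuousOn hφ.continuousOn
  exact ⟨C, fun x hx => hC x (hb hx)⟩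

theorem memLp_box {p : ℝ≥0∞} {φ : Config N → ℂ} (hφ : Measurable φ) {C : ℝ}
    (hC : ∀ x ∈ box N L, ‖φ x‖ ≤ C) : MemLp φ p (boxMeasure N L) :=
  MemLp.of_bound hφ.aestronglyMeasurable C
    ((ae_restrict_iff' (measurableSet_box N L)).2 (Eventually.of_forall hC))

theorem integrableOn_box {φ : Config N → ℂ} (hφ : Continuous φ) : IntegrableOn φ (box N L) := by
  obtain ⟨C, hC⟩ := exists_bound_on_box (L := L) hφ
  exact memLp_one_iff_integrable.1 (memLp_box hφ.measurable hC)

theorem integrableOn_box_mul {W : Config N → ℝ} (hW : Measurable W) {C : ℝ} (hC : ∀ x, |W x| ≤ C)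
    {φ : Config N → ℂ} (hφ : Continuous φ) : IntegrableOn (fun x => (W x : ℂ) * φ x) (box N L) := by
  refine (integrableOn_box hφ).bdd_mul (c := C) ?_ (Eventually.of_forall fun x => ?_)
  · exact (Complex.measurable_ofReal.comp hW).aestronglyMeasurable
  · rw [Complex.norm_real]; exact hC x

/-- Integration of a derivative of a function with support in the box. -/
theorem integral_pd_eq_zero_of_compact {φ : Config N → ℂ} (hφ : ContDiff ℝ ∞ φ)
    (hc : HasCompactSupport φ) (i : Fin N) (k : Fin 3) : ∫ x, pd i k φ x = 0 := by
  have hcd : HasCompactSupport fun x => fderiv ℝ φ x (dir i k) :=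
    (hc.fderiv ℝ).comp_left (g := fun f : Config N →L[ℝ] ℂ => f (dir i k)) rfl
  have h1 : Integrable φ := hφ.continuous.integrable_of_hasCompactSupport hc
  have h2 : Integrable fun x => fderiv ℝ φ x (dir i k) :=
    (contDiff_pd hφ i k).continuous.integrable_of_hasCompactSupport hcd
  have h := integral_mul_fderiv_eq_neg_fderiv_mul_of_integrable (μ := (volume : Measure (Config N)))
    (f := φ) (g := fun _ => (1 : ℂ)) (v := dir i k) (by simpa using h2) (by simp) (by simpa using h1)
    (fun x _ => contDiff_differentiable hφ x) (fun x _ => differentiableAt_const _)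
  simp only [fderiv_fun_const, Pi.zero_apply, _root_.zero_apply, mul_zero, mul_one,
    integral_zero] at h
  exact neg_eq_zero.1 h.symm

theorem IsPeriodic.pd {φ : Config N → ℂ} (hφ : IsPeriodic L φ) (i : Fin N) (k : Fin 3) :
    IsPeriodic L (pd i k φ) := by
  intro x j l
  have h : (fun y => φ (y + Pi.single j (EuclideanSpace.single l L))) = φ :=
    funext fun y => hφ y j l
  have h2 := congrFun (pd_comp_add φ i k (Pi.single j (EuclideanSpace.single l L))) x
  rw [h] at h2
  exact h2.symm

/-- The integral of a derivative of a periodic function over the box vanishes. -/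
theorem integral_pd_eq_zero_of_periodic [Fact (0 < L)] {φ : Config N → ℂ} (hφ : ContDiff ℝ ∞ φ)
    (hp : IsPeriodic L φ) (i : Fin N) (k : Fin 3) : ∫ x in box N L, pd i k φ x = 0 := by
  have hc := (contDiff_pd hφ i k).continuous
  -- Average the fundamental theorem of calculus over the box: by translation invariance the left
  -- side averages to `0`, and on the right every `s` contributes the same integral of `pd i k φ`.
  have h1 : ∀ x, φ (x + dir i k) - φ x = ∫ s in (0:ℝ)..1, pd i k φ (x + s • dir i k) := by
    intro x
    have hd : ∀ s ∈ Set.uIcc (0 : ℝ) 1, HasDerivAt (fun s : ℝ => φ (x + s • dir i k))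
        (pd i k φ (x + s • dir i k)) s := by
      intro s _
      have h2 : HasDerivAt (fun s : ℝ => x + s • dir i k) ((1 : ℝ) • dir i k) s :=
        ((hasDerivAt_id s).smul_const _).const_add x
      rw [one_smul] at h2
      exact (contDiff_differentiable hφ _).hasFDerivAt.comp_hasDerivAt s h2
    rw [intervalIntegral.integral_eq_sub_of_hasDerivAt hd
      (Continuous.intervalIntegrable (by fun_prop) _ _)]
    simp
  have h2 : ∫ x in box N L, (φ (x + dir i k) - φ x) = 0 := by
    rw [integral_sub (integrableOn_box (by have := hφ.continuous; fun_prop))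
      (integrableOn_box hφ.continuous), integral_box_add hp hφ.continuous.measurable, sub_self]
  simp_rw [h1, intervalIntegral.integral_of_le zero_le_one] at h2
  rw [integral_integral_swap] at h2
  · have h3 : ∀ s : ℝ, ∫ x in box N L, pd i k φ (x + s • dir i k) = ∫ x in box N L, pd i k φ x :=
      fun s => integral_box_add (hp.pd i k) hc.measurable _
    simp_rw [h3] at h2
    simpa using h2
  · obtain ⟨K, hK, hb⟩ := exists_isCompact_box_subset N L
    have hcc : Continuous (Function.uncurry fun (x : Config N) (s : ℝ) =>
        pd i k φ (x + s • dir i k)) := by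
      simp only [Function.uncurry_def]
      fun_prop
    rw [Measure.prod_restrict]
    refine IntegrableOn.mono_set (t := K ×ˢ Set.Icc 0 1)
      (hcc.continuousOn.integrableOn_compact (hK.prod isCompact_Icc)) ?_
    exact Set.prod_mono hb Set.Ioc_subset_Icc_self

end Calculus

/-! ### The core Hamiltonians and their quadratic forms. -/

section Cores

variable {N : ℕ} {L : ℝ}

/-- A linear space of smooth functions on which integration by parts over the box holds. -/
structure IsCore (L : ℝ) (𝒦 : Set (Config N → ℂ)) : Prop where
  contDiff : ∀ φ ∈ 𝒦, ContDiff ℝ ∞ φ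
  zero_mem : 0 ∈ 𝒦
  add_mem : ∀ φ ∈ 𝒦, ∀ ψ ∈ 𝒦, φ + ψ ∈ 𝒦
  smul_mem : ∀ (c : ℂ), ∀ φ ∈ 𝒦, c • φ ∈ 𝒦
  integral_pd : ∀ φ ∈ 𝒦, ∀ ψ ∈ 𝒦, ∀ i k,
    ∫ x in box N L, pd i k (fun y => (starRingEnd ℂ) (φ y) * pd i k ψ y) x = 0

theorem isCore_dirichlet (N : ℕ) (L : ℝ) : IsCore L (DirichletCore N L) where
  contDiff φ h := h.1
  zero_mem := ⟨contDiff_const, fun _ _ => rfl, HasCompactSupport.zero, by simp [tsupport]⟩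
  add_mem φ hφ ψ hψ := by
    refine ⟨hφ.1.add hψ.1, fun σ x => ?_, hφ.2.2.1.add hψ.2.2.1, ?_⟩
    · simp only [Pi.add_apply, hφ.2.1 σ x, hψ.2.1 σ x]
    · exact (tsupport_add φ ψ).trans (Set.union_subset hφ.2.2.2 hψ.2.2.2)
  smul_mem c φ hφ := by
    refine ⟨contDiff_const.smul hφ.1, fun σ x => ?_, hφ.2.2.1.smul_left (f := fun _ => c), ?_⟩
    · simp only [Pi.smul_apply, hφ.2.1 σ x]
    · exact (tsupport_smul_subset_right (fun _ => c) φ).trans hφ.2.2.2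
  integral_pd φ hφ ψ hψ i k := by
    have hsm : ContDiff ℝ ∞ fun y => (starRingEnd ℂ) (φ y) * pd i k ψ y :=
      (contDiff_conj hφ.1).mul (contDiff_pd hψ.1 i k)
    have hsupp : tsupport (fun y => (starRingEnd ℂ) (φ y) * pd i k ψ y) ⊆ tsupport φ := by
      refine closure_mono fun x hx => ?_
      simp only [Function.mem_support] at hx ⊢
      intro h
      simp [h] at hx
    have hc : HasCompactSupport fun y => (starRingEnd ℂ) (φ y) * pd i k ψ y :=
      hφ.2.2.1.mono' (subset_tsupport _ |>.trans hsupp)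
    rw [setIntegral_eq_integral_of_forall_compl_eq_zero,
      integral_pd_eq_zero_of_compact hsm hc]
    intro x hx
    have hx' : x ∉ tsupport (fun y => (starRingEnd ℂ) (φ y) * pd i k ψ y) :=
      fun h => hx (hφ.2.2.2 (hsupp h))
    simp only [pd]
    rw [show fderiv ℝ (fun y => (starRingEnd ℂ) (φ y) * fderiv ℝ ψ y (dir i k)) x = 0 from
      image_eq_zero_of_notMem_tsupport fun h => hx' (tsupport_fderiv_subset ℝ h)]
    rfl

theorem isCore_periodic (N : ℕ) (L : ℝ) [Fact (0 < L)] : IsCore L (PeriodicCore N L) where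
  contDiff φ h := h.1
  zero_mem := ⟨contDiff_const, fun _ _ => rfl, fun _ _ _ => rfl⟩
  add_mem φ hφ ψ hψ := by
    refine ⟨hφ.1.add hψ.1, fun σ x => ?_, fun x i k => ?_⟩
    · simp only [Pi.add_apply, hφ.2.1 σ x, hψ.2.1 σ x]
    · simp only [Pi.add_apply, hφ.2.2 x i k, hψ.2.2 x i k]
  smul_mem c φ hφ := by
    refine ⟨contDiff_const.smul hφ.1, fun σ x => ?_, fun x i k => ?_⟩
    · simp only [Pi.smul_apply, hφ.2.1 σ x]
    · simp only [Pi.smul_apply, hφ.2.2 x i k]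
  integral_pd φ hφ ψ hψ i k := by
    refine integral_pd_eq_zero_of_periodic
      ((contDiff_conj hφ.1).mul (contDiff_pd hψ.1 i k)) ?_ i k
    intro x j l
    have h1 := hφ.2.2 x j l
    have h2 := IsPeriodic.pd (L := L) hψ.2.2 i k x j l
    simp only [h1, h2]

variable {𝒦 : Set (Config N → ℂ)}

theorem IsCore.ibp (h : IsCore L 𝒦) {φ ψ : Config N → ℂ} (hφ : φ ∈ 𝒦) (hψ : ψ ∈ 𝒦) (i : Fin N)
    (k : Fin 3) : ∫ x in box N L, (starRingEnd ℂ) (φ x) * pd i k (pd i k ψ) x =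
      -∫ x in box N L, (starRingEnd ℂ) (pd i k φ x) * pd i k ψ x := by
  have hφs := h.contDiff φ hφ
  have hψs := contDiff_pd (h.contDiff ψ hψ) i k
  have h0 := h.integral_pd φ hφ ψ hψ i k
  simp_rw [pd_mul (contDiff_conj hφs) hψs, pd_conj hφs] at h0
  rw [integral_add] at h0
  · exact eq_neg_of_add_eq_zero_right h0
  · exact integrableOn_box (contDiff_conj (contDiff_pd hφs i k) |>.mul hψs).continuous
  · exact integrableOn_box ((contDiff_conj hφs).mul (contDiff_pd hψs i k)).continuous

theorem hamiltonianApply_add (W : EuclideanSpace ℝ (Fin 3) → ℝ) {φ ψ : Config N → ℂ}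
    (hφ : ContDiff ℝ ∞ φ) (hψ : ContDiff ℝ ∞ ψ) (x : Config N) :
    hamiltonianApply W (φ + ψ) x = hamiltonianApply W φ x + hamiltonianApply W ψ x := by
  rw [hamiltonianApply_eq W hφ, hamiltonianApply_eq W hψ, 
    hamiltonianApply_eq W (show ContDiff ℝ ∞ (φ + ψ) from hφ.add hψ)]
  simp only [pd_add hφ hψ, pd_add (contDiff_pd hφ _ _) (contDiff_pd hψ _ _), Pi.add_apply,
    Finset.sum_add_distrib]
  ring

theorem hamiltonianApply_smul (W : EuclideanSpace ℝ (Fin 3) → ℝ) {φ : Config N → ℂ}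
    (hφ : ContDiff ℝ ∞ φ) (c : ℂ) (x : Config N) :
    hamiltonianApply W (c • φ) x = c * hamiltonianApply W φ x := by
  rw [hamiltonianApply_eq W hφ, 
    hamiltonianApply_eq W (show ContDiff ℝ ∞ (c • φ) from contDiff_const.smul hφ)]
  simp only [pd_const_smul hφ, pd_const_smul (contDiff_pd hφ _ _), Pi.smul_apply,
    smul_eq_mul, ← Finset.mul_sum]
  ring

/-- The graph of the Hamiltonian on a core, as a linear space. -/
def coreSubmodule (h : IsCore L 𝒦) (W : EuclideanSpace ℝ (Fin 3) → ℝ) :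
    Submodule ℂ (bosonSpace N L × bosonSpace N L) where
  carrier := coreHamiltonian N L W 𝒦
  zero_mem' := by
    refine ⟨0, h.zero_mem, Lp.coeFn_zero _ _ _, (Lp.coeFn_zero _ _ _).trans ?_⟩
    refine Eventually.of_forall fun x => ?_
    have h1 := hamiltonianApply_smul W (h.contDiff 0 h.zero_mem) 0 x
    rw [zero_smul, zero_mul] at h1
    exact h1.symm
  add_mem' {p q} := by
    rintro ⟨φ, hφ, hp1, hp2⟩ ⟨ψ, hψ, hq1, hq2⟩
    refine ⟨φ + ψ, h.add_mem φ hφ ψ hψ, ?_, ?_⟩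
    · exact (Lp.coeFn_add _ _).trans (hp1.add hq1)
    · refine (Lp.coeFn_add _ _).trans ((hp2.add hq2).trans (Eventually.of_forall fun x => ?_))
      exact (hamiltonianApply_add W (h.contDiff φ hφ) (h.contDiff ψ hψ) x).symm
  smul_mem' c p := by
    rintro ⟨φ, hφ, hp1, hp2⟩
    refine ⟨c • φ, h.smul_mem c φ hφ, ?_, ?_⟩
    · exact (Lp.coeFn_smul _ _).trans (hp1.const_smul c)
    · refine (Lp.coeFn_smul _ _).trans ((hp2.const_smul c).trans (Eventually.of_forall fun x => ?_))
      exact (hamiltonianApply_smul W (h.contDiff φ hφ) c x).symm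

theorem inner_bosonSpace {p q : bosonSpace N L} {φ ψ : Config N → ℂ}
    (hp : (p : Lp ℂ 2 (boxMeasure N L)) =ᵐ[boxMeasure N L] φ)
    (hq : (q : Lp ℂ 2 (boxMeasure N L)) =ᵐ[boxMeasure N L] ψ) :
    inner ℂ p q = ∫ x in box N L, (starRingEnd ℂ) (φ x) * ψ x := by
  rw [Submodule.coe_inner, L2.inner_def]
  refine integral_congr_ae ?_
  filter_upwards [hp, hq] with x h1 h2
  rw [h1, h2, RCLike.inner_apply, mul_comm]

/-- The quadratic form of the Hamiltonian. -/
def energyForm (L : ℝ) (W : EuclideanSpace ℝ (Fin 3) → ℝ) (φ ψ : Config N → ℂ) : ℂ :=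
  (∑ i, ∑ k, ∫ x in box N L, (starRingEnd ℂ) (pd i k φ x) * pd i k ψ x) +
    ∫ x in box N L, (pairSum W x : ℂ) * ((starRingEnd ℂ) (φ x) * ψ x)

theorem integrableOn_pairSum_mul {W : EuclideanSpace ℝ (Fin 3) → ℝ} (hW : Measurable W) {C : ℝ}
    (hC : ∀ z, |W z| ≤ C) {φ : Config N → ℂ} (hφ : Continuous φ) :
    IntegrableOn (fun x => (pairSum W x : ℂ) * φ x) (box N L) :=
  integrableOn_box_mul (measurable_pairSum hW) (abs_pairSum_le hC) hφ

theorem IsCore.integral_hamiltonianApply (h : IsCore L 𝒦) {W : EuclideanSpace ℝ (Fin 3) → ℝ}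
    (hW : Measurable W) {C : ℝ} (hC : ∀ z, |W z| ≤ C) {φ ψ : Config N → ℂ} (hφ : φ ∈ 𝒦)
    (hψ : ψ ∈ 𝒦) :
    ∫ x in box N L, (starRingEnd ℂ) (φ x) * hamiltonianApply W ψ x = energyForm L W φ ψ := by
  have hφs := h.contDiff φ hφ
  have hψs := h.contDiff ψ hψ
  have hi : ∀ i k, IntegrableOn
      (fun x => (starRingEnd ℂ) (φ x) * pd i k (pd i k ψ) x) (box N L) := fun i k =>
    integrableOn_box ((contDiff_conj hφs).mul (contDiff_pd (contDiff_pd hψs i k) i k)).continuous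
  have e : ∀ x, (starRingEnd ℂ) (φ x) * hamiltonianApply W ψ x =
      -∑ i, ∑ k, (starRingEnd ℂ) (φ x) * pd i k (pd i k ψ) x +
        (pairSum W x : ℂ) * ((starRingEnd ℂ) (φ x) * ψ x) := by
    intro x
    rw [hamiltonianApply_eq W hψs, mul_add, mul_neg, Finset.mul_sum]
    simp_rw [Finset.mul_sum]
    ring
  simp_rw [e]
  rw [integral_add, integral_neg, integral_finsetSum]
  · simp_rw [integral_finsetSum _ fun k (_ : k ∈ Finset.univ) => hi _ k, h.ibp hφ hψ,
      Finset.sum_neg_distrib, neg_neg]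
    rfl
  · exact fun i _ => integrable_finsetSum _ fun k _ => hi i k
  · exact (integrable_finsetSum _ fun i _ => integrable_finsetSum _ fun k _ => hi i k).neg
  · exact integrableOn_pairSum_mul hW hC ((contDiff_conj hφs).mul hψs).continuous

theorem conj_energyForm (W : EuclideanSpace ℝ (Fin 3) → ℝ) (φ ψ : Config N → ℂ) :
    (starRingEnd ℂ) (energyForm L W φ ψ) = energyForm L W ψ φ := by
  simp only [energyForm, map_add, map_sum, ← integral_conj]
  congr 1
  · refine Finset.sum_congr rfl fun i _ => Finset.sum_congr rfl fun k _ => ?_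
    refine integral_congr_ae (Eventually.of_forall fun x => ?_)
    simp only [map_mul, Complex.conj_conj]
    ring
  · refine integral_congr_ae (Eventually.of_forall fun x => ?_)
    simp only [map_mul, Complex.conj_conj, Complex.conj_ofReal]
    ring

theorem conj_mul_self_eq (z : ℂ) : (starRingEnd ℂ) z * z = ((‖z‖ ^ 2 : ℝ) : ℂ) := by
  rw [← Complex.normSq_eq_conj_mul_self, Complex.normSq_eq_norm_sq]

theorem energyForm_self (W : EuclideanSpace ℝ (Fin 3) → ℝ) (φ : Config N → ℂ) :
    energyForm L W φ φ = (((∑ i, ∑ k, ∫ x in box N L, ‖pd i k φ x‖ ^ 2) +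
      ∫ x in box N L, pairSum W x * ‖φ x‖ ^ 2 : ℝ) : ℂ) := by
  simp only [energyForm, conj_mul_self_eq, ← Complex.ofReal_mul]
  push_cast
  simp only [← Complex.ofReal_pow, ← Complex.ofReal_mul, integral_complex_ofReal]

theorem pairSum_nonneg {W : EuclideanSpace ℝ (Fin 3) → ℝ} (hW : ∀ z, 0 ≤ W z) (x : Config N) :
    0 ≤ pairSum W x :=
  Finset.sum_nonneg fun _ _ => Finset.sum_nonneg fun _ _ => hW _

theorem isNonnegSymmetric_coreSubmodule (h : IsCore L 𝒦) {W : EuclideanSpace ℝ (Fin 3) → ℝ}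
    (hW : Measurable W) (hW0 : ∀ z, 0 ≤ W z) {C : ℝ} (hC : ∀ z, |W z| ≤ C) :
    IsNonnegSymmetric (coreSubmodule h W) where
  symm := by
    rintro p ⟨φ, hφ, hp1, hp2⟩ q ⟨ψ, hψ, hq1, hq2⟩
    refine (inner_conj_symm (𝕜 := ℂ) p.2 q.1).symm.trans ?_
    rw [inner_bosonSpace hq1 hp2, inner_bosonSpace hp1 hq2,
      h.integral_hamiltonianApply hW hC hφ hψ, h.integral_hamiltonianApply hW hC hψ hφ,
      conj_energyForm]
  nonneg := by
    rintro p ⟨φ, hφ, hp1, hp2⟩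
    rw [inner_bosonSpace hp1 hp2, h.integral_hamiltonianApply hW hC hφ hφ, energyForm_self,
      Complex.ofReal_re]
    refine add_nonneg (Finset.sum_nonneg fun i _ => Finset.sum_nonneg fun k _ =>
      integral_nonneg fun x => by positivity) (integral_nonneg fun x => ?_)
    exact mul_nonneg (pairSum_nonneg hW0 x) (by positivity)

theorem measurable_hamiltonianApply {W : EuclideanSpace ℝ (Fin 3) → ℝ} (hW : Measurable W)
    {φ : Config N → ℂ} (hφ : ContDiff ℝ ∞ φ) : Measurable (hamiltonianApply W φ) := by
  rw [funext (hamiltonianApply_eq W hφ)]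
  refine Measurable.add (Measurable.neg ?_) ?_
  · exact Finset.measurable_fun_sum _ fun i _ => Finset.measurable_fun_sum _ fun k _ =>
      (contDiff_pd (contDiff_pd hφ i k) i k).continuous.measurable
  · exact (Complex.measurable_ofReal.comp (measurable_pairSum hW)).mul hφ.continuous.measurable

/-- Every symmetric function in a core defines an element of the graph of the Hamiltonian. -/
theorem exists_mem_coreSubmodule (h : IsCore L 𝒦) {W : EuclideanSpace ℝ (Fin 3) → ℝ}
    (hW : Measurable W) {C : ℝ} (hC : ∀ z, |W z| ≤ C) (hWe : ∀ z, W (-z) = W z)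
    {φ : Config N → ℂ} (hφ : φ ∈ 𝒦) (hs : IsSymmetric φ) :
    ∃ p ∈ coreSubmodule h W, (p.1 : Lp ℂ 2 (boxMeasure N L)) =ᵐ[boxMeasure N L] φ ∧
      (p.2 : Lp ℂ 2 (boxMeasure N L)) =ᵐ[boxMeasure N L] hamiltonianApply W φ := by
  have hφs := h.contDiff φ hφ
  have key : ∀ χ : Config N → ℂ, Measurable χ → IsSymmetric χ →
      (∃ C, ∀ x ∈ box N L, ‖χ x‖ ≤ C) →
      ∃ u : bosonSpace N L, (u : Lp ℂ 2 (boxMeasure N L)) =ᵐ[boxMeasure N L] χ := by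
    rintro χ hχ hsym ⟨C, hC⟩
    have hm : MemLp χ 2 (boxMeasure N L) := memLp_box hχ hC
    have hae := hm.coeFn_toLp
    refine ⟨⟨hm.toLp χ, fun σ => ?_⟩, hae⟩
    have h1 := (measurePreserving_perm N L σ).quasiMeasurePreserving.ae_eq_comp hae
    refine h1.trans (EventuallyEq.trans (Eventually.of_forall fun x => ?_) hae.symm)
    exact hsym σ x
  obtain ⟨u, hu⟩ := key φ hφs.continuous.measurable hs (exists_bound_on_box hφs.continuous)
  obtain ⟨v, hv⟩ := key _ (measurable_hamiltonianApply hW hφs) (hamiltonianApply_perm hWe hs) (by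
    have hl : Continuous fun x => ∑ i, ∑ k, pd i k (pd i k φ) x :=
      continuous_finsetSum _ fun i _ => continuous_finsetSum _ fun k _ =>
        (contDiff_pd (contDiff_pd hφs i k) i k).continuous
    obtain ⟨C1, hC1⟩ := exists_bound_on_box (L := L) hl
    obtain ⟨C2, hC2⟩ := exists_bound_on_box (L := L) hφs.continuous
    refine ⟨C1 + N * (N * C) * C2, fun x hx => ?_⟩
    rw [hamiltonianApply_eq W hφs]
    refine (norm_add_le _ _).trans (add_le_add ((norm_neg _).trans_le (hC1 x hx)) ?_)
    rw [norm_mul, Complex.norm_real]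
    have h3 := abs_pairSum_le hC x
    exact mul_le_mul h3 (hC2 x hx) (norm_nonneg _) ((abs_nonneg _).trans h3))
  exact ⟨(u, v), ⟨φ, hφ, hu, hv⟩, hu, hv⟩

end Cores

/-! ### The one-dimensional cutoff. -/

section Cutoff

theorem exists_deriv_smoothTransition_bound : ∃ B : ℝ, 0 ≤ B ∧
    ∀ x, |deriv Real.smoothTransition x| ≤ B := by
  have hc : Continuous (deriv Real.smoothTransition) :=
    (Real.smoothTransition.contDiff (n := 1)).continuous_deriv le_rfl
  obtain ⟨B, hB⟩ := (isCompact_Icc (a := (0 : ℝ)) (b := 1)).exists_bound_of_continuousOn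
    hc.continuousOn
  refine ⟨B, (norm_nonneg _).trans (hB 0 (by simp)), fun x => ?_⟩
  by_cases hx : x ∈ Set.Icc (0 : ℝ) 1
  · exact hB x hx
  · have h0 : deriv Real.smoothTransition x = 0 := by
      rw [Set.mem_Icc, not_and_or, not_le, not_le] at hx
      rcases hx with hx | hx
      · have h : Real.smoothTransition =ᶠ[𝓝 x] fun _ => 0 := by
          filter_upwards [Iio_mem_nhds hx] with y hy
          exact Real.smoothTransition.zero_of_nonpos (le_of_lt hy)
        rw [h.deriv_eq, deriv_const]
      · have h : Real.smoothTransition =ᶠ[𝓝 x] fun _ => 1 := by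
          filter_upwards [Ioi_mem_nhds hx] with y hy
          exact Real.smoothTransition.one_of_one_le (le_of_lt hy)
        rw [h.deriv_eq, deriv_const]
    rw [h0, abs_zero]
    exact (norm_nonneg _).trans (hB 0 (by simp))

/-- A smooth function supported in `(0, L + δ)` whose square has periodization `1`, with the
constant `C` in the bound on its derivative. -/
structure IsCutoff (C L δ : ℝ) (h : ℝ → ℝ) : Prop where
  contDiff : ContDiff ℝ ∞ h
  support : ∀ t, t ∉ Set.Icc (δ / 3) (L + 2 * δ / 3) → h t = 0
  sq_add_sq : ∀ t ∈ Set.Ioc 0 L, h t ^ 2 + h (t + L) ^ 2 = 1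
  deriv_sq_le : ∀ t ∈ Set.Ico 0 L, deriv h t ^ 2 + deriv h (t + L) ^ 2 ≤
    if t ∈ Set.Ioo 0 δ then C / δ ^ 2 else 0

/-- Let `S` climb smoothly from `0` to `1` on `[δ/3, 2δ/3]` and take `sin(πS(t)/2) cos(πS(t-L)/2)`.
On one period only the sine is active at `t` and only the cosine at `t + L`, so the squares add to
`1` and the squared derivatives to `(πS'/2)²`. The constant comes from `S' ≤ 3B/δ`, with `B` a bound
for the derivative of the smooth transition; it depends on neither `L` nor `δ`. -/
theorem exists_isCutoff : ∃ C : ℝ, 0 ≤ C ∧ ∀ L δ : ℝ, 0 < δ → δ ≤ L →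
    ∃ h, IsCutoff C L δ h := by
  obtain ⟨B, hB0, hB⟩ := exists_deriv_smoothTransition_bound
  refine ⟨(3 * (Real.pi / 2) * B) ^ 2, by positivity, fun L δ hδ hL => ?_⟩
  set S : ℝ → ℝ := fun t => Real.smoothTransition (3 / δ * t - 1) with hS
  have hSd : ∀ t, HasDerivAt S (deriv Real.smoothTransition (3 / δ * t - 1) * (3 / δ)) t := by
    intro t
    have h1 : HasDerivAt Real.smoothTransition (deriv Real.smoothTransition (3 / δ * t - 1))
        (3 / δ * t - 1) :=
      ((Real.smoothTransition.contDiff (n := 1)).differentiable (by simp) _).hasDerivAt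
    have h2 : HasDerivAt (fun t => 3 / δ * t - 1) (3 / δ) t := by
      simpa using ((hasDerivAt_id t).const_mul (3 / δ)).sub_const 1
    exact h1.comp t h2
  have hS0 : ∀ t, t ≤ δ / 3 → S t = 0 := by
    intro t ht
    refine Real.smoothTransition.zero_of_nonpos ?_
    have : 3 / δ * t ≤ 3 / δ * (δ / 3) := by gcongr
    have h2 : 3 / δ * (δ / 3) = 1 := by field_simp
    linarith
  have hS1 : ∀ t, 2 * δ / 3 ≤ t → S t = 1 := by
    intro t ht
    refine Real.smoothTransition.one_of_one_le ?_
    have : 3 / δ * (2 * δ / 3) ≤ 3 / δ * t := by gcongr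
    have h2 : 3 / δ * (2 * δ / 3) = 2 := by field_simp
    linarith
  have hSs : ContDiff ℝ ∞ S := Real.smoothTransition.contDiff.comp (by fun_prop)
  set h : ℝ → ℝ := fun t => Real.sin (Real.pi / 2 * S t) * Real.cos (Real.pi / 2 * S (t - L))
  have hl : ∀ t, t ≤ L + δ / 3 → h t = Real.sin (Real.pi / 2 * S t) := by
    intro t ht
    simp only [h]
    rw [hS0 (t - L) (by linarith)]
    simp
  have hr : ∀ t, -δ / 3 ≤ t → h (t + L) = Real.cos (Real.pi / 2 * S t) := by
    intro t ht
    simp only [h]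
    rw [hS1 (t + L) (by linarith), add_sub_cancel_right]
    simp
  refine ⟨h, ?_, ?_, ?_, ?_⟩
  · have h2 : ContDiff ℝ ∞ fun t => S (t - L) := hSs.comp (contDiff_id.sub contDiff_const)
    exact (Real.contDiff_sin.comp (contDiff_const.mul hSs)).mul
      (Real.contDiff_cos.comp (contDiff_const.mul h2))
  · intro t ht
    rw [Set.mem_Icc, not_and_or, not_le, not_le] at ht
    simp only [h]
    rcases ht with ht | ht
    · rw [hS0 t ht.le]; simp
    · rw [hS1 (t - L) (by linarith)]; simp
  · intro t ht
    rw [hl t (by linarith [ht.2]), hr t (by linarith [ht.1]), Real.sin_sq_add_cos_sq]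
  · intro t ht
    set S' := deriv Real.smoothTransition (3 / δ * t - 1) * (3 / δ)
    have e1 : h =ᶠ[𝓝 t] fun u => Real.sin (Real.pi / 2 * S u) := by
      filter_upwards [Iio_mem_nhds (show t < L + δ / 3 by linarith [ht.2])] with u hu
      exact hl u (le_of_lt hu)
    have e2 : (fun u => h (u + L)) =ᶠ[𝓝 t] fun u => Real.cos (Real.pi / 2 * S u) := by
      filter_upwards [Ioi_mem_nhds (show -δ / 3 < t by linarith [ht.1])] with u hu
      exact hr u (le_of_lt hu)
    have d1 : deriv h t = Real.cos (Real.pi / 2 * S t) * (Real.pi / 2 * S') := by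
      rw [e1.deriv_eq]
      exact ((hSd t).const_mul (Real.pi / 2)).sin.deriv
    have d2 : deriv h (t + L) = -Real.sin (Real.pi / 2 * S t) * (Real.pi / 2 * S') := by
      rw [← deriv_comp_add_const, e2.deriv_eq]
      exact ((hSd t).const_mul (Real.pi / 2)).cos.deriv
    have d3 : deriv h t ^ 2 + deriv h (t + L) ^ 2 = (Real.pi / 2 * S') ^ 2 := by
      rw [d1, d2]
      linear_combination (Real.pi / 2 * S') ^ 2 * Real.sin_sq_add_cos_sq (Real.pi / 2 * S t)
    rw [d3]
    split_ifs with hi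
    · rw [← sq_abs, ← div_pow]
      refine pow_le_pow_left₀ (abs_nonneg _) ?_ 2
      simp only [S', abs_mul, abs_of_pos (div_pos Real.pi_pos two_pos),
        abs_of_pos (div_pos three_pos hδ)]
      calc Real.pi / 2 * (|deriv Real.smoothTransition (3 / δ * t - 1)| * (3 / δ))
          ≤ Real.pi / 2 * (B * (3 / δ)) := by
            have := Real.pi_pos
            gcongr
            exact hB _
        _ = 3 * (Real.pi / 2) * B / δ := by ring
    · have h0 : S' = 0 := by
        rw [show S' = deriv S t from (hSd t).deriv.symm]
        by_cases h0 : 0 < t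
        · have h1 : δ ≤ t := not_lt.1 fun h1 => hi ⟨h0, h1⟩
          have e : S =ᶠ[𝓝 t] fun _ => 1 := by
            filter_upwards [Ioi_mem_nhds (show 2 * δ / 3 < t by linarith)] with u hu
            exact hS1 u (le_of_lt hu)
          rw [e.deriv_eq, deriv_const]
        · have e : S =ᶠ[𝓝 t] fun _ => 0 := by
            filter_upwards [Iio_mem_nhds (show t < δ / 3 by linarith)] with u hu
            exact hS0 u (le_of_lt hu)
          rw [e.deriv_eq, deriv_const]
      rw [h0]; simp

end Cutoff

/-! ### Folding product weights onto the torus. -/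

section Periodization

variable {N : ℕ} {L : ℝ} [hL : Fact (0 < L)] {X : Type*} [NormedAddCommGroup X] [NormedSpace ℝ X]

/-- The integral of a periodic function against a product weight is its integral over the box
against the periodization of the weight. -/
theorem integral_prod_smul_periodic {g : Fin N × Fin 3 → ℝ → ℝ} (hg : ∀ p, Continuous (g p))
    (hg0 : ∀ p t, 0 ≤ g p t) (hsupp : ∀ p, ∀ t, t ∉ Set.Ioc 0 (2 * L) → g p t = 0)
    {F : Config N → X} (hF : IsPeriodic L F) (hFm : StronglyMeasurable F) :
    ∫ x : Config N, (∏ p : Fin N × Fin 3, g p (x p.1 p.2)) • F x =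
      ∫ x in box N L, (∏ p : Fin N × Fin 3, (g p (x p.1 p.2) + g p (x p.1 p.2 + L))) • F x := by
  have hL' : 0 < L := hL.out
  set γ : Fin N → Fin 3 → ℝ → ℝ≥0∞ := fun i k t => ENNReal.ofReal (g (i, k) t) with hγ
  -- The folded weight has to be a function on the circle, so it is written through the
  -- representative in `(0, L]`; on the box this representative is the coordinate itself.
  set r : AddCircle L → ℝ := fun y => (AddCircle.equivIoc L 0 y : ℝ) with hr
  have hrm : Measurable r :=
    measurable_subtype_coe.comp (AddCircle.measurableEquivIoc L 0).measurable
  have hrt : ∀ t ∈ Set.Ioc 0 L, r (t : AddCircle L) = t := by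
    intro t ht
    have h := AddCircle.equivIoc_coe_eq (p := L) (a := 0) (x := t) (by simpa using ht)
    simp only [hr, h]
  set w : Fin N → Fin 3 → AddCircle L → ℝ≥0∞ := fun i k y =>
    γ i k (r y) + γ i k (r y + L) with hw
  have hγm : ∀ i k, Measurable (γ i k) := fun i k => (hg (i, k)).measurable.ennreal_ofReal
  have hwm : ∀ i k, Measurable (w i k) := fun i k =>
    ((hγm i k).comp hrm).add ((hγm i k).comp (hrm.add_const L))
  have hγs : ∀ i k t, t ∉ Set.Ioc 0 (2 * L) → γ i k t = 0 := fun i k t ht => by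
    simp only [hγ, hsupp (i, k) t ht, ENNReal.ofReal_zero]
  have hfin : ∀ i k, ∫⁻ t, γ i k t ≠ ⊤ := by
    intro i k
    have hcs : HasCompactSupport (g (i, k)) := by
      refine HasCompactSupport.intro (isCompact_Icc (a := 0) (b := 2 * L)) fun t ht => ?_
      exact hsupp _ t fun h => ht ⟨h.1.le, h.2⟩
    have hi : HasFiniteIntegral (g (i, k)) volume :=
      ((hg (i, k)).integrable_of_hasCompactSupport hcs).hasFiniteIntegral
    rw [hasFiniteIntegral_iff_ofReal (Eventually.of_forall (hg0 (i, k)))] at hi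
    exact hi.ne
  have hmap := map_toTorus_withDensity (N := N) hγm hwm hfin fun i k =>
    map_mk_withDensity (hγm i k) (hγs i k) (hwm i k) fun t ht => by simp only [hw, hrt t ht]
  have hprod : ∀ x : Config N, ∏ i, ∏ k, γ i k (x i k) =
      ENNReal.ofReal (∏ p : Fin N × Fin 3, g p (x p.1 p.2)) := by
    intro x
    rw [ENNReal.ofReal_prod_of_nonneg fun p _ => hg0 p _, Fintype.prod_prod_type]
  have hpos : ∀ x : Config N, 0 ≤ ∏ p : Fin N × Fin 3, g p (x p.1 p.2) := fun x =>
    Finset.prod_nonneg fun p _ => hg0 p _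
  have hm1 : Measurable fun x : Config N => ∏ i, ∏ k, γ i k (x i k) :=
    Finset.measurable_fun_prod _ fun i _ => Finset.measurable_fun_prod _ fun k _ =>
      (hγm i k).comp (by fun_prop)
  have hm2 : Measurable fun y : Torus N L => ∏ i, ∏ k, w i k (y i k) :=
    Finset.measurable_fun_prod _ fun i _ => Finset.measurable_fun_prod _ fun k _ =>
      (hwm i k).comp (by fun_prop)
  have hwfin : ∀ y : Torus N L, ∏ i, ∏ k, w i k (y i k) < ⊤ := fun y =>
    ENNReal.prod_lt_top fun i _ => ENNReal.prod_lt_top fun k _ =>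
      ENNReal.add_lt_top.2 ⟨ENNReal.ofReal_lt_top, ENNReal.ofReal_lt_top⟩
  have hFt : StronglyMeasurable fun y : Torus N L => F (ofTorus y) :=
    hFm.comp_measurable measurable_ofTorus
  have e1 : ∫ x : Config N, (∏ p : Fin N × Fin 3, g p (x p.1 p.2)) • F x =
      ∫ x, F x ∂(volume.withDensity fun x : Config N => ∏ i, ∏ k, γ i k (x i k)) := by
    rw [integral_withDensity_eq_integral_toReal_smul hm1
      (Eventually.of_forall fun x => by rw [hprod]; exact ENNReal.ofReal_lt_top)]
    refine integral_congr_ae (Eventually.of_forall fun x => ?_)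
    simp only [hprod, ENNReal.toReal_ofReal (hpos x)]
  have e2 : ∫ x, F x ∂(volume.withDensity fun x : Config N => ∏ i, ∏ k, γ i k (x i k)) =
      ∫ y, F (ofTorus y) ∂((volume.withDensity fun x : Config N =>
        ∏ i, ∏ k, γ i k (x i k)).map (toTorus N L)) := by
    rw [integral_map measurable_toTorus.aemeasurable hFt.aestronglyMeasurable]
    exact integral_congr_ae (Eventually.of_forall fun x => (hF.apply_ofTorus x).symm)
  have hsm : StronglyMeasurable fun y : Torus N L =>
      (∏ i, ∏ k, w i k (y i k)).toReal • F (ofTorus y) :=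
    hm2.ennreal_toReal.stronglyMeasurable.smul hFt
  rw [e1, e2, hmap, integral_withDensity_eq_integral_toReal_smul hm2
    (Eventually.of_forall hwfin), ← measurePreserving_toTorus.map_eq,
    integral_map measurable_toTorus.aemeasurable hsm.aestronglyMeasurable]
  refine setIntegral_congr_fun (measurableSet_box N L) fun x hx => ?_
  have hx' : ∀ i k, r ((x i k : ℝ) : AddCircle L) = x i k := fun i k =>
    hrt _ (Set.Ioo_subset_Ioc_self (hx i k))
  simp only [hF.apply_ofTorus, toTorus, hw, hx', hγ]
  congr 1
  rw [ENNReal.toReal_prod, Fintype.prod_prod_type]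
  refine Finset.prod_congr rfl fun i _ => ?_
  rw [ENNReal.toReal_prod]
  refine Finset.prod_congr rfl fun k _ => ?_
  rw [ENNReal.toReal_add ENNReal.ofReal_ne_top ENNReal.ofReal_ne_top,
    ENNReal.toReal_ofReal (hg0 _ _), ENNReal.toReal_ofReal (hg0 _ _)]

end Periodization

/-! ### Products of functions of single coordinates. -/

section ProductFunctions

variable {N : ℕ}

/-- The product of functions of the coordinates. -/
def prodFun (f : Fin N × Fin 3 → ℝ → ℝ) (x : Config N) : ℝ := ∏ p, f p (x p.1 p.2)

theorem contDiff_prodFun {f : Fin N × Fin 3 → ℝ → ℝ} (hf : ∀ p, ContDiff ℝ ∞ (f p)) :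
    ContDiff ℝ ∞ (prodFun f) := by
  refine contDiff_prod fun p _ => (hf p).comp ?_
  fun_prop

theorem continuous_prodFun {f : Fin N × Fin 3 → ℝ → ℝ} (hf : ∀ p, Continuous (f p)) :
    Continuous (prodFun f) :=
  continuous_finsetProd _ fun p _ => (hf p).comp (by fun_prop)

theorem pd_prodFun {f : Fin N × Fin 3 → ℝ → ℝ} (hf : ∀ p, ContDiff ℝ ∞ (f p)) (i : Fin N)
    (k : Fin 3) (x : Config N) :
    pd i k (fun y => (prodFun f y : ℂ)) x =
      (prodFun (Function.update f (i, k) (deriv (f (i, k)))) x : ℂ) := by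
  have hc : ContDiff ℝ ∞ fun y => (prodFun f y : ℂ) :=
    Complex.ofRealCLM.contDiff.comp (contDiff_prodFun hf)
  have hline : HasDerivAt (fun s : ℝ => x + s • dir i k) (dir i k) 0 := by
    simpa using ((hasDerivAt_id (0 : ℝ)).smul_const (dir i k)).const_add x
  have h1 : HasDerivAt (fun s : ℝ => (prodFun f (x + s • dir i k) : ℂ))
      (pd i k (fun y => (prodFun f y : ℂ)) x) 0 := by
    have h := (contDiff_differentiable hc (x + (0 : ℝ) • dir i k)).hasFDerivAt.comp_hasDerivAt 0 hline
    rw [zero_smul, add_zero] at h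
    exact h
  have e : ∀ s : ℝ, prodFun f (x + s • dir i k) =
      f (i, k) (x i k + s) * ∏ p ∈ Finset.univ.erase (i, k), f p (x p.1 p.2) := by
    intro s
    rw [prodFun, ← Finset.mul_prod_erase _ _ (Finset.mem_univ (i, k))]
    congr 1
    · simp [dir]
    · refine Finset.prod_congr rfl fun p hp => ?_
      have hp' : p ≠ (i, k) := (Finset.mem_erase.1 hp).1
      congr 1
      by_cases h : p.1 = i
      · have h2 : p.2 ≠ k := fun h2 => hp' (Prod.ext h h2)
        simp only [dir, Pi.add_apply, Pi.smul_apply, PiLp.add_apply, PiLp.smul_apply, ← h,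
          Pi.single_eq_same]
        simp [h2]
      · simp [dir, Pi.single_eq_of_ne h]
  have h2 : HasDerivAt (fun s : ℝ => prodFun f (x + s • dir i k))
      (deriv (f (i, k)) (x i k) * ∏ p ∈ Finset.univ.erase (i, k), f p (x p.1 p.2)) 0 := by
    rw [funext e]
    refine HasDerivAt.mul_const ?_ _
    have h3 : HasDerivAt (f (i, k)) (deriv (f (i, k)) (x i k)) (x i k + 0) := by
      rw [add_zero]
      exact ((hf (i, k)).differentiable (by simp) _).hasDerivAt
    simpa using h3.comp_const_add (x i k) 0
  rw [h1.unique h2.ofReal_comp]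
  congr 1
  rw [prodFun, ← Finset.mul_prod_erase _ _ (Finset.mem_univ (i, k))]
  congr 1
  · simp
  · refine Finset.prod_congr rfl fun p hp => ?_
    rw [Function.update_of_ne (Finset.mem_erase.1 hp).1]

theorem isCompact_closedBox (N : ℕ) (a b : ℝ) :
    IsCompact {x : Config N | ∀ i k, x i k ∈ Set.Icc a b} := by
  have : {x : Config N | ∀ i k, x i k ∈ Set.Icc a b} =
      (fun (y : Fin N → Fin 3 → ℝ) i => WithLp.toLp 2 (y i)) ''
        (Set.pi Set.univ fun _ => Set.pi Set.univ fun _ => Set.Icc a b) := by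
    ext x
    constructor
    · exact fun hx => ⟨fun i k => x i k, fun i _ k _ => hx i k, rfl⟩
    · rintro ⟨y, hy, rfl⟩ i k
      exact hy i trivial k trivial
  rw [this]
  refine IsCompact.image (isCompact_univ_pi fun _ => isCompact_univ_pi fun _ => isCompact_Icc) ?_
  exact continuous_pi fun i => (PiLp.continuous_toLp 2 _).comp (continuous_apply i)

theorem prodFun_eq_zero {f : Fin N × Fin 3 → ℝ → ℝ} {a b : ℝ}
    (hf : ∀ p, ∀ t, t ∉ Set.Icc a b → f p t = 0) {x : Config N}
    (hx : x ∉ {x : Config N | ∀ i k, x i k ∈ Set.Icc a b}) : prodFun f x = 0 := by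
  simp only [Set.mem_ofPred_eq, not_forall] at hx
  obtain ⟨i, k, h⟩ := hx
  exact Finset.prod_eq_zero (Finset.mem_univ (i, k)) (hf (i, k) _ h)

end ProductFunctions

/-! ### Integrals of periodic functions against the squared cutoff and its derivatives. -/

section CutoffIntegrals

variable {N : ℕ} {C L δ L' : ℝ} {h : ℝ → ℝ}

theorem IsCutoff.deriv_support (hh : IsCutoff C L δ h) (t : ℝ)
    (ht : t ∉ Set.Icc (δ / 3) (L + 2 * δ / 3)) : deriv h t = 0 := by
  have e : h =ᶠ[𝓝 t] fun _ => 0 := by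
    filter_upwards [isClosed_Icc.isOpen_compl.mem_nhds ht] with u hu
    exact hh.support u hu
  rw [e.deriv_eq, deriv_const]

/-- The factors of the derivative of the product cutoff. -/
def derivFactors (h : ℝ → ℝ) (i : Fin N) (k : Fin 3) : Fin N × Fin 3 → ℝ → ℝ :=
  Function.update (fun _ => h) (i, k) (deriv h)

theorem IsCutoff.derivFactors_continuous (hh : IsCutoff C L δ h) (i : Fin N) (k : Fin 3)
    (p : Fin N × Fin 3) : Continuous (derivFactors h i k p) := by
  by_cases hp : p = (i, k)
  · subst hp
    simp only [derivFactors, Function.update_self]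
    exact hh.contDiff.continuous_deriv (by simp)
  · simp only [derivFactors, Function.update_of_ne hp]
    exact hh.contDiff.continuous

theorem IsCutoff.derivFactors_support (hh : IsCutoff C L δ h) (i : Fin N) (k : Fin 3)
    (p : Fin N × Fin 3) (t : ℝ) (ht : t ∉ Set.Icc (δ / 3) (L + 2 * δ / 3)) :
    derivFactors h i k p t = 0 := by
  by_cases hp : p = (i, k)
  · subst hp
    simp only [derivFactors, Function.update_self]
    exact hh.deriv_support t ht
  · simp only [derivFactors, Function.update_of_ne hp]
    exact hh.support t ht

theorem IsCutoff.pd_prodFun (hh : IsCutoff C L δ h) (i : Fin N) (k : Fin 3) (x : Config N) :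
    pd i k (fun y => (prodFun (fun _ => h) y : ℂ)) x = (prodFun (derivFactors h i k) x : ℂ) :=
  BoseGas.pd_prodFun (fun _ => hh.contDiff) i k x

/-- Multiplication by the product cutoff. -/
def cut (h : ℝ → ℝ) (φ : Config N → ℂ) (x : Config N) : ℂ := (prodFun (fun _ => h) x : ℂ) * φ x

theorem IsCutoff.contDiff_prod (hh : IsCutoff C L δ h) :
    ContDiff ℝ ∞ fun x : Config N => (prodFun (fun _ => h) x : ℂ) :=
  Complex.ofRealCLM.contDiff.comp (contDiff_prodFun fun _ => hh.contDiff)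

variable [hL : Fact (0 < L)] {X : Type*} [NormedAddCommGroup X] [NormedSpace ℝ X]

theorem integral_sq_prodFun_smul (hδ : 0 < δ) (hδL : δ ≤ L) {f : Fin N × Fin 3 → ℝ → ℝ}
    (hf : ∀ p, Continuous (f p))
    (hs : ∀ p, ∀ t, t ∉ Set.Icc (δ / 3) (L + 2 * δ / 3) → f p t = 0)
    {F : Config N → X} (hF : IsPeriodic L F) (hFm : StronglyMeasurable F) :
    ∫ x : Config N, (prodFun f x) ^ 2 • F x =
      ∫ x in box N L, (∏ p : Fin N × Fin 3, (f p (x p.1 p.2) ^ 2 + f p (x p.1 p.2 + L) ^ 2)) • F x := by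
  have h1 := integral_prod_smul_periodic (g := fun p t => f p t ^ 2) (fun p => (hf p).pow 2)
    (fun p t => sq_nonneg _) (fun p t ht => by
      rw [hs p t fun h => ht ⟨by linarith [h.1], by linarith [h.2]⟩]; simp) hF hFm
  rw [← h1]
  refine integral_congr_ae (Eventually.of_forall fun x => ?_)
  simp only [prodFun, Finset.prod_pow]

/-- Every factor `h²` periodizes to `1`, so the squared cutoff acts as a partition of unity over the
lattice translates of the box. Isometry and the comparison of kinetic and interaction energies all
rest on this identity. -/
theorem IsCutoff.integral_sq_smul (hh : IsCutoff C L δ h) (hδ : 0 < δ) (hδL : δ ≤ L)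
    {F : Config N → X} (hF : IsPeriodic L F) (hFm : StronglyMeasurable F) :
    ∫ x : Config N, (prodFun (fun _ => h) x) ^ 2 • F x = ∫ x in box N L, F x := by
  rw [integral_sq_prodFun_smul hδ hδL (fun _ => hh.contDiff.continuous) (fun _ => hh.support) hF hFm]
  refine setIntegral_congr_fun (measurableSet_box N L) fun x hx => ?_
  simp only
  rw [Finset.prod_eq_one fun p _ => hh.sq_add_sq _ (Set.Ioo_subset_Ioc_self (hx p.1 p.2)), one_smul]

/-- The undifferentiated coordinates still periodize to `1`; only the differentiated one keeps a
weight. -/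
theorem IsCutoff.integral_deriv_sq_smul (hh : IsCutoff C L δ h) (hδ : 0 < δ) (hδL : δ ≤ L)
    (i : Fin N) (k : Fin 3) {F : Config N → X} (hF : IsPeriodic L F) (hFm : StronglyMeasurable F) :
    ∫ x : Config N, (prodFun (derivFactors h i k) x) ^ 2 • F x =
      ∫ x in box N L, (deriv h (x i k) ^ 2 + deriv h (x i k + L) ^ 2) • F x := by
  rw [integral_sq_prodFun_smul hδ hδL (hh.derivFactors_continuous i k)
    (hh.derivFactors_support i k) hF hFm]
  refine setIntegral_congr_fun (measurableSet_box N L) fun x hx => ?_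
  simp only
  congr 1
  rw [← Finset.mul_prod_erase _ _ (Finset.mem_univ (i, k)), Finset.prod_eq_one, mul_one]
  · simp [derivFactors]
  · intro p hp
    simp only [derivFactors, Function.update_of_ne (Finset.mem_erase.1 hp).1]
    exact hh.sq_add_sq _ (Set.Ioo_subset_Ioc_self (hx p.1 p.2))

end CutoffIntegrals

/-! ### Energy of a periodic function after the cutoff. -/

section CutoffEnergy

variable {N : ℕ} {C L δ L' : ℝ} {h : ℝ → ℝ}

/-- The closed box which contains the support of the product cutoff. -/
def cutSupport (N : ℕ) (L δ : ℝ) : Set (Config N) :=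
  {x | ∀ i k, x i k ∈ Set.Icc (δ / 3) (L + 2 * δ / 3)}

theorem isCompact_cutSupport (N : ℕ) (L δ : ℝ) : IsCompact (cutSupport N L δ) :=
  isCompact_closedBox N _ _

theorem cutSupport_subset_box (hδ : 0 < δ) (hL' : L + δ ≤ L') : cutSupport N L δ ⊆ box N L' :=
  fun _ hx i k => ⟨by linarith [(hx i k).1], by linarith [(hx i k).2]⟩

theorem IsCutoff.prodFun_eq_zero (hh : IsCutoff C L δ h) {x : Config N}
    (hx : x ∉ cutSupport N L δ) : prodFun (fun _ => h) x = 0 :=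
  BoseGas.prodFun_eq_zero (fun _ => hh.support) hx

theorem IsCutoff.prodFun_derivFactors_eq_zero (hh : IsCutoff C L δ h) (i : Fin N) (k : Fin 3)
    {x : Config N} (hx : x ∉ cutSupport N L δ) : prodFun (derivFactors h i k) x = 0 :=
  BoseGas.prodFun_eq_zero (hh.derivFactors_support i k) hx

theorem integrable_of_cutSupport {X : Type*} [NormedAddCommGroup X] {f : Config N → X}
    (hf : Continuous f) (h0 : ∀ x, x ∉ cutSupport N L δ → f x = 0) : Integrable f :=
  hf.integrable_of_hasCompactSupport (HasCompactSupport.intro (isCompact_cutSupport N L δ) h0)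

theorem IsCutoff.pd_cut (hh : IsCutoff C L δ h) {φ : Config N → ℂ} (hφ : ContDiff ℝ ∞ φ)
    (i : Fin N) (k : Fin 3) (x : Config N) :
    pd i k (cut h φ) x = (prodFun (derivFactors h i k) x : ℂ) * φ x +
      (prodFun (fun _ => h) x : ℂ) * pd i k φ x := by
  have h1 := pd_mul hh.contDiff_prod hφ i k x
  rw [hh.pd_prodFun] at h1
  exact h1

theorem IsCutoff.cut_mem_dirichletCore (hh : IsCutoff C L δ h) (hδ : 0 < δ) (hL' : L + δ ≤ L')
    {φ : Config N → ℂ} (hφ : ContDiff ℝ ∞ φ) (hs : IsSymmetric φ) :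
    cut h φ ∈ DirichletCore N L' := by
  have h0 : ∀ x, x ∉ cutSupport N L δ → cut h φ x = 0 := fun x hx => by
    rw [cut, hh.prodFun_eq_zero hx]; simp
  have hts : tsupport (cut h φ) ⊆ cutSupport N L δ :=
    closure_minimal (fun x hx => not_not.1 fun hn => hx (h0 x hn))
      (isCompact_cutSupport N L δ).isClosed
  refine ⟨hh.contDiff_prod.mul hφ, fun σ x => ?_,
    HasCompactSupport.intro (isCompact_cutSupport N L δ) h0,
    hts.trans (cutSupport_subset_box hδ hL')⟩
  simp only [cut, hs σ x]
  congr 2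
  simp only [prodFun, Fintype.prod_prod_type]
  exact Equiv.prod_comp σ fun i => ∏ k, h (x i k)

variable [hL : Fact (0 < L)]

theorem IsCutoff.integral_conj_cut_mul_cut (hh : IsCutoff C L δ h) (hδ : 0 < δ) (hδL : δ ≤ L)
    (hL' : L + δ ≤ L') {φ ψ : Config N → ℂ} (hφ : ContDiff ℝ ∞ φ) (hψ : ContDiff ℝ ∞ ψ)
    (pφ : IsPeriodic L φ) (pψ : IsPeriodic L ψ) :
    ∫ x in box N L', (starRingEnd ℂ) (cut h φ x) * cut h ψ x =
      ∫ x in box N L, (starRingEnd ℂ) (φ x) * ψ x := by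
  rw [setIntegral_eq_integral_of_forall_compl_eq_zero, ← hh.integral_sq_smul hδ hδL]
  · refine integral_congr_ae (Eventually.of_forall fun x => ?_)
    simp only [cut, map_mul, Complex.conj_ofReal, Complex.real_smul, Complex.ofReal_pow]
    ring
  · intro x i k
    simp only [pφ x i k, pψ x i k]
  · exact ((contDiff_conj hφ).mul hψ).continuous.stronglyMeasurable
  · intro x hx
    rw [cut, hh.prodFun_eq_zero fun hc => hx (cutSupport_subset_box hδ hL' hc)]
    simp

/-- Integrating by parts moves the derivative from the squared cutoff to `g`; the squared cutoff
then folds to `1`, leaving the integral of a second derivative over the torus, which is zero. With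
`g = |φ|²` this removes the cross term of the localization formula. -/
theorem IsCutoff.integral_pd_sq_mul_pd (hh : IsCutoff C L δ h) (hδ : 0 < δ) (hδL : δ ≤ L)
    {g : Config N → ℂ} (hg : ContDiff ℝ ∞ g) (pg : IsPeriodic L g) (i : Fin N) (k : Fin 3) :
    ∫ x, pd i k (fun y => (prodFun (fun _ => h) y : ℂ) * (prodFun (fun _ => h) y : ℂ)) x *
      pd i k g x = 0 := by
  set G : Config N → ℂ := fun y => (prodFun (fun _ => h) y : ℂ) * (prodFun (fun _ => h) y : ℂ)
  have hG : ContDiff ℝ ∞ G := hh.contDiff_prod.mul hh.contDiff_prod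
  have hG0 : ∀ x, x ∉ cutSupport N L δ → G x = 0 := fun x hx => by
    simp only [G, hh.prodFun_eq_zero hx]; simp
  have hpG0 : ∀ x, x ∉ cutSupport N L δ → pd i k G x = 0 := fun x hx => by
    simp only [G]
    rw [pd_mul hh.contDiff_prod hh.contDiff_prod, hh.prodFun_eq_zero hx]; simp
  have hpg := contDiff_pd hg i k
  have h1 := integral_pd_eq_zero_of_compact (hG.mul hpg)
    (HasCompactSupport.intro (isCompact_cutSupport N L δ) fun x hx => by rw [hG0 x hx, zero_mul])
    i k
  simp_rw [pd_mul hG hpg] at h1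
  rw [integral_add] at h1
  · have h2 : ∫ x, G x * pd i k (pd i k g) x = 0 := by
      rw [← integral_pd_eq_zero_of_periodic hpg (pg.pd i k) i k,
        ← hh.integral_sq_smul hδ hδL ((pg.pd i k).pd i k)
          (contDiff_pd hpg i k).continuous.stronglyMeasurable]
      refine integral_congr_ae (Eventually.of_forall fun x => ?_)
      simp only [G, Complex.real_smul, Complex.ofReal_pow]
      ring
    rwa [h2, add_zero] at h1
  · exact integrable_of_cutSupport ((contDiff_pd hG i k).mul hpg).continuous fun x hx => by
      rw [hpG0 x hx, zero_mul]
  · exact integrable_of_cutSupport (hG.mul (contDiff_pd hpg i k)).continuous fun x hx => by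
      rw [hG0 x hx, zero_mul]

/-- The localization formula for the kinetic energy. -/
theorem IsCutoff.integral_norm_pd_cut_sq (hh : IsCutoff C L δ h) (hδ : 0 < δ) (hδL : δ ≤ L)
    (hL' : L + δ ≤ L') {φ : Config N → ℂ} (hφ : ContDiff ℝ ∞ φ) (pφ : IsPeriodic L φ)
    (i : Fin N) (k : Fin 3) :
    ∫ x in box N L', ‖pd i k (cut h φ) x‖ ^ 2 = (∫ x in box N L, ‖pd i k φ x‖ ^ 2) +
      ∫ x in box N L, (deriv h (x i k) ^ 2 + deriv h (x i k + L) ^ 2) * ‖φ x‖ ^ 2 := by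
  set P : Config N → ℝ := prodFun (fun _ => h) with hP
  set P' : Config N → ℝ := prodFun (derivFactors h i k) with hP'
  set g : Config N → ℂ := fun x => (starRingEnd ℂ) (φ x) * φ x with hg
  have hPc : Continuous P := continuous_prodFun fun _ => hh.contDiff.continuous
  have hP'c : Continuous P' := continuous_prodFun (hh.derivFactors_continuous i k)
  have hgs : ContDiff ℝ ∞ g := (contDiff_conj hφ).mul hφ
  have hφk := contDiff_pd hφ i k
  have hpg : IsPeriodic L g := fun x j l => by simp only [hg, pφ x j l]
  set X : Config N → ℂ := fun x => pd i k (fun y => (P y : ℂ) * (P y : ℂ)) x * pd i k g x with hX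
  have hXe : ∀ x, X x = ((2 * (P x * P' x) : ℝ) : ℂ) *
      ((starRingEnd ℂ) (pd i k φ x) * φ x + (starRingEnd ℂ) (φ x) * pd i k φ x) := by
    intro x
    simp only [hX, hg, hP]
    rw [pd_mul hh.contDiff_prod hh.contDiff_prod, pd_mul (contDiff_conj hφ) hφ, pd_conj hφ,
      hh.pd_prodFun]
    push_cast
    ring
  -- The cross term `2 P P' Re(φ̄ ∂φ)` is one half of `∂(P²) ∂|φ|²`, which is `X`.
  have key : ∀ x, ‖pd i k (cut h φ) x‖ ^ 2 =
      P x ^ 2 • ‖pd i k φ x‖ ^ 2 + P' x ^ 2 • ‖φ x‖ ^ 2 + (1 / 2) * (X x).re := by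
    intro x
    rw [hh.pd_cut hφ, hXe, ← Complex.normSq_eq_norm_sq, ← Complex.normSq_eq_norm_sq,
      ← Complex.normSq_eq_norm_sq]
    simp only [Complex.normSq_apply, Complex.add_re, Complex.add_im, Complex.mul_re,
      Complex.mul_im, Complex.ofReal_re, Complex.ofReal_im, Complex.conj_re, Complex.conj_im,
      smul_eq_mul]
    ring
  have hX0 : ∀ x, x ∉ cutSupport N L δ → X x = 0 := fun x hx => by
    rw [hXe, hP, hh.prodFun_eq_zero hx]; simp
  have hXc : Continuous X :=
    ((contDiff_pd (hh.contDiff_prod.mul hh.contDiff_prod) i k).mul (contDiff_pd hgs i k)).continuous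
  have hXi : Integrable X := integrable_of_cutSupport hXc hX0
  have hXint : ∫ x, (X x).re = 0 := by
    have h1 := hh.integral_pd_sq_mul_pd hδ hδL hgs hpg i k
    have h2 := integral_re hXi
    simp only [RCLike.re_eq_complex_re] at h2
    rw [h2]
    exact (congrArg Complex.re h1).trans rfl
  have hi1 : Integrable fun x => P x ^ 2 • ‖pd i k φ x‖ ^ 2 :=
    integrable_of_cutSupport (L := L) (δ := δ) ((hPc.pow 2).smul (hφk.continuous.norm.pow 2))
      fun x hx => by simp [hP, hh.prodFun_eq_zero hx]
  have hi2 : Integrable fun x => P' x ^ 2 • ‖φ x‖ ^ 2 :=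
    integrable_of_cutSupport (L := L) (δ := δ) ((hP'c.pow 2).smul (hφ.continuous.norm.pow 2))
      fun x hx => by simp [hP', hh.prodFun_derivFactors_eq_zero i k hx]
  rw [setIntegral_eq_integral_of_forall_compl_eq_zero]
  · simp_rw [key]
    rw [integral_add, integral_add, integral_const_mul, hXint, mul_zero, add_zero]
    · congr 1
      · refine hh.integral_sq_smul hδ hδL (F := fun x => ‖pd i k φ x‖ ^ 2) (fun x j l => ?_)
          (hφk.continuous.norm.pow 2).stronglyMeasurable
        simp only [IsPeriodic.pd pφ i k x j l]
      · refine hh.integral_deriv_sq_smul hδ hδL i k (F := fun x => ‖φ x‖ ^ 2) (fun x j l => ?_)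
          (hφ.continuous.norm.pow 2).stronglyMeasurable
        simp only [pφ x j l]
    · exact hi1
    · exact hi2
    · exact hi1.add hi2
    · exact hXi.re.const_mul _
  · intro x hx
    have hx' : x ∉ cutSupport N L δ := fun hc => hx (cutSupport_subset_box hδ hL' hc)
    rw [hh.pd_cut hφ, hh.prodFun_eq_zero hx', hh.prodFun_derivFactors_eq_zero i k hx']
    simp

/-- `V` itself is not periodic, so it is first replaced pointwise by the larger `W`; the integrand
is then periodic apart from the squared cutoff, which folds to `1`. -/
theorem IsCutoff.integral_pairSum_cut_le (hh : IsCutoff C L δ h) (hδ : 0 < δ) (hδL : δ ≤ L)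
    (hL' : L + δ ≤ L') {V W : EuclideanSpace ℝ (Fin 3) → ℝ} (hV : Measurable V)
    (hW : Measurable W) (hV0 : ∀ z, 0 ≤ V z) (hVW : ∀ z, V z ≤ W z) {B : ℝ} (hWB : ∀ z, W z ≤ B)
    (hWp : IsPeriodic L (pairSum W : Config N → ℝ))
    {φ : Config N → ℂ} (hφ : ContDiff ℝ ∞ φ) (pφ : IsPeriodic L φ) :
    ∫ x in box N L', pairSum V x * ‖cut h φ x‖ ^ 2 ≤ ∫ x in box N L, pairSum W x * ‖φ x‖ ^ 2 := by
  have hle : ∀ x : Config N, pairSum V x ≤ pairSum W x := fun x =>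
    Finset.sum_le_sum fun _ _ => Finset.sum_le_sum fun _ _ => hVW _
  have hcut : ∀ x, ‖cut h φ x‖ ^ 2 = prodFun (fun _ => h) x ^ 2 * ‖φ x‖ ^ 2 := fun x => by
    rw [cut, norm_mul, mul_pow, Complex.norm_real, Real.norm_eq_abs, sq_abs]
  have hi : Integrable fun x : Config N => ‖cut h φ x‖ ^ 2 := by
    refine integrable_of_cutSupport (L := L) (δ := δ)
      ((hh.contDiff_prod.mul hφ).continuous.norm.pow 2) fun x hx => ?_
    rw [hcut, hh.prodFun_eq_zero hx]; simp
  have hbd : ∀ (U : EuclideanSpace ℝ (Fin 3) → ℝ), Measurable U → (∀ z, |U z| ≤ B) →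
      Integrable fun x : Config N => pairSum U x * ‖cut h φ x‖ ^ 2 := fun U hU hUB =>
    hi.bdd_mul (c := N * (N * B)) (measurable_pairSum hU).aestronglyMeasurable
      (Eventually.of_forall fun x => abs_pairSum_le hUB x)
  rw [setIntegral_eq_integral_of_forall_compl_eq_zero, ← hh.integral_sq_smul hδ hδL]
  · have e : ∀ x : Config N, prodFun (fun _ => h) x ^ 2 • (pairSum W x * ‖φ x‖ ^ 2) =
        pairSum W x * ‖cut h φ x‖ ^ 2 := fun x => by
      rw [hcut, smul_eq_mul]; ring
    simp_rw [e]
    refine integral_mono (hbd V hV fun z => ?_) (hbd W hW fun z => ?_) fun x =>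
      mul_le_mul_of_nonneg_right (hle x) (by positivity)
    · rw [abs_of_nonneg (hV0 z)]; exact (hVW z).trans (hWB z)
    · rw [abs_of_nonneg ((hV0 z).trans (hVW z))]; exact hWB z
  · intro x i k
    simp only [hWp x i k, pφ x i k]
  · exact ((measurable_pairSum hW).mul (hφ.continuous.norm.pow 2).measurable).stronglyMeasurable
  · intro x hx
    rw [hcut, hh.prodFun_eq_zero fun hc => hx (cutSupport_subset_box hδ hL' hc)]
    simp

end CutoffEnergy

/-! ### The potential on the torus. -/

section TorusPotential

variable {N : ℕ} {L : ℝ}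

theorem torusRep_add_single (hL : L ≠ 0) (z : EuclideanSpace ℝ (Fin 3)) (k : Fin 3) :
    torusRep L (z + EuclideanSpace.single k L) = torusRep L z := by
  ext l
  simp only [torusRep, PiLp.add_apply, PiLp.single_apply]
  split_ifs with h
  · rw [add_div, div_self hL, round_add_one]
    push_cast
    ring
  · rw [add_zero]

theorem torusRep_sub_single (hL : L ≠ 0) (z : EuclideanSpace ℝ (Fin 3)) (k : Fin 3) :
    torusRep L (z - EuclideanSpace.single k L) = torusRep L z := by
  rw [← torusRep_add_single hL (z - EuclideanSpace.single k L) k, sub_add_cancel]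

theorem isPeriodic_pairSum (hL : L ≠ 0) (V : EuclideanSpace ℝ (Fin 3) → ℝ) :
    IsPeriodic L (pairSum (fun z => V (torusRep L z)) : Config N → ℝ) := by
  intro x i₀ k
  refine Finset.sum_congr rfl fun i _ => Finset.sum_congr rfl fun j _ => ?_
  simp only
  congr 1
  simp only [Pi.add_apply]
  by_cases hi : i = i₀ <;> by_cases hj : j = i₀
  · subst hi; subst hj
    rw [add_sub_add_right_eq_sub]
  · subst hi
    rw [Pi.single_eq_same, Pi.single_eq_of_ne hj, add_zero, add_sub_right_comm,
      torusRep_add_single hL]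
  · subst hj
    rw [Pi.single_eq_same, Pi.single_eq_of_ne hi, add_zero, ← sub_sub, torusRep_sub_single hL]
  · rw [Pi.single_eq_of_ne hi, Pi.single_eq_of_ne hj, add_zero, add_zero]

theorem measurable_torusRep (L : ℝ) : Measurable (torusRep L) := by
  refine (PiLp.volume_preserving_toLp (Fin 3)).measurable.comp (measurable_pi_lambda _ fun k => ?_)
  have h1 : Measurable fun x : EuclideanSpace ℝ (Fin 3) => x k := by fun_prop
  simp only [round_eq]
  have h2 : Measurable fun t : ℝ => ((⌊t / L + 1 / 2⌋ : ℤ) : ℝ) :=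
    (measurable_from_top (f := fun n : ℤ => (n : ℝ))).comp
      (Int.measurable_floor.comp ((measurable_id.div_const L).add_const _))
  exact h1.sub ((h2.comp h1).const_mul L)

theorem torusRep_eq_self {z : EuclideanSpace ℝ (Fin 3)} (h : 2 * ‖z‖ < L) : torusRep L z = z := by
  have hL : 0 < L := lt_of_le_of_lt (by positivity) h
  ext k
  have h1 : |z k| ≤ ‖z‖ := PiLp.norm_apply_le z k
  have h2 := abs_le.1 h1
  have h3 : round (z k / L) = 0 := by
    rw [round_eq_zero_iff]
    constructor
    · rw [le_div_iff₀ hL]; linarith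
    · rw [div_lt_iff₀ hL]; linarith
  simp [torusRep, h3]

/-- Outside the range the left side is zero; inside it `z` is its own representative, because its
norm is below `L/2`. Only an inequality holds, as particles may also interact across the boundary of
the box. -/
theorem le_comp_torusRep {V : EuclideanSpace ℝ (Fin 3) → ℝ} (hV0 : ∀ x, 0 ≤ V x) {R₀ : ℝ}
    (hR : ∀ x, R₀ < ‖x‖ → V x = 0) (hL : 2 * R₀ < L) (z : EuclideanSpace ℝ (Fin 3)) :
    V z ≤ V (torusRep L z) := by
  by_cases h : R₀ < ‖z‖
  · rw [hR z h]; exact hV0 _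
  · rw [torusRep_eq_self (by linarith [not_lt.1 h])]

end TorusPotential

/-! ### The localization error of a translated cutoff. -/

section Localization

variable {N : ℕ} {C L δ : ℝ} {h : ℝ → ℝ}

/-- The translation of all particles by `(s, s, s)`. -/
def shift (N : ℕ) (s : ℝ) : Config N := fun _ => WithLp.toLp 2 fun _ => s

theorem pairSum_add_shift (W : EuclideanSpace ℝ (Fin 3) → ℝ) (x : Config N) (s : ℝ) :
    pairSum W (x + shift N s) = pairSum W x := by
  refine Finset.sum_congr rfl fun i _ => Finset.sum_congr rfl fun j _ => ?_
  simp only [Pi.add_apply, shift, add_sub_add_right_eq_sub]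

/-- The configurations for which a given coordinate lies in `(s, s + δ)`. -/
def slab (N : ℕ) (s δ : ℝ) (p : Fin N × Fin 3) : Set (Config N) := {x | x p.1 p.2 ∈ Set.Ioo s (s + δ)}

theorem measurableSet_slab (s : ℝ) (p : Fin N × Fin 3) : MeasurableSet (slab N s δ p) :=
  (by fun_prop : Measurable fun x : Config N => x p.1 p.2) measurableSet_Ioo

/-- `L * Int.fract ((x - s) / L)` is `x - s` reduced modulo `L`. As `s + δ ≤ L`, the slab does not
wrap around: for `x < s` the reduced value is `x - s + L`, which exceeds `δ`. -/
theorem IsCutoff.deriv_sq_fract_le (hh : IsCutoff C L δ h) (hC : 0 ≤ C) (hL : 0 < L) {s x : ℝ}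
    (hs : 0 ≤ s) (hsL : s + δ ≤ L) (hx : x ∈ Set.Ioo 0 L) :
    deriv h (L * Int.fract ((x - s) / L)) ^ 2 + deriv h (L * Int.fract ((x - s) / L) + L) ^ 2 ≤
      if x ∈ Set.Ioo s (s + δ) then C / δ ^ 2 else 0 := by
  set y := L * Int.fract ((x - s) / L) with hy
  have hy0 : 0 ≤ y := mul_nonneg hL.le (Int.fract_nonneg _)
  have hyL : y < L := by
    have := mul_lt_mul_of_pos_left (Int.fract_lt_one ((x - s) / L)) hL
    linarith
  refine (hh.deriv_sq_le y ⟨hy0, hyL⟩).trans ?_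
  have hpos : 0 ≤ C / δ ^ 2 := by positivity
  by_cases hyδ : y ∈ Set.Ioo 0 δ
  · have hxs : x ∈ Set.Ioo s (s + δ) := by
      rcases le_or_gt s x with h1 | h1
      · have h2 : Int.fract ((x - s) / L) = (x - s) / L := by
          rw [Int.fract_eq_self]
          exact ⟨div_nonneg (by linarith) hL.le, by rw [div_lt_one hL]; linarith [hx.2]⟩
        rw [h2, mul_div_cancel₀ _ hL.ne'] at hy
        exact ⟨by linarith [hyδ.1], by linarith [hyδ.2]⟩
      · exfalso
        have h2 : Int.fract ((x - s) / L) = (x - s) / L + 1 := by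
          rw [← Int.fract_add_one, Int.fract_eq_self]
          constructor
          · rw [div_add_one hL.ne']
            exact div_nonneg (by linarith [hx.1, hyδ.1, hyδ.2]) hL.le
          · have : (x - s) / L < 0 := div_neg_of_neg_of_pos (by linarith) hL
            linarith
        rw [h2, mul_add, mul_div_cancel₀ _ hL.ne'] at hy
        linarith [hyδ.2, hx.1]
    rw [if_pos hyδ, if_pos hxs]
  · rw [if_neg hyδ]
    split_ifs
    · exact hpos
    · exact le_rfl

variable [hL : Fact (0 < L)]

theorem IsCutoff.integral_deriv_sq_shift_le (hh : IsCutoff C L δ h) (hC : 0 ≤ C) {s : ℝ}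
    (hs : 0 ≤ s) (hsL : s + δ ≤ L) {φ : Config N → ℂ} (hφ : Continuous φ)
    (pφ : IsPeriodic L φ) (i : Fin N) (k : Fin 3) :
    ∫ x in box N L, (deriv h (x i k) ^ 2 + deriv h (x i k + L) ^ 2) * ‖φ (x + shift N s)‖ ^ 2 ≤
      C / δ ^ 2 * ∫ x in slab N s δ (i, k), ‖φ x‖ ^ 2 ∂(boxMeasure N L) := by
  have hL' : 0 < L := hL.out
  have hdc : Continuous (deriv h) := hh.contDiff.continuous_deriv (by simp)
  -- The weight matters only on one period, so it may be extended periodically. The translation can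
  -- then be transferred from `φ` to the weight by invariance of the integral over the box.
  set D : ℝ → ℝ := fun t => deriv h (L * Int.fract (t / L)) ^ 2 +
    deriv h (L * Int.fract (t / L) + L) ^ 2 with hD
  have hDm : Measurable D := by
    have h1 : Measurable fun t : ℝ => L * Int.fract (t / L) :=
      (measurable_fract.comp (measurable_id.div_const L)).const_mul L
    exact ((hdc.measurable.comp h1).pow_const 2).add
      ((hdc.measurable.comp (h1.add_const L)).pow_const 2)
  set F : Config N → ℝ := fun x => D (x i k - s) * ‖φ x‖ ^ 2 with hF
  have hFm : Measurable F :=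
    (hDm.comp (by fun_prop)).mul (hφ.norm.pow 2).measurable
  have hFp : IsPeriodic L F := by
    intro x j l
    simp only [hF, pφ x j l]
    congr 1
    by_cases h1 : i = j
    · subst h1
      by_cases h2 : k = l
      · subst h2
        have : (x + Pi.single i (EuclideanSpace.single k L) : Config N) i k - s =
            (x i k - s) + L := by
          simp; ring
        rw [this]
        simp only [hD, add_div, div_self hL'.ne', Int.fract_add_one]
      · simp [h2]
    · simp [Pi.single_eq_of_ne h1]
  have e1 : ∫ x in box N L, (deriv h (x i k) ^ 2 + deriv h (x i k + L) ^ 2) *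
      ‖φ (x + shift N s)‖ ^ 2 = ∫ x in box N L, F (x + shift N s) := by
    refine setIntegral_congr_fun (measurableSet_box N L) fun x hx => ?_
    have hf : Int.fract (x i k / L) = x i k / L := by
      rw [Int.fract_eq_self]
      exact ⟨div_nonneg (hx i k).1.le hL'.le, by rw [div_lt_one hL']; exact (hx i k).2⟩
    have hx' : (x + shift N s) i k - s = x i k := by simp [shift]
    simp only [hF]
    rw [hx']
    simp only [hD, hf, mul_div_cancel₀ _ hL'.ne']
  rw [e1, integral_box_add hFp hFm, ← integral_const_mul,
    ← integral_indicator (measurableSet_slab s (i, k))]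
  have hle : ∀ x ∈ box N L, F x ≤
      (slab N s δ (i, k)).indicator (fun x => C / δ ^ 2 * ‖φ x‖ ^ 2) x := by
    intro x hx
    have h1 := hh.deriv_sq_fract_le hC hL' hs hsL (hx i k)
    have h2 := mul_le_mul_of_nonneg_right h1 (sq_nonneg ‖φ x‖)
    refine h2.trans ?_
    by_cases hxs : x i k ∈ Set.Ioo s (s + δ)
    · rw [if_pos hxs, Set.indicator_of_mem (show x ∈ slab N s δ (i, k) from hxs)]
    · rw [if_neg hxs, zero_mul, Set.indicator_of_notMem (show x ∉ slab N s δ (i, k) from hxs)]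
  obtain ⟨B, hB⟩ := exists_bound_on_box (L := L) hφ
  have hig : Integrable ((slab N s δ (i, k)).indicator (fun x => C / δ ^ 2 * ‖φ x‖ ^ 2))
      (boxMeasure N L) := by
    refine Integrable.indicator ?_ (measurableSet_slab s (i, k))
    refine Integrable.const_mul ?_ _
    refine Integrable.of_bound (hφ.norm.pow 2).aestronglyMeasurable (B ^ 2) ?_
    refine (ae_restrict_iff' (measurableSet_box N L)).2 (Eventually.of_forall fun x hx => ?_)
    rw [norm_pow, norm_norm]
    exact pow_le_pow_left₀ (norm_nonneg _) (hB x hx) 2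
  refine integral_mono_of_nonneg (Eventually.of_forall fun x => ?_) hig
    ((ae_restrict_iff' (measurableSet_box N L)).2 (Eventually.of_forall hle))
  simp only [hF, hD, Pi.zero_apply]
  positivity

end Localization

/-! ### The translated cutoffs as core maps, and their average error. -/

section LocalizationMaps

theorem norm_sq_eq_integral {α : Type*} [MeasurableSpace α] {μ : Measure α} (f : Lp ℂ 2 μ) :
    ‖f‖ ^ 2 = ∫ x, ‖f x‖ ^ 2 ∂μ := by
  rw [← inner_self_eq_norm_sq (𝕜 := ℂ), L2.inner_def]
  simp_rw [inner_self_eq_norm_sq_to_K]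
  rw [← integral_re]
  · refine integral_congr_ae (Eventually.of_forall fun x => ?_)
    simp only
    norm_cast
  · have h := L2.integrable_inner (𝕜 := ℂ) f f
    simp_rw [inner_self_eq_norm_sq_to_K] at h
    exact h

theorem integrable_norm_sq {α : Type*} [MeasurableSpace α] {μ : Measure α} (f : Lp ℂ 2 μ) :
    Integrable (fun x => ‖f x‖ ^ 2) μ := (Lp.memLp f).integrable_norm_pow two_ne_zero

/-- The eigenvectors of the periodic Hamiltonian need not lie in the core, so the localization error
must be continuous in the Hilbert space norm; here it is the squared norm of a restriction. -/
theorem continuous_setIntegral_norm_sq {α : Type*} [MeasurableSpace α] {μ : Measure α}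
    (s : Set α) : Continuous fun f : Lp ℂ 2 μ => ∫ x in s, ‖f x‖ ^ 2 ∂μ := by
  have h : (fun f : Lp ℂ 2 μ => ∫ x in s, ‖f x‖ ^ 2 ∂μ) =
      fun f => ‖LpToLpRestrictCLM α ℂ ℂ μ 2 s f‖ ^ 2 := by
    funext f
    rw [norm_sq_eq_integral]
    refine integral_congr_ae ?_
    filter_upwards [LpToLpRestrictCLM_coeFn ℂ s f] with x hx
    rw [hx]
  rw [h]
  fun_prop

variable {N : ℕ} {L : ℝ}

theorem IsCore.re_inner_eq {𝒦 : Set (Config N → ℂ)} (h : IsCore L 𝒦)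
    {W : EuclideanSpace ℝ (Fin 3) → ℝ} (hW : Measurable W) {C : ℝ} (hC : ∀ z, |W z| ≤ C)
    {p : bosonSpace N L × bosonSpace N L} {φ : Config N → ℂ} (hφ : φ ∈ 𝒦)
    (hp1 : (p.1 : Lp ℂ 2 (boxMeasure N L)) =ᵐ[boxMeasure N L] φ)
    (hp2 : (p.2 : Lp ℂ 2 (boxMeasure N L)) =ᵐ[boxMeasure N L] hamiltonianApply W φ) :
    (inner ℂ p.1 p.2).re = (∑ i, ∑ k, ∫ x in box N L, ‖pd i k φ x‖ ^ 2) +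
      ∫ x in box N L, pairSum W x * ‖φ x‖ ^ 2 := by
  rw [inner_bosonSpace hp1 hp2, h.integral_hamiltonianApply hW hC hφ hφ, energyForm_self,
    Complex.ofReal_re]

/-- The localization error for the cutoff translated by `s`. -/
def localizationError (C δ s : ℝ) (u : bosonSpace N L) : ℝ :=
  ∑ p, C / δ ^ 2 * ∫ x in slab N s δ p, ‖(u : Lp ℂ 2 (boxMeasure N L)) x‖ ^ 2 ∂(boxMeasure N L)

/-- For each of the `3N` coordinates the slabs `(mδ, (m+1)δ)` are disjoint, so their masses add up
to at most `‖u‖²`. The bound does not depend on `M`; this is the gain from averaging over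
translates. -/
theorem sum_localizationError_le {C : ℝ} (hC : 0 ≤ C) (δ : ℝ) (hδ : 0 < δ) (M : ℕ)
    (u : bosonSpace N L) :
    ∑ m : Fin M, localizationError C δ (m * δ) u ≤ C / δ ^ 2 * (3 * N) * ‖u‖ ^ 2 := by
  simp only [localizationError]
  rw [Finset.sum_comm]
  have hint := integrable_norm_sq (u : Lp ℂ 2 (boxMeasure N L))
  have h1 : ∀ p : Fin N × Fin 3, ∑ m : Fin M, C / δ ^ 2 * ∫ x in slab N (m * δ) δ p,
      ‖(u : Lp ℂ 2 (boxMeasure N L)) x‖ ^ 2 ∂(boxMeasure N L) ≤ C / δ ^ 2 * ‖u‖ ^ 2 := by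
    intro p
    rw [← Finset.mul_sum]
    refine mul_le_mul_of_nonneg_left ?_ (by positivity)
    rw [← integral_iUnion_fintype (fun m => measurableSet_slab _ p) ?_ fun m => hint.integrableOn]
    · refine (setIntegral_le_integral hint (Eventually.of_forall fun x => by positivity)).trans ?_
      rw [← norm_sq_eq_integral]
      rfl
    · intro m n hmn
      have hlt : ∀ {a b : Fin M}, a < b → Disjoint (slab N (a * δ) δ p) (slab N (b * δ) δ p) := by
        intro a b hab
        refine Set.disjoint_left.2 fun x hx hy => ?_
        have h2 : ((a : ℕ) : ℝ) + 1 ≤ ((b : ℕ) : ℝ) := by exact_mod_cast hab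
        have h3 : (((a : ℕ) : ℝ) + 1) * δ ≤ ((b : ℕ) : ℝ) * δ := by gcongr
        have h4 := hx.2
        have h5 := hy.1
        linarith
      rcases lt_or_gt_of_ne hmn with h | h
      · exact hlt h
      · exact (hlt h).symm
  refine (Finset.sum_le_sum fun p _ => h1 p).trans ?_
  rw [Finset.sum_const, Finset.card_univ, Fintype.card_prod, Fintype.card_fin, Fintype.card_fin,
    nsmul_eq_mul]
  push_cast
  exact le_of_eq (by ring)

variable [hL : Fact (0 < L)]

omit hL in
theorem mem_periodicCore_add_shift {φ : Config N → ℂ} (hφ : φ ∈ PeriodicCore N L) (s : ℝ) :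
    (fun x => φ (x + shift N s)) ∈ PeriodicCore N L :=
  ⟨hφ.1.comp (contDiff_id.add contDiff_const), fun σ x => hφ.2.1 σ (x + shift N s),
    IsPeriodic.add_const (L := L) hφ.2.2 (shift N s)⟩

/-- The translated periodic functions, cut off to the larger Dirichlet box. -/
theorem exists_isCoreMap {C δ L' : ℝ} {h : ℝ → ℝ} (hh : IsCutoff C L δ h) (hC : 0 ≤ C)
    (hδ : 0 < δ) (hδL : δ ≤ L) (hL' : L + δ ≤ L') {V : EuclideanSpace ℝ (Fin 3) → ℝ}
    (hV : Measurable V) (hV0 : ∀ z, 0 ≤ V z) {B : ℝ} (hB : ∀ z, V z ≤ B)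
    (hVe : ∀ z, V (-z) = V z) (hVL : ∀ z, V z ≤ V (torusRep L z)) {s : ℝ} (hs : 0 ≤ s)
    (hsL : s + δ ≤ L) :
    ∃ J, IsCoreMap (coreSubmodule (isCore_periodic N L) fun z => V (torusRep L z))
      (coreSubmodule (isCore_dirichlet N L') V) J (localizationError C δ s) := by
  have hWm : Measurable fun z => V (torusRep L z) := hV.comp (measurable_torusRep L)
  have hVB : ∀ z, |V z| ≤ B := fun z => by rw [abs_of_nonneg (hV0 z)]; exact hB z
  have hL0 : L ≠ 0 := hL.out.ne'
  have hex : ∀ p ∈ coreSubmodule (isCore_periodic N L) fun z => V (torusRep L z),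
      ∃ φ ∈ PeriodicCore N L, (p.1 : Lp ℂ 2 (boxMeasure N L)) =ᵐ[boxMeasure N L] φ ∧
        (p.2 : Lp ℂ 2 (boxMeasure N L)) =ᵐ[boxMeasure N L]
          hamiltonianApply (fun z => V (torusRep L z)) φ := fun p hp => hp
  -- A smooth representative is chosen for each pair of the graph separately, so the resulting `J`
  -- is not known to be linear.
  choose! φ hφ hp1 hp2 using hex
  set ψ : bosonSpace N L × bosonSpace N L → Config N → ℂ :=
    fun p => cut h fun x => φ p (x + shift N s)
  have hφs := fun p hp => mem_periodicCore_add_shift (hφ p hp) s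
  have hψ : ∀ p ∈ coreSubmodule (isCore_periodic N L) fun z => V (torusRep L z),
      ψ p ∈ DirichletCore N L' := fun p hp =>
    hh.cut_mem_dirichletCore hδ hL' (hφs p hp).1 (hφs p hp).2.1
  have hex2 : ∀ p ∈ coreSubmodule (isCore_periodic N L) fun z => V (torusRep L z),
      ∃ q ∈ coreSubmodule (isCore_dirichlet N L') V,
        (q.1 : Lp ℂ 2 (boxMeasure N L')) =ᵐ[boxMeasure N L'] ψ p ∧
        (q.2 : Lp ℂ 2 (boxMeasure N L')) =ᵐ[boxMeasure N L'] hamiltonianApply V (ψ p) :=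
    fun p hp => exists_mem_coreSubmodule (isCore_dirichlet N L') hV hVB hVe (hψ p hp) (hψ p hp).2.1
  choose! J hJ hJ1 hJ2 using hex2
  refine ⟨J, hJ, fun p hp q hq => ?_, ?_, fun p hp => ?_⟩
  · have hP : IsPeriodic L fun x => (starRingEnd ℂ) (φ p x) * φ q x := fun x i k => by
      simp only [(hφ p hp).2.2 x i k, (hφ q hq).2.2 x i k]
    rw [inner_bosonSpace (hJ1 p hp) (hJ1 q hq), inner_bosonSpace (hp1 p hp) (hp1 q hq),
      hh.integral_conj_cut_mul_cut hδ hδL hL' (hφs p hp).1 (hφs q hq).1 (hφs p hp).2.2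
        (hφs q hq).2.2]
    exact integral_box_add hP
      ((contDiff_conj (hφ p hp).1).mul (hφ q hq).1).continuous.measurable (shift N s)
  · refine continuous_finsetSum _ fun p _ => continuous_const.mul ?_
    exact (continuous_setIntegral_norm_sq _).comp continuous_subtype_val
  · have hsm := (hφ p hp).1
    have hper : IsPeriodic L (φ p) := (hφ p hp).2.2
    rw [(isCore_dirichlet N L').re_inner_eq hV hVB (hψ p hp) (hJ1 p hp) (hJ2 p hp),
      (isCore_periodic N L).re_inner_eq hWm (fun z => hVB _) (hφ p hp) (hp1 p hp) (hp2 p hp)]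
    have hkin : ∀ i k, ∫ x in box N L', ‖pd i k (ψ p) x‖ ^ 2 ≤
        (∫ x in box N L, ‖pd i k (φ p) x‖ ^ 2) +
          C / δ ^ 2 * ∫ x in slab N s δ (i, k),
            ‖(p.1 : Lp ℂ 2 (boxMeasure N L)) x‖ ^ 2 ∂(boxMeasure N L) := by
      intro i k
      rw [hh.integral_norm_pd_cut_sq hδ hδL hL' (hφs p hp).1 (hφs p hp).2.2]
      refine add_le_add (le_of_eq ?_) ?_
      · rw [pd_comp_add]
        refine integral_box_add (F := fun x => ‖pd i k (φ p) x‖ ^ 2) (fun x j l => ?_)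
          ((contDiff_pd hsm i k).continuous.norm.pow 2).measurable (shift N s)
        simp only [IsPeriodic.pd hper i k x j l]
      · refine (hh.integral_deriv_sq_shift_le hC hs hsL hsm.continuous hper i k).trans_eq ?_
        congr 1
        refine integral_congr_ae (ae_restrict_of_ae ?_)
        filter_upwards [hp1 p hp] with x hx
        rw [hx]
    have hpot : ∫ x in box N L', pairSum V x * ‖ψ p x‖ ^ 2 ≤
        ∫ x in box N L, pairSum (fun z => V (torusRep L z)) x * ‖φ p x‖ ^ 2 := by
      refine (hh.integral_pairSum_cut_le hδ hδL hL' hV hWm hV0 hVL (fun z => hB _)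
        (isPeriodic_pairSum hL0 V) (hφs p hp).1 (hφs p hp).2.2).trans_eq ?_
      rw [← integral_box_add (F := fun x => pairSum (fun z => V (torusRep L z)) x * ‖φ p x‖ ^ 2)
        (fun x j l => ?_) ((measurable_pairSum hWm).mul
          (hsm.continuous.norm.pow 2).measurable) (shift N s)]
      · simp only [pairSum_add_shift]
      · simp only [hper x j l, isPeriodic_pairSum hL0 V x j l]
    have hsum : ∑ i, ∑ k, ∫ x in box N L', ‖pd i k (ψ p) x‖ ^ 2 ≤
        (∑ i, ∑ k, ∫ x in box N L, ‖pd i k (φ p) x‖ ^ 2) + localizationError C δ s p.1 := by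
      refine (Finset.sum_le_sum fun i _ => Finset.sum_le_sum fun k _ => hkin i k).trans_eq ?_
      simp only [Finset.sum_add_distrib, localizationError, Fintype.sum_prod_type]
    linarith

end LocalizationMaps

/-! ### Plane waves and Fourier coefficients on the torus. -/

section PlaneWaves

variable {N : ℕ} {L : ℝ}

theorem hasDerivAt_line {φ : Config N → ℂ} (hφ : ContDiff ℝ ∞ φ) (i : Fin N) (k : Fin 3)
    (x : Config N) : HasDerivAt (fun s : ℝ => φ (x + s • dir i k)) (pd i k φ x) 0 := by
  have hline : HasDerivAt (fun s : ℝ => x + s • dir i k) (dir i k) 0 := by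
    simpa using ((hasDerivAt_id (0 : ℝ)).smul_const (dir i k)).const_add x
  have h := (contDiff_differentiable hφ (x + (0 : ℝ) • dir i k)).hasFDerivAt.comp_hasDerivAt 0 hline
  rw [zero_smul, add_zero] at h
  exact h

theorem add_smul_dir_apply (x : Config N) (s : ℝ) (i j : Fin N) (k l : Fin 3) :
    (x + s • dir i k) j l = x j l + if (j, l) = (i, k) then s else 0 := by
  by_cases h : j = i
  · subst h
    by_cases h2 : l = k <;> simp [dir, h2]
  · simp [dir, h]

/-- The wave numbers `2 π n / L`. -/
def waveNumber (L : ℝ) (n : Fin N × Fin 3 → ℤ) (p : Fin N × Fin 3) : ℝ := 2 * Real.pi * n p / L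

/-- The plane waves on the torus. -/
def plane (L : ℝ) (n : Fin N × Fin 3 → ℤ) (x : Config N) : ℂ :=
  Complex.exp (((∑ p, waveNumber L n p * x p.1 p.2 : ℝ) : ℂ) * Complex.I)

theorem contDiff_plane (n : Fin N × Fin 3 → ℤ) : ContDiff ℝ ∞ (plane L n) := by
  have h1 : ContDiff ℝ ∞ fun x : Config N => ∑ p, waveNumber L n p * x p.1 p.2 := by fun_prop
  exact ((Complex.ofRealCLM.contDiff.comp h1).mul contDiff_const).cexp

theorem plane_add_smul_dir (n : Fin N × Fin 3 → ℤ) (x : Config N) (s : ℝ) (i : Fin N) (k : Fin 3) :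
    plane L n (x + s • dir i k) =
      plane L n x * Complex.exp (((waveNumber L n (i, k) * s : ℝ) : ℂ) * Complex.I) := by
  rw [plane, plane, ← Complex.exp_add, ← add_mul, ← Complex.ofReal_add]
  congr 3
  simp only [add_smul_dir_apply, mul_add, Finset.sum_add_distrib, mul_ite, mul_zero, Prod.mk.eta,
    Finset.sum_ite_eq', Finset.mem_univ, if_true]

theorem pd_plane (n : Fin N × Fin 3 → ℤ) (i : Fin N) (k : Fin 3) (x : Config N) :
    pd i k (plane L n) x = (waveNumber L n (i, k) : ℂ) * Complex.I * plane L n x := by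
  refine (hasDerivAt_line (contDiff_plane n) i k x).unique ?_
  simp_rw [plane_add_smul_dir]
  have h1 : HasDerivAt (fun s : ℝ => ((waveNumber L n (i, k) * s : ℝ) : ℂ) * Complex.I)
      ((waveNumber L n (i, k) : ℂ) * Complex.I) 0 := by
    have h2 : HasDerivAt (fun s : ℝ => waveNumber L n (i, k) * s) (waveNumber L n (i, k)) 0 := by
      simpa using (hasDerivAt_id (0 : ℝ)).const_mul (waveNumber L n (i, k))
    exact h2.ofReal_comp.mul_const _
  have h3 := h1.cexp.const_mul (plane L n x)
  simp only [mul_zero, Complex.ofReal_zero, zero_mul, Complex.exp_zero, one_mul] at h3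
  rwa [mul_comm] at h3

theorem isPeriodic_plane (hL : L ≠ 0) (n : Fin N × Fin 3 → ℤ) : IsPeriodic L (plane L n) := by
  intro x i k
  have h1 : (Pi.single i (EuclideanSpace.single k L) : Config N) = L • dir i k := by
    funext j
    by_cases h : j = i
    · subst h
      ext l
      by_cases h2 : l = k <;> simp [dir, h2]
    · simp [dir, Pi.single_eq_of_ne h]
  rw [h1, plane_add_smul_dir]
  have h2 : ((waveNumber L n (i, k) * L : ℝ) : ℂ) * Complex.I =
      (n (i, k) : ℂ) * (2 * Real.pi * Complex.I) := by
    rw [waveNumber, div_mul_cancel₀ _ hL]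
    push_cast
    ring
  rw [h2, Complex.exp_int_mul_two_pi_mul_I, mul_one]

theorem conj_plane_mul_plane (m n : Fin N × Fin 3 → ℤ) (x : Config N) :
    (starRingEnd ℂ) (plane L m x) * plane L n x = plane L (n - m) x := by
  rw [plane, plane, plane, ← Complex.exp_conj, ← Complex.exp_add, map_mul, Complex.conj_ofReal,
    Complex.conj_I]
  congr 1
  rw [mul_neg, neg_add_eq_sub, ← sub_mul, ← Complex.ofReal_sub, ← Finset.sum_sub_distrib]
  congr 2
  refine Finset.sum_congr rfl fun p _ => ?_
  simp only [waveNumber, Pi.sub_apply]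
  push_cast
  ring

theorem volume_box_pos [hL : Fact (0 < L)] : 0 < (volume : Measure (Config N)).real (box N L) := by
  refine ENNReal.toReal_pos (ne_of_gt ?_) ?_
  · refine IsOpen.measure_pos _ ?_ ⟨fun _ => WithLp.toLp 2 fun _ => L / 2, fun i k => ?_⟩
    · have : box N L = ⋂ i, ⋂ k, (fun x : Config N => x i k) ⁻¹' Set.Ioo 0 L := by
        ext x; simp [box]
      rw [this]
      exact isOpen_iInter_of_finite fun i => isOpen_iInter_of_finite fun k =>
        isOpen_Ioo.preimage (by fun_prop)
    · have := hL.out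
      exact ⟨by simp [this], by simp [this]⟩
  · have h := measure_ne_top (boxMeasure N L) Set.univ
    rwa [Measure.restrict_apply_univ] at h

variable [hL : Fact (0 < L)]

theorem integral_plane (n : Fin N × Fin 3 → ℤ) (hn : n ≠ 0) : ∫ x in box N L, plane L n x = 0 := by
  obtain ⟨p, hp⟩ := Function.ne_iff.1 hn
  have h := integral_pd_eq_zero_of_periodic (contDiff_plane n) (isPeriodic_plane hL.out.ne' n) p.1 p.2
  simp_rw [pd_plane] at h
  rw [integral_const_mul] at h
  refine (mul_eq_zero.1 h).resolve_left (mul_ne_zero ?_ Complex.I_ne_zero)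
  rw [Complex.ofReal_ne_zero, waveNumber]
  have h1 : ((n p : ℤ) : ℝ) ≠ 0 := by exact_mod_cast hp
  exact div_ne_zero (mul_ne_zero (by positivity) h1) hL.out.ne'

omit hL in
theorem memLp_of_continuous {φ : Config N → ℂ} (hφ : Continuous φ) :
    MemLp φ 2 (boxMeasure N L) := by
  obtain ⟨C, hC⟩ := exists_bound_on_box (L := L) hφ
  exact memLp_box hφ.measurable hC

/-- The normalization of the plane waves. -/
def planeNormalization (N : ℕ) (L : ℝ) : ℝ := (√((volume : Measure (Config N)).real (box N L)))⁻¹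

/-- The normalized plane waves as square-integrable functions. -/
def planeLp (N : ℕ) (L : ℝ) [Fact (0 < L)] (n : Fin N × Fin 3 → ℤ) : Lp ℂ 2 (boxMeasure N L) :=
  (planeNormalization N L : ℂ) • (memLp_of_continuous (contDiff_plane (L := L) n).continuous).toLp _

theorem coeFn_planeLp (n : Fin N × Fin 3 → ℤ) :
    planeLp N L n =ᵐ[boxMeasure N L] fun x => (planeNormalization N L : ℂ) * plane L n x := by
  refine (Lp.coeFn_smul _ _).trans ?_
  filter_upwards [(memLp_of_continuous (contDiff_plane (L := L) n).continuous).coeFn_toLp] with x hx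
  rw [Pi.smul_apply, hx, smul_eq_mul]

theorem inner_planeLp {u : Lp ℂ 2 (boxMeasure N L)} {φ : Config N → ℂ}
    (hu : u =ᵐ[boxMeasure N L] φ) (n : Fin N × Fin 3 → ℤ) :
    inner ℂ (planeLp N L n) u =
      (planeNormalization N L : ℂ) * ∫ x in box N L, (starRingEnd ℂ) (plane L n x) * φ x := by
  rw [L2.inner_def, ← integral_const_mul]
  refine integral_congr_ae ?_
  filter_upwards [coeFn_planeLp n, hu] with x h1 h2
  rw [h1, h2, RCLike.inner_apply, map_mul, Complex.conj_ofReal]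
  ring

theorem orthonormal_planeLp : Orthonormal ℂ (planeLp N L) := by
  classical
  rw [orthonormal_iff_ite]
  intro m n
  rw [inner_planeLp (coeFn_planeLp n)]
  have h1 : ∀ x, (starRingEnd ℂ) (plane L m x) * ((planeNormalization N L : ℂ) * plane L n x) =
      (planeNormalization N L : ℂ) * plane L (n - m) x := fun x => by
    rw [← conj_plane_mul_plane]; ring
  simp_rw [h1]
  rw [integral_const_mul]
  split_ifs with h
  · subst h
    have h2 : ∀ x : Config N, plane L (m - m) x = 1 := fun x => by
      simp [plane, waveNumber]
    simp_rw [h2]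
    have hv := volume_box_pos (N := N) (L := L)
    have h3 : planeNormalization N L * (planeNormalization N L *
        (volume : Measure (Config N)).real (box N L)) = 1 := by
      rw [planeNormalization]
      have h4 := Real.mul_self_sqrt hv.le
      have h5 : √((volume : Measure (Config N)).real (box N L)) ≠ 0 := (Real.sqrt_pos.2 hv).ne'
      field_simp
      nlinarith
    rw [integral_const, measureReal_restrict_apply_univ, Complex.real_smul, mul_one]
    exact_mod_cast h3
  · rw [integral_plane _ (sub_ne_zero.2 (Ne.symm h)), mul_zero, mul_zero]

/-- Fourier coefficients of a derivative. -/
theorem integral_conj_plane_mul_pd {φ : Config N → ℂ} (hφ : ContDiff ℝ ∞ φ)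
    (pφ : IsPeriodic L φ) (n : Fin N × Fin 3 → ℤ) (i : Fin N) (k : Fin 3) :
    ∫ x in box N L, (starRingEnd ℂ) (plane L n x) * pd i k φ x =
      (waveNumber L n (i, k) : ℂ) * Complex.I *
        ∫ x in box N L, (starRingEnd ℂ) (plane L n x) * φ x := by
  have hpl := contDiff_plane (N := N) (L := L) n
  have h := integral_pd_eq_zero_of_periodic (L := L) ((contDiff_conj hpl).mul hφ) (fun x j l => by
    simp only [isPeriodic_plane hL.out.ne' n x j l, pφ x j l]) i k
  simp_rw [pd_mul (contDiff_conj hpl) hφ, pd_conj hpl, pd_plane] at h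
  rw [integral_add] at h
  · rw [eq_neg_of_add_eq_zero_right h, ← integral_const_mul, ← integral_neg]
    refine integral_congr_ae (Eventually.of_forall fun x => ?_)
    simp only [map_mul, Complex.conj_ofReal, Complex.conj_I]
    ring
  · refine integrableOn_box (Continuous.mul ?_ hφ.continuous)
    exact (contDiff_conj (contDiff_const.mul hpl)).continuous
  · exact integrableOn_box ((contDiff_conj hpl).mul (contDiff_pd hφ i k)).continuous

/-- The kinetic energies of the plane waves. -/
def planeEnergy (L : ℝ) (n : Fin N × Fin 3 → ℤ) : ℝ := ∑ p, waveNumber L n p ^ 2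

/-- Differentiation multiplies a Fourier coefficient by `i` times the wave number, so Bessel applied
to each partial derivative, summed over all coordinates, bounds the weighted sum. -/
theorem sum_planeEnergy_mul_le {φ : Config N → ℂ} (hφ : ContDiff ℝ ∞ φ) (pφ : IsPeriodic L φ)
    {u : Lp ℂ 2 (boxMeasure N L)} (hu : u =ᵐ[boxMeasure N L] φ)
    (s : Finset (Fin N × Fin 3 → ℤ)) :
    ∑ n ∈ s, planeEnergy L n * ‖inner ℂ (planeLp N L n) u‖ ^ 2 ≤
      ∑ i, ∑ k, ∫ x in box N L, ‖pd i k φ x‖ ^ 2 := by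
  simp only [planeEnergy, Finset.sum_mul]
  rw [Finset.sum_comm, ← Fintype.sum_prod_type']
  refine Finset.sum_le_sum fun p _ => ?_
  have hm := memLp_of_continuous (L := L) (contDiff_pd hφ p.1 p.2).continuous
  have h1 := orthonormal_planeLp.sum_inner_products_le (x := hm.toLp _) (s := s)
  have h2 : ‖hm.toLp (pd p.1 p.2 φ)‖ ^ 2 = ∫ x in box N L, ‖pd p.1 p.2 φ x‖ ^ 2 := by
    rw [norm_sq_eq_integral]
    refine integral_congr_ae ?_
    filter_upwards [hm.coeFn_toLp] with x hx
    rw [hx]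
  rw [h2] at h1
  refine le_trans (le_of_eq (Finset.sum_congr rfl fun n _ => ?_)) h1
  rw [inner_planeLp hm.coeFn_toLp, inner_planeLp hu, integral_conj_plane_mul_pd hφ pφ]
  simp only [norm_mul, Complex.norm_I, Complex.norm_real, Real.norm_eq_abs, mul_pow, sq_abs]
  ring

theorem finite_planeEnergy_le (C : ℝ) : {n : Fin N × Fin 3 → ℤ | planeEnergy L n ≤ C}.Finite := by
  have hL' := hL.out
  refine (Set.Finite.pi' (t := fun _ : Fin N × Fin 3 =>
    Set.Icc (-⌈C * (L / (2 * Real.pi)) ^ 2⌉) ⌈C * (L / (2 * Real.pi)) ^ 2⌉)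
    fun _ => Set.finite_Icc _ _).subset ?_
  intro n hn p
  have h1 : waveNumber L n p ^ 2 ≤ C :=
    (Finset.single_le_sum (f := fun p => waveNumber L n p ^ 2) (fun _ _ => sq_nonneg _)
      (Finset.mem_univ p)).trans hn
  have h2 : ((n p : ℤ) : ℝ) ^ 2 = waveNumber L n p ^ 2 * (L / (2 * Real.pi)) ^ 2 := by
    rw [waveNumber]
    have := Real.pi_pos
    field_simp
  have h3 : ((n p : ℤ) : ℝ) ^ 2 ≤ C * (L / (2 * Real.pi)) ^ 2 := by
    rw [h2]; gcongr
  have h4 : (n p) ^ 2 ≤ ⌈C * (L / (2 * Real.pi)) ^ 2⌉ := by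
    have := h3.trans (Int.le_ceil _)
    exact_mod_cast this
  have h5 : |n p| ≤ (n p) ^ 2 := by
    rw [← sq_abs]
    exact Int.le_self_sq _
  exact abs_le.1 (h5.trans h4)

end PlaneWaves

/-! ### Density of the plane waves. -/

section Density

variable {N : ℕ} {L : ℝ}

/-- The coordinates in units of `L`, on the unit torus. -/
def unitCoordinates (N : ℕ) (L : ℝ) : C(Config N, UnitAddTorus (Fin N × Fin 3)) where
  toFun x p := ((x p.1 p.2 / L : ℝ) : UnitAddCircle)
  continuous_toFun := continuous_pi fun p => (AddCircle.continuous_mk' 1).comp (by fun_prop)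

theorem plane_eq_mFourier (n : Fin N × Fin 3 → ℤ) (x : Config N) :
    plane L n x = UnitAddTorus.mFourier n (unitCoordinates N L x) := by
  simp only [plane, UnitAddTorus.mFourier, unitCoordinates, ContinuousMap.coe_mk, fourier_coe_apply,
    ← Complex.exp_sum]
  congr 1
  rw [Complex.ofReal_sum, Finset.sum_mul]
  refine Finset.sum_congr rfl fun p _ => ?_
  simp only [waveNumber]
  push_cast
  ring

variable [hL : Fact (0 < L)]

/-- Continuous periodic functions are continuous functions on the unit torus. -/
theorem exists_continuousMap_unitAddTorus {φ : Config N → ℂ} (hφ : Continuous φ)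
    (pφ : IsPeriodic L φ) :
    ∃ Φ : C(UnitAddTorus (Fin N × Fin 3), ℂ), ∀ x, Φ (unitCoordinates N L x) = φ x := by
  have hL' := hL.out
  set A : (Fin N × Fin 3 → ℝ) → Config N := fun t i => WithLp.toLp 2 fun k => L * t (i, k)
  have hA : Continuous A := continuous_pi fun i => (PiLp.continuous_toLp 2 _).comp (by fun_prop)
  set q : (Fin N × Fin 3 → ℝ) → UnitAddTorus (Fin N × Fin 3) :=
    Pi.map fun _ (t : ℝ) => (t : UnitAddCircle)
  have hq : IsOpenQuotientMap q :=
    IsOpenQuotientMap.piMap fun _ => QuotientAddGroup.isOpenQuotientMap_mk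
  have hfib : ∀ t t', q t = q t' → φ (A t) = φ (A t') := by
    intro t t' h
    refine pφ.apply_eq (funext fun i => funext fun k => ?_)
    have h1 : ((t (i, k) - t' (i, k) : ℝ) : UnitAddCircle) = 0 := by
      rw [AddCircle.coe_sub, sub_eq_zero]
      exact congrFun h (i, k)
    obtain ⟨n, hn⟩ := (AddCircle.coe_eq_zero_iff 1).1 h1
    have h2 : ((L * t (i, k) - L * t' (i, k) : ℝ) : AddCircle L) = 0 := by
      refine (AddCircle.coe_eq_zero_iff L).2 ⟨n, ?_⟩
      rw [← mul_sub, ← hn]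
      simp [mul_comm]
    rw [AddCircle.coe_sub, sub_eq_zero] at h2
    exact h2
  -- The section `r` is merely set-theoretic. Continuity of the induced function is checked after
  -- composing with the quotient map, where `r` disappears by periodicity.
  choose r hr using hq.surjective
  have hΦ : ∀ t, φ (A (r (q t))) = φ (A t) := fun t => hfib _ _ (hr (q t))
  have hcont : Continuous fun y => φ (A (r y)) := by
    rw [hq.isQuotientMap.continuous_iff]
    exact (hφ.comp hA).congr fun t => (hΦ t).symm
  refine ⟨⟨_, hcont⟩, fun x => ?_⟩
  have h1 : unitCoordinates N L x = q fun p => x p.1 p.2 / L := rfl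
  rw [h1]
  refine (hΦ _).trans ?_
  congr 1
  funext i
  ext k
  simp only [A]
  exact mul_div_cancel₀ _ hL'.ne'

/-- Trigonometric polynomials are uniformly dense among continuous functions on the unit torus, and
the passage to square-integrable functions on the box is continuous for the sup norm. -/
theorem mem_closure_span_planeLp {φ : Config N → ℂ} (hφ : Continuous φ) (pφ : IsPeriodic L φ)
    {u : Lp ℂ 2 (boxMeasure N L)} (hu : u =ᵐ[boxMeasure N L] φ) :
    u ∈ (Submodule.span ℂ (Set.range (planeLp N L))).topologicalClosure := by
  obtain ⟨Φ, hΦ⟩ := exists_continuousMap_unitAddTorus hφ pφ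
  set T : C(UnitAddTorus (Fin N × Fin 3), ℂ) → Lp ℂ 2 (boxMeasure N L) := fun g =>
    BoundedContinuousFunction.toLp 2 (boxMeasure N L) ℂ
      ((BoundedContinuousFunction.mkOfCompact g).compContinuous (unitCoordinates N L)) with hT
  have hTc : Continuous T := by
    refine (ContinuousLinearMap.continuous _).comp
      ((BoundedContinuousFunction.continuous_compContinuous _).comp ?_)
    exact (ContinuousMap.isometryEquivBoundedOfCompact _ _).continuous
  have hTae : ∀ g, T g =ᵐ[boxMeasure N L] fun x => g (unitCoordinates N L x) := fun g =>
    BoundedContinuousFunction.coeFn_toLp ..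
  have hTΦ : T Φ = u := by
    refine Lp.ext ((hTae Φ).trans ?_)
    filter_upwards [hu] with x hx
    rw [hΦ, hx]
  have hV : planeNormalization N L ≠ 0 :=
    inv_ne_zero (Real.sqrt_pos.2 (volume_box_pos (N := N) (L := L))).ne'
  have hspan : ∀ g ∈ Submodule.span ℂ (Set.range (UnitAddTorus.mFourier (d := Fin N × Fin 3))),
      T g ∈ Submodule.span ℂ (Set.range (planeLp N L)) := by
    intro g hg
    induction hg using Submodule.span_induction with
    | mem g hg =>
      obtain ⟨n, rfl⟩ := hg
      have e : T (UnitAddTorus.mFourier n) = (planeNormalization N L : ℂ)⁻¹ • planeLp N L n := by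
        refine Lp.ext ((hTae _).trans ?_)
        filter_upwards [Lp.coeFn_smul (planeNormalization N L : ℂ)⁻¹ (planeLp N L n),
          coeFn_planeLp n] with x h1 h2
        rw [h1, Pi.smul_apply, h2, smul_eq_mul, inv_mul_cancel_left₀ (by exact_mod_cast hV),
          plane_eq_mFourier]
      rw [e]
      exact Submodule.smul_mem _ _ (Submodule.subset_span ⟨n, rfl⟩)
    | zero =>
      have e : T 0 = 0 := by
        refine Lp.ext ((hTae _).trans ?_)
        filter_upwards [Lp.coeFn_zero ℂ 2 (boxMeasure N L)] with x h1
        rw [h1]; rfl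
      rw [e]
      exact Submodule.zero_mem _
    | add f g _ _ h1 h2 =>
      have e : T (f + g) = T f + T g := by
        refine Lp.ext ((hTae _).trans ?_)
        filter_upwards [Lp.coeFn_add (T f) (T g), hTae f, hTae g] with x e1 e2 e3
        rw [e1, Pi.add_apply, e2, e3]; rfl
      rw [e]
      exact Submodule.add_mem _ h1 h2
    | smul c f _ h1 =>
      have e : T (c • f) = c • T f := by
        refine Lp.ext ((hTae _).trans ?_)
        filter_upwards [Lp.coeFn_smul c (T f), hTae f] with x e1 e2
        rw [e1, Pi.smul_apply, e2]; rfl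
      rw [e]
      exact Submodule.smul_mem _ _ h1
  have hmem : Φ ∈ closure (Submodule.span ℂ
      (Set.range (UnitAddTorus.mFourier (d := Fin N × Fin 3))) : Set _) := by
    have h := UnitAddTorus.span_mFourier_closure_eq_top (d := Fin N × Fin 3)
    have h2 : Φ ∈ (Submodule.span ℂ
        (Set.range (UnitAddTorus.mFourier (d := Fin N × Fin 3)))).topologicalClosure := by
      rw [h]; trivial
    exact h2
  rw [← hTΦ]
  exact map_mem_closure hTc hmem hspan

/-- The modes live in the full `L²` space rather than the symmetric subspace. Symmetrizing them is
unnecessary for an upper bound on the trace: the price is the partition function of distinguishable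
free particles. -/
theorem isModeBound_coreSubmodule {W : EuclideanSpace ℝ (Fin 3) → ℝ} (hW : Measurable W)
    (hW0 : ∀ z, 0 ≤ W z) {C : ℝ} (hC : ∀ z, |W z| ≤ C) :
    IsModeBound (coreSubmodule (isCore_periodic N L) W) (bosonSpace N L).subtypeₗᵢ (planeLp N L)
      (planeEnergy L) where
  orthonormal := orthonormal_planeLp
  finite := finite_planeEnergy_le
  nonneg n := Finset.sum_nonneg fun p _ => sq_nonneg _
  bound := by
    rintro p ⟨φ, hφ, h1, h2⟩ s
    rw [(isCore_periodic N L).re_inner_eq hW hC hφ h1 h2]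
    refine (sum_planeEnergy_mul_le hφ.1 hφ.2.2 h1 s).trans (le_add_of_nonneg_right ?_)
    exact integral_nonneg fun x => mul_nonneg (pairSum_nonneg hW0 x) (by positivity)
  mem_closure := by
    rintro p ⟨φ, hφ, h1, h2⟩
    exact mem_closure_span_planeLp hφ.1.continuous hφ.2.2 h1

end Density

/-! ### Bounds on the partition functions and the free energies. -/

section PartitionFunctions

theorem tsum_prod_le {ι : Type*} [Fintype ι] {κ : Type*} (a : κ → ℝ≥0∞) :
    ∑' n : ι → κ, ∏ p, a (n p) ≤ (∑' k, a k) ^ Fintype.card ι := by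
  classical
  rw [ENNReal.tsum_eq_iSup_sum]
  refine iSup_le fun s => ?_
  set t : ι → Finset κ := fun p => s.image fun n => n p
  have hs : s ⊆ Fintype.piFinset t := fun n hn =>
    Fintype.mem_piFinset.2 fun p => Finset.mem_image_of_mem _ hn
  calc ∑ n ∈ s, ∏ p, a (n p) ≤ ∑ n ∈ Fintype.piFinset t, ∏ p, a (n p) :=
        Finset.sum_le_sum_of_subset hs
    _ = ∏ p, ∑ k ∈ t p, a k := (Finset.prod_univ_sum t fun _ => a).symm
    _ ≤ ∏ _p : ι, ∑' k, a k := Finset.prod_le_prod' fun p _ => ENNReal.sum_le_tsum _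
    _ = (∑' k, a k) ^ Fintype.card ι := by rw [Finset.prod_const, Finset.card_univ]

/-- Since `|k| ≤ k²` for integers, the Gaussian sum is below a two-sided geometric series. Its value
`1 + 2r/(1-r)` with `r = exp(-b)` is at most `1 + 2/b`, because `exp b ≥ 1 + b`. -/
theorem tsum_exp_neg_sq_le {b : ℝ} (hb : 0 < b) :
    ∑' k : ℤ, ENNReal.ofReal (Real.exp (-b * (k : ℝ) ^ 2)) ≤ ENNReal.ofReal (1 + 2 / b) := by
  set r := Real.exp (-b) with hr
  have hr0 : 0 ≤ r := (Real.exp_pos _).le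
  have hr1 : r < 1 := by
    rw [hr, ← Real.exp_zero]
    exact Real.exp_lt_exp.2 (by linarith)
  have hgeo := hasSum_geometric_of_lt_one hr0 hr1
  have hsum : HasSum (fun k : ℤ => r ^ k.natAbs) ((1 - r)⁻¹ + r * (1 - r)⁻¹) := by
    refine HasSum.of_nat_of_neg_add_one ?_ ?_
    · simpa using hgeo
    · have h := hgeo.mul_left r
      refine h.congr_fun fun n => ?_
      have : (-((n : ℤ) + 1)).natAbs = n + 1 := by omega
      rw [this, pow_succ, mul_comm]
  have hterm : ∀ k : ℤ, Real.exp (-b * (k : ℝ) ^ 2) ≤ r ^ k.natAbs := by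
    intro k
    rw [hr, ← Real.exp_nat_mul]
    refine Real.exp_le_exp.2 ?_
    have h1 : (k.natAbs : ℝ) ≤ (k : ℝ) ^ 2 := by
      have h2 : |k| ≤ k ^ 2 := by
        rw [← sq_abs]
        exact Int.le_self_sq _
      rw [Nat.cast_natAbs]
      exact_mod_cast h2
    nlinarith
  calc ∑' k : ℤ, ENNReal.ofReal (Real.exp (-b * (k : ℝ) ^ 2))
      ≤ ∑' k : ℤ, ENNReal.ofReal (r ^ k.natAbs) :=
        ENNReal.tsum_le_tsum fun k => ENNReal.ofReal_le_ofReal (hterm k)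
    _ = ENNReal.ofReal ((1 - r)⁻¹ + r * (1 - r)⁻¹) := by
        rw [← ENNReal.ofReal_tsum_of_nonneg (fun k => pow_nonneg hr0 _) hsum.summable, hsum.tsum_eq]
    _ ≤ ENNReal.ofReal (1 + 2 / b) := by
        refine ENNReal.ofReal_le_ofReal ?_
        have h1 : 0 < 1 - r := by linarith
        have h2 : r * (1 + b) ≤ 1 := by
          have h3 : 1 + b ≤ Real.exp b := by linarith [Real.add_one_le_exp b]
          calc r * (1 + b) ≤ r * Real.exp b := by gcongr
            _ = 1 := by rw [hr, ← Real.exp_add]; simp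
        have h4 : (1 - r)⁻¹ + r * (1 - r)⁻¹ = 1 + 2 * (r / (1 - r)) := by
          field_simp; ring
        have h5 : r / (1 - r) ≤ 1 / b := by
          rw [div_le_div_iff₀ h1 hb]; linarith
        rw [h4, show 2 / b = 2 * (1 / b) by ring]
        linarith

theorem tsum_exp_planeEnergy_le {N : ℕ} {L β : ℝ} (hL : 0 < L) (hβ : 0 < β) :
    ∑' n : Fin N × Fin 3 → ℤ, ENNReal.ofReal (Real.exp (-β * planeEnergy L n)) ≤
      ENNReal.ofReal ((1 + 2 / (β * (2 * Real.pi / L) ^ 2)) ^ (3 * N)) := by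
  have hb : 0 < β * (2 * Real.pi / L) ^ 2 := by have := Real.pi_pos; positivity
  have e : ∀ n : Fin N × Fin 3 → ℤ, ENNReal.ofReal (Real.exp (-β * planeEnergy L n)) =
      ∏ p, ENNReal.ofReal (Real.exp (-(β * (2 * Real.pi / L) ^ 2) * ((n p : ℤ) : ℝ) ^ 2)) := by
    intro n
    rw [← ENNReal.ofReal_prod_of_nonneg fun p _ => (Real.exp_pos _).le, ← Real.exp_sum,
      planeEnergy, Finset.mul_sum]
    congr 2
    refine Finset.sum_congr rfl fun p _ => ?_
    rw [waveNumber]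
    ring
  simp_rw [e]
  refine (tsum_prod_le fun k : ℤ =>
    ENNReal.ofReal (Real.exp (-(β * (2 * Real.pi / L) ^ 2) * (k : ℝ) ^ 2))).trans ?_
  rw [ENNReal.ofReal_pow (by positivity)]
  have hc : Fintype.card (Fin N × Fin 3) = 3 * N := by simp [mul_comm]
  rw [hc]
  exact pow_le_pow_left' (tsum_exp_neg_sq_le hb) _

/-- Comparison of the partition functions with Dirichlet and periodic boundary conditions. -/
theorem exists_partition_comparison : ∃ C : ℝ, 0 ≤ C ∧
    ∀ (V : EuclideanSpace ℝ (Fin 3) → ℝ), Measurable V → (∀ x y, ‖x‖ = ‖y‖ → V x = V y) →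
    (∀ x, 0 ≤ V x) → (∃ B, ∀ x, V x ≤ B) → ∀ R₀ : ℝ, (∀ x, R₀ < ‖x‖ → V x = 0) →
    ∀ (N M : ℕ) (L L' β : ℝ), 0 < L → 0 < M → 2 * R₀ < L → L + L / M ≤ L' → 0 < β →
      ENNReal.ofReal (Real.exp (-β * (3 * N * C * M / L ^ 2))) *
          trace (expNeg β (periodicHamiltonian V N L)) ≤
        trace (expNeg β (dirichletHamiltonian V N L')) ∧
      trace (expNeg β (periodicHamiltonian V N L)) ≤
        ENNReal.ofReal ((1 + 2 / (β * (2 * Real.pi / L) ^ 2)) ^ (3 * N)) := by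
  obtain ⟨C, hC, hcut⟩ := exists_isCutoff
  refine ⟨C, hC, fun V hV hVr hV0 ⟨B, hB⟩ R₀ hR N M L L' β hL hM hRL hL' hβ => ?_⟩
  have : Fact (0 < L) := ⟨hL⟩
  have hM' : (0 : ℝ) < M := by exact_mod_cast hM
  have hM1 : (1 : ℝ) ≤ M := by exact_mod_cast hM
  set δ := L / M with hδ
  have hδ0 : 0 < δ := div_pos hL hM'
  have hδL : δ ≤ L := div_le_self hL.le hM1
  obtain ⟨h, hh⟩ := hcut L δ hδ0 hδL
  have hVB : ∀ z, |V z| ≤ B := fun z => by rw [abs_of_nonneg (hV0 z)]; exact hB z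
  have hVe : ∀ z, V (-z) = V z := fun z => hVr _ _ (norm_neg z)
  have hWm : Measurable fun z => V (torusRep L z) := hV.comp (measurable_torusRep L)
  have hJ := fun m : Fin M => exists_isCoreMap (N := N) hh hC hδ0 hδL hL' hV hV0 hB hVe
    (le_comp_torusRep hV0 hR hRL) (s := m * δ) (by positivity) (by
      have h1 : ((m : ℕ) : ℝ) + 1 ≤ M := by exact_mod_cast m.2
      have h2 : (((m : ℕ) : ℝ) + 1) * δ ≤ M * δ := by gcongr
      have h3 : M * δ = L := by rw [hδ]; field_simp
      linarith)
  choose J hJ using hJ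
  have hmode := isModeBound_coreSubmodule (N := N) (L := L) hWm (fun z => hV0 _) (fun z => hVB _)
  have hS := isNonnegSymmetric_coreSubmodule (isCore_periodic N L) hWm (fun z => hV0 _)
    (fun z => hVB _)
  have hS' := isNonnegSymmetric_coreSubmodule (isCore_dirichlet N L') hV hV0 hVB
  -- The total error `3NC/δ²` of the `M` translates equals `M ε`, as `δ = L/M`.
  have hmain := trace_comparison hmode hS hS' hβ hM hJ (ε := 3 * N * C * M / L ^ 2) fun u => by
    refine (sum_localizationError_le hC δ hδ0 M u).trans_eq ?_
    rw [hδ]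
    field_simp
  exact ⟨hmain.1, hmain.2.trans (tsum_exp_planeEnergy_le hL hβ)⟩

/-- The difference of the volume prefactors multiplies `log Z` with a nonnegative coefficient, so an
upper bound on `Z` is what controls it; the energy error only enters through `ε / vol'`. -/
theorem freeEnergyOf_sub_le {vol vol' β ε B : ℝ} (hvol : 0 < vol) (hvv : vol ≤ vol') (hβ : 0 < β)
    (hB : 1 ≤ B) {Z Z' : ℝ≥0∞} (hZ : ENNReal.ofReal (Real.exp (-β * ε)) * Z ≤ Z')
    (hZB : Z ≤ ENNReal.ofReal B) :
    freeEnergyOf vol' β Z' - freeEnergyOf vol β Z ≤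
      ((((vol * β)⁻¹ - (vol' * β)⁻¹) * Real.log B + ε / vol' : ℝ) : EReal) := by
  have hvol' : 0 < vol' := hvol.trans_le hvv
  -- If `Z = 0` the subtracted free energy is `⊤`, and `EReal` subtraction of `⊤` gives `⊥` whatever
  -- the other term is.
  by_cases hZ0 : Z = 0
  · have h1 : freeEnergyOf vol β Z = ⊤ := by
      rw [freeEnergyOf, hZ0, ENNReal.log_zero, EReal.coe_mul_bot_of_pos (by positivity),
        EReal.neg_bot]
    rw [h1, EReal.sub_top]
    exact bot_le
  have hZt : Z ≠ ⊤ := ne_top_of_le_ne_top ENNReal.ofReal_ne_top hZB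
  have hz : 0 < Z.toReal := ENNReal.toReal_pos hZ0 hZt
  have hzB : Z.toReal ≤ B := ENNReal.toReal_le_of_le_ofReal (by linarith) hZB
  have hZe : Z = ENNReal.ofReal Z.toReal := (ENNReal.ofReal_toReal hZt).symm
  have e1 : freeEnergyOf vol β Z = ((-((vol * β)⁻¹ * Real.log Z.toReal) : ℝ) : EReal) := by
    rw [freeEnergyOf, hZe, ENNReal.log_ofReal_of_pos hz, ENNReal.toReal_ofReal hz.le]
    norm_cast
  have e2 : freeEnergyOf vol' β Z' ≤
      ((-((vol' * β)⁻¹ * (-β * ε + Real.log Z.toReal)) : ℝ) : EReal) := by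
    rw [hZe, ← ENNReal.ofReal_mul (Real.exp_pos _).le] at hZ
    have h1 := ENNReal.log_monotone hZ
    rw [ENNReal.log_ofReal_of_pos (by positivity), Real.log_mul (Real.exp_pos _).ne' hz.ne',
      Real.log_exp] at h1
    rw [EReal.coe_neg, EReal.coe_mul]
    exact EReal.neg_le_neg_iff.2 (mul_le_mul_of_nonneg_left h1
      (by exact_mod_cast (by positivity : (0 : ℝ) ≤ (vol' * β)⁻¹)))
  rw [e1]
  refine (EReal.sub_le_sub e2 le_rfl).trans ?_
  rw [← EReal.coe_sub, EReal.coe_le_coe_iff]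
  have h1 : Real.log Z.toReal ≤ Real.log B := Real.log_le_log hz hzB
  have h2 : (vol' * β)⁻¹ ≤ (vol * β)⁻¹ := by gcongr
  have h3 : (vol' * β)⁻¹ * (β * ε) = ε / vol' := by field_simp
  have h4 := mul_le_mul_of_nonneg_left h1 (sub_nonneg.2 h2)
  linarith

end PartitionFunctions

/-! ### Powers of the density. -/

section ThermodynamicScaling

theorem side_boxVol {ρ : ℝ} (hρ : 0 < ρ) : side (boxVol ρ) = ρ ^ (-(41 / 60) : ℝ) := by
  rw [side, boxVol, ← Real.rpow_mul hρ.le]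
  norm_num

theorem side_boxVolStar {ρ : ℝ} (hρ : 0 < ρ) :
    side (boxVolStar ρ) = ρ ^ (-(41 / 60) : ℝ) * (1 + 2 * ρ ^ (41 / 120 : ℝ)) := by
  have h1 : 0 ≤ 1 + 2 * ρ ^ (41 / 120 : ℝ) := by positivity
  rw [boxVolStar, side,
    Real.mul_rpow (show 0 ≤ boxVol ρ from (Real.rpow_pos_of_pos hρ _).le) (by positivity),
    ← Real.rpow_natCast, ← Real.rpow_mul h1]
  have h2 := side_boxVol hρ
  rw [side] at h2
  rw [h2]
  norm_num

theorem densityStar_mul_boxVolStar {ρ : ℝ} (hρ : 0 < ρ) :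
    densityStar ρ * boxVolStar ρ = ρ * boxVol ρ := by
  have h1 : (1 + 2 * ρ ^ (41 / 120 : ℝ)) ^ 3 ≠ 0 := by positivity
  rw [densityStar, boxVolStar]
  field_simp

theorem mul_boxVol {ρ : ℝ} (hρ : 0 < ρ) : ρ * boxVol ρ = ρ ^ (-(21 / 20) : ℝ) := by
  rw [boxVol]
  nth_rewrite 1 [← Real.rpow_one ρ]
  rw [← Real.rpow_add hρ]
  norm_num

theorem freeEnergyD_eq (V : EuclideanSpace ℝ (Fin 3) → ℝ) (β : ℝ) {ρ vol L : ℝ} {N : ℕ}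
    (hN : particleNumber ρ vol = N) (hL : side vol = L) :
    freeEnergyD V ρ vol β = freeEnergyOf vol β (trace (expNeg β (dirichletHamiltonian V N L))) := by
  subst hN; subst hL; rfl

theorem freeEnergyP_eq (V : EuclideanSpace ℝ (Fin 3) → ℝ) (β : ℝ) {ρ vol L : ℝ} {N : ℕ}
    (hN : particleNumber ρ vol = N) (hL : side vol = L) :
    freeEnergyP V ρ vol β = freeEnergyOf vol β (trace (expNeg β (periodicHamiltonian V N L))) := by
  subst hN; subst hL; rfl

/-- The bound on the difference of the free energies in terms of the density. -/
theorem scaled_error_le {ρ β c C B ε κ vol vol' : ℝ} {n : ℕ} (hρ : 0 < ρ) (hρ1 : ρ ≤ 1) (hc : 0 < c)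
    (hC : 0 ≤ C) (hκ : κ = ρ ^ (41 / 120 : ℝ)) (hn : (n : ℝ) = ρ ^ (-(21 / 20) : ℝ))
    (hvol : vol = ρ ^ (-(41 / 20) : ℝ)) (hvol' : vol' = vol * (1 + 2 * κ) ^ 3)
    (hβ : c * ρ ^ (-(2 / 3) : ℝ) ≤ β)
    (hB : B = (1 + 2 / (β * (2 * Real.pi / ρ ^ (-(41 / 60) : ℝ)) ^ 2)) ^ (3 * n))
    (hε : ε ≤ 3 * n * C * κ⁻¹ / (ρ ^ (-(41 / 60) : ℝ)) ^ 2) :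
    (((vol * β)⁻¹ - (vol' * β)⁻¹) * Real.log B + ε / vol') * ρ ^ (-2 : ℝ) ≤
      1800 * c⁻¹ * (1 + 2 / c) ^ (1 / 100 : ℝ) * ρ ^ (1 / 750 : ℝ) + 3 * C * ρ ^ (1 / 40 : ℝ) := by
  have hκ0 : 0 < κ := hκ ▸ Real.rpow_pos_of_pos hρ _
  have hv0 : 0 < vol := hvol ▸ Real.rpow_pos_of_pos hρ _
  have hβ0 : 0 < β := lt_of_lt_of_le (mul_pos hc (Real.rpow_pos_of_pos hρ _)) hβ
  have hvv : vol ≤ vol' := by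
    rw [hvol']
    exact le_mul_of_one_le_right hv0.le (one_le_pow₀ (by linarith))
  have hv0' : 0 < vol' := hv0.trans_le hvv
  set A := 1 + 2 / (β * (2 * Real.pi / ρ ^ (-(41 / 60) : ℝ)) ^ 2) with hA
  have hA1 : 1 ≤ A := by
    rw [hA]
    have : 0 ≤ 2 / (β * (2 * Real.pi / ρ ^ (-(41 / 60) : ℝ)) ^ 2) := by positivity
    linarith
  -- The exponent is `41/30 - 2/3 = 7/10`: the mode spacing `(2π/ℓ)²` times `β`.
  have hAle : A ≤ (1 + 2 / c) * ρ ^ (-(7 / 10) : ℝ) := by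
    have h1 : (2 * Real.pi / ρ ^ (-(41 / 60) : ℝ)) ^ 2 = (2 * Real.pi) ^ 2 * ρ ^ (41 / 30 : ℝ) := by
      rw [div_pow, ← Real.rpow_natCast (ρ ^ (-(41 / 60) : ℝ)), ← Real.rpow_mul hρ.le,
        div_eq_mul_inv, ← Real.rpow_neg hρ.le]
      norm_num
    have h2 : (1 : ℝ) ≤ (2 * Real.pi) ^ 2 := by nlinarith [Real.pi_gt_three]
    have h3 : c * ρ ^ (7 / 10 : ℝ) ≤ β * (2 * Real.pi / ρ ^ (-(41 / 60) : ℝ)) ^ 2 := by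
      rw [h1]
      calc c * ρ ^ (7 / 10 : ℝ) = (c * ρ ^ (-(2 / 3) : ℝ)) * (1 * ρ ^ (41 / 30 : ℝ)) := by
            rw [one_mul, mul_assoc, ← Real.rpow_add hρ]; norm_num
        _ ≤ β * ((2 * Real.pi) ^ 2 * ρ ^ (41 / 30 : ℝ)) := by gcongr
    have h4 : 2 / (β * (2 * Real.pi / ρ ^ (-(41 / 60) : ℝ)) ^ 2) ≤ 2 / (c * ρ ^ (7 / 10 : ℝ)) := by
      gcongr
    have h5 : 2 / (c * ρ ^ (7 / 10 : ℝ)) = 2 / c * ρ ^ (-(7 / 10) : ℝ) := by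
      rw [Real.rpow_neg hρ.le]; field_simp
    have h6 : 1 ≤ ρ ^ (-(7 / 10) : ℝ) := Real.one_le_rpow_of_pos_of_le_one_of_nonpos hρ hρ1 (by norm_num)
    rw [hA, add_mul, one_mul]
    linarith
  -- The logarithm is traded for a small power, `log A ≤ 100 A^{1/100}`. The loss `7/1000` has to
  -- stay below the margin `1/120 = 41/120 - 1/3` of the volume term; what remains is `1/750`.
  have hlogB : Real.log B ≤ 300 * n * (1 + 2 / c) ^ (1 / 100 : ℝ) * ρ ^ (-(7 / 1000) : ℝ) := by
    rw [hB, Real.log_pow]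
    have h1 : Real.log A ≤ A ^ (1 / 100 : ℝ) / (1 / 100) :=
      Real.log_le_rpow_div (by linarith) (by norm_num)
    have h2 : A ^ (1 / 100 : ℝ) ≤ (1 + 2 / c) ^ (1 / 100 : ℝ) * ρ ^ (-(7 / 1000) : ℝ) := by
      refine (Real.rpow_le_rpow (by linarith) hAle (by norm_num)).trans_eq ?_
      rw [Real.mul_rpow (by positivity) (by positivity), ← Real.rpow_mul hρ.le]
      norm_num
    have h3 : Real.log A ≤ 100 * ((1 + 2 / c) ^ (1 / 100 : ℝ) * ρ ^ (-(7 / 1000) : ℝ)) := by linarith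
    calc ((3 * n : ℕ) : ℝ) * Real.log A
        ≤ ((3 * n : ℕ) : ℝ) * (100 * ((1 + 2 / c) ^ (1 / 100 : ℝ) * ρ ^ (-(7 / 1000) : ℝ))) := by
          gcongr
      _ = _ := by push_cast; ring
  have hcoef : (vol * β)⁻¹ - (vol' * β)⁻¹ ≤ 6 * κ * (vol * (c * ρ ^ (-(2 / 3) : ℝ)))⁻¹ := by
    -- The relative volume difference between the boxes is at most `6κ`.
    have h1 : 1 - 6 * κ ≤ ((1 + 2 * κ) ^ 3)⁻¹ := by
      rw [← one_div, le_div_iff₀ (by positivity)]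
      nlinarith [pow_pos hκ0 2, pow_pos hκ0 3, pow_pos hκ0 4]
    have h2 : (vol' * β)⁻¹ = (vol * β)⁻¹ * ((1 + 2 * κ) ^ 3)⁻¹ := by
      rw [hvol', ← mul_inv]; ring
    have h3 : 0 < (vol * β)⁻¹ := by positivity
    have h4 : (vol * β)⁻¹ ≤ (vol * (c * ρ ^ (-(2 / 3) : ℝ)))⁻¹ := by gcongr
    rw [h2]
    calc (vol * β)⁻¹ - (vol * β)⁻¹ * ((1 + 2 * κ) ^ 3)⁻¹ = (vol * β)⁻¹ * (1 - ((1 + 2 * κ) ^ 3)⁻¹) := by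
          ring
      _ ≤ (vol * β)⁻¹ * (6 * κ) := by gcongr; linarith
      _ ≤ (vol * (c * ρ ^ (-(2 / 3) : ℝ)))⁻¹ * (6 * κ) := by gcongr
      _ = _ := by ring
  have hlog0 : 0 ≤ Real.log B := Real.log_nonneg (hB ▸ one_le_pow₀ hA1)
  have hεv : ε / vol' ≤ 3 * n * C * κ⁻¹ / (ρ ^ (-(41 / 60) : ℝ)) ^ 2 / vol := by gcongr
  have hR : 0 < ρ ^ (-2 : ℝ) := Real.rpow_pos_of_pos hρ _
  have hmono : (((vol * β)⁻¹ - (vol' * β)⁻¹) * Real.log B + ε / vol') * ρ ^ (-2 : ℝ) ≤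
      (6 * κ * (vol * (c * ρ ^ (-(2 / 3) : ℝ)))⁻¹ *
        (300 * n * (1 + 2 / c) ^ (1 / 100 : ℝ) * ρ ^ (-(7 / 1000) : ℝ)) +
        3 * n * C * κ⁻¹ / (ρ ^ (-(41 / 60) : ℝ)) ^ 2 / vol) * ρ ^ (-2 : ℝ) := by
    refine mul_le_mul_of_nonneg_right (add_le_add ?_ hεv) hR.le
    exact mul_le_mul hcoef hlogB hlog0 (by positivity)
  refine hmono.trans_eq ?_
  have e1 : ρ ^ (41 / 120 : ℝ) * ρ ^ (41 / 20 : ℝ) * ρ ^ (2 / 3 : ℝ) * ρ ^ (-(21 / 20) : ℝ) *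
      ρ ^ (-(7 / 1000) : ℝ) * ρ ^ (-2 : ℝ) = ρ ^ (1 / 750 : ℝ) := by
    simp only [← Real.rpow_add hρ]; norm_num
  have e2 : ρ ^ (-(21 / 20) : ℝ) * ρ ^ (-(41 / 120) : ℝ) * ρ ^ (41 / 30 : ℝ) * ρ ^ (41 / 20 : ℝ) *
      ρ ^ (-2 : ℝ) = ρ ^ (1 / 40 : ℝ) := by
    simp only [← Real.rpow_add hρ]; norm_num
  have e3 : ((ρ ^ (-(41 / 60) : ℝ)) ^ 2)⁻¹ = ρ ^ (41 / 30 : ℝ) := by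
    rw [← Real.rpow_natCast, ← Real.rpow_mul hρ.le, ← Real.rpow_neg hρ.le]
    norm_num
  have e4 : vol⁻¹ = ρ ^ (41 / 20 : ℝ) := by
    rw [hvol, ← Real.rpow_neg hρ.le, neg_neg]
  have e5 : κ⁻¹ = ρ ^ (-(41 / 120) : ℝ) := by rw [hκ, ← Real.rpow_neg hρ.le]
  have e6 : (ρ ^ (-(2 / 3) : ℝ))⁻¹ = ρ ^ (2 / 3 : ℝ) := by rw [← Real.rpow_neg hρ.le, neg_neg]
  rw [← e1, ← e2, div_eq_mul_inv _ ((ρ ^ (-(41 / 60) : ℝ)) ^ 2), div_eq_mul_inv _ vol, e3, mul_inv, mul_inv, e4, e5, e6, hn, hκ]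
  ring

/-- For an admissible density, the scaled difference of the free energies is bounded by the
localization error. -/
theorem exists_freeEnergy_sub_le {V : EuclideanSpace ℝ (Fin 3) → ℝ} (hV : Measurable V)
    (hVr : ∀ x y, ‖x‖ = ‖y‖ → V x = V y) (hV0 : ∀ x, 0 ≤ V x) (hVb : ∃ B, ∀ x, V x ≤ B)
    {R₀ : ℝ} (hR : ∀ x, R₀ < ‖x‖ → V x = 0) {c : ℝ} (hc : 0 < c) :
    ∃ K₁ K₂ : ℝ, ∀ ρ ∈ admissibleDensities, ∀ β : ℝ, c * ρ ^ (-(2 / 3) : ℝ) ≤ β →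
      ρ ^ (41 / 120 : ℝ) ≤ 1 / 2 → 2 * R₀ < ρ ^ (-(41 / 60) : ℝ) →
      (freeEnergyD V (densityStar ρ) (boxVolStar ρ) β - freeEnergyP V ρ (boxVol ρ) β) *
          ((ρ ^ (-2 : ℝ) : ℝ) : EReal) ≤
        ((K₁ * ρ ^ (1 / 750 : ℝ) + K₂ * ρ ^ (1 / 40 : ℝ) : ℝ) : EReal) := by
  obtain ⟨C, hC, hcomp⟩ := exists_partition_comparison
  refine ⟨1800 * c⁻¹ * (1 + 2 / c) ^ (1 / 100 : ℝ), 3 * C, ?_⟩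
  rintro ρ ⟨hρ, n, hn⟩ β hβ hκ2 hRρ
  have hρ1 : ρ ≤ 1 := by
    by_contra h
    have := Real.one_lt_rpow (not_le.1 h) (show (0 : ℝ) < 41 / 120 by norm_num)
    linarith
  set κ := ρ ^ (41 / 120 : ℝ) with hκ
  have hκ0 : 0 < κ := Real.rpow_pos_of_pos hρ _
  set ℓ := ρ ^ (-(41 / 60) : ℝ) with hℓ
  have hℓ0 : 0 < ℓ := Real.rpow_pos_of_pos hρ _
  have hβ0 : 0 < β := lt_of_lt_of_le (mul_pos hc (Real.rpow_pos_of_pos hρ _)) hβ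
  have hN : particleNumber ρ (boxVol ρ) = n := by rw [particleNumber, hn, Nat.floor_natCast]
  have hN' : particleNumber (densityStar ρ) (boxVolStar ρ) = n := by
    rw [particleNumber, densityStar_mul_boxVolStar hρ, hn, Nat.floor_natCast]
  -- The smallest `M` for which the margin `ℓ/M` fits into the extra width `2κℓ` of the larger box;
  -- `κ ≤ 1/2` then gives `M ≤ κ⁻¹`, which enters the localization error.
  set M := ⌈1 / (2 * κ)⌉₊ with hM
  have hM0 : 0 < M := Nat.ceil_pos.2 (by positivity)
  have hMge : 1 / (2 * κ) ≤ M := Nat.le_ceil _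
  have hMle : (M : ℝ) ≤ κ⁻¹ := by
    have h1 : (M : ℝ) < 1 / (2 * κ) + 1 := Nat.ceil_lt_add_one (by positivity)
    have h2 : 1 ≤ 1 / (2 * κ) := by rw [le_div_iff₀ (by positivity)]; linarith
    have h3 : κ⁻¹ = 1 / (2 * κ) + 1 / (2 * κ) := by field_simp; norm_num
    linarith
  have hL' : ℓ + ℓ / M ≤ ℓ * (1 + 2 * κ) := by
    have h1 : ℓ / M ≤ ℓ / (1 / (2 * κ)) := by gcongr
    have h2 : ℓ / (1 / (2 * κ)) = ℓ * (2 * κ) := by field_simp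
    linarith
  have hZ := hcomp V hV hVr hV0 hVb R₀ hR n M ℓ (ℓ * (1 + 2 * κ)) β hℓ0 hM0 hRρ hL' hβ0
  have hvol : 0 < boxVol ρ := Real.rpow_pos_of_pos hρ _
  have hvol' : boxVolStar ρ = boxVol ρ * (1 + 2 * κ) ^ 3 := rfl
  have hvv : boxVol ρ ≤ boxVolStar ρ := by
    rw [hvol']
    exact le_mul_of_one_le_right hvol.le (one_le_pow₀ (by linarith))
  set B := (1 + 2 / (β * (2 * Real.pi / ℓ) ^ 2)) ^ (3 * n) with hB
  have hB1 : 1 ≤ B := by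
    refine one_le_pow₀ ?_
    have : 0 ≤ 2 / (β * (2 * Real.pi / ℓ) ^ 2) := by positivity
    linarith
  have hsub := freeEnergyOf_sub_le hvol hvv hβ0 hB1 hZ.1 hZ.2
  have hscale := scaled_error_le (n := n) hρ hρ1 hc hC hκ (by rw [← hn, mul_boxVol hρ]) rfl hvol' hβ
    hB (show 3 * n * C * M / ℓ ^ 2 ≤ 3 * n * C * κ⁻¹ / ℓ ^ 2 by gcongr)
  rw [freeEnergyD_eq V β hN' (side_boxVolStar hρ), freeEnergyP_eq V β hN (side_boxVol hρ)]
  refine (mul_le_mul_of_nonneg_right hsub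
    (by exact_mod_cast (Real.rpow_pos_of_pos hρ (-2)).le)).trans ?_
  rw [← EReal.coe_mul]
  exact EReal.coe_le_coe_iff.2 hscale

end ThermodynamicScaling

end BoseGas

end

/-! ### The limit of vanishing density. -/

theorem lemma1
    (V : EuclideanSpace ℝ (Fin 3) → ℝ)
    (hV_meas : Measurable V)
    (hV_radial : ∀ x y, ‖x‖ = ‖y‖ → V x = V y)
    (hV_nonneg : ∀ x, 0 ≤ V x)
    (hV_bdd : ∃ M : ℝ, ∀ x, V x ≤ M)
    (hV_range : ∃ R₀ : ℝ, ∀ x, R₀ < ‖x‖ → V x = 0)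
    (β : ℝ → ℝ)
    (hβ : ∃ c : ℝ, 0 < c ∧
      Tendsto (fun ρ => ρ ^ (2 / 3 : ℝ) * β ρ) (𝓝[BoseGas.admissibleDensities] 0) (𝓝 c))
    (hfP : ∃ C : ℝ, ∀ᶠ ρ in 𝓝[BoseGas.admissibleDensities] 0,
      BoseGas.freeEnergyP V ρ (BoseGas.boxVol ρ) (β ρ) ≤ ((C * ρ ^ (5 / 3 : ℝ) : ℝ) : EReal)) :
    limsup (fun ρ : ℝ =>
        (BoseGas.freeEnergyD V (BoseGas.densityStar ρ) (BoseGas.boxVolStar ρ) (β ρ)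
          - BoseGas.freeEnergyP V ρ (BoseGas.boxVol ρ) (β ρ)) * ((ρ ^ (-2 : ℝ) : ℝ) : EReal))
      (𝓝[BoseGas.admissibleDensities] 0) ≤ 0 := by
  obtain ⟨c, hc, hβ⟩ := hβ
  obtain ⟨R₀, hR⟩ := hV_range
  -- Half of the limit `c` is an eventual strict lower bound for `ρ^{2/3} β(ρ)`, so the constants
  -- can be fixed before `ρ`.
  obtain ⟨K₁, K₂, hK⟩ := BoseGas.exists_freeEnergy_sub_le hV_meas hV_radial hV_nonneg hV_bdd hR
    (half_pos hc)
  -- Along the trivial filter the limsup is `⊥`, so accumulation of the admissible densities at `0`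
  -- need not be shown.
  rcases eq_or_neBot (𝓝[BoseGas.admissibleDensities] (0 : ℝ)) with hbot | _
  · rw [hbot, limsup_bot]
    exact bot_le
  have hid : Tendsto (fun ρ : ℝ => ρ) (𝓝[BoseGas.admissibleDensities] 0) (𝓝 0) :=
    tendsto_id.mono_left nhdsWithin_le_nhds
  have hpos : ∀ᶠ ρ : ℝ in 𝓝[BoseGas.admissibleDensities] 0, ρ ∈ BoseGas.admissibleDensities :=
    self_mem_nhdsWithin
  have hpow : ∀ s : ℝ, 0 < s →
      Tendsto (fun ρ : ℝ => ρ ^ s) (𝓝[BoseGas.admissibleDensities] 0) (𝓝 0) := by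
    intro s hs
    have h := hid.rpow_const (p := s) (Or.inr hs.le)
    rwa [Real.zero_rpow hs.ne'] at h
  have hev : ∀ᶠ ρ : ℝ in 𝓝[BoseGas.admissibleDensities] 0,
      (BoseGas.freeEnergyD V (BoseGas.densityStar ρ) (BoseGas.boxVolStar ρ) (β ρ)
          - BoseGas.freeEnergyP V ρ (BoseGas.boxVol ρ) (β ρ)) * ((ρ ^ (-2 : ℝ) : ℝ) : EReal) ≤
        ((K₁ * ρ ^ (1 / 750 : ℝ) + K₂ * ρ ^ (1 / 40 : ℝ) : ℝ) : EReal) := by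
    have hRpos : 0 < (2 * |R₀| + 1)⁻¹ := by positivity
    filter_upwards [hpos, hβ.eventually_const_lt (half_lt_self hc),
      (hpow (41 / 120) (by norm_num)).eventually_le_const (show (0 : ℝ) < 1 / 2 by norm_num),
      (hpow (41 / 60) (by norm_num)).eventually_lt_const hRpos] with ρ h1 h2 h3 h4
    have hρ := h1.1
    refine hK ρ h1 (β ρ) ?_ h3 ?_
    · rw [Real.rpow_neg hρ.le, ← div_eq_mul_inv, div_le_iff₀ (Real.rpow_pos_of_pos hρ _)]
      linarith
    · rw [Real.rpow_neg hρ.le]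
      have h5 := (lt_inv_comm₀ (Real.rpow_pos_of_pos hρ _) (by positivity)).1 h4
      linarith [le_abs_self R₀]
  have hlim : Tendsto (fun ρ : ℝ => ((K₁ * ρ ^ (1 / 750 : ℝ) + K₂ * ρ ^ (1 / 40 : ℝ) : ℝ) : EReal))
      (𝓝[BoseGas.admissibleDensities] 0) (𝓝 0) := by
    have h := ((hpow (1 / 750) (by norm_num)).const_mul K₁).add
      ((hpow (1 / 40) (by norm_num)).const_mul K₂)
    rw [mul_zero, mul_zero, add_zero] at h
    exact (continuous_coe_real_ereal.tendsto 0).comp h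
  exact (limsup_le_limsup hev).trans_eq hlim.limsup_eq
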